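/- **Conventions.** An analytic space is a locally ringed space $(X,\mathcal O_X)$ over $\mathbb C$ (not assumed Hausdorff or reduced) which is locally a closed subspace of a complex manifold, defined by an ideal sheaf of finite type (equivalently, a coherent one). Complex manifolds are Hausdorff, paracompact and of pure finite dimension. An *embedding triple* of $X$ is $(U,k,D)$ with $U\subset X$ open, $D$ a complex manifold and $k:U\hookrightarrow D$ a closed embedding of ringed spaces over $\mathbb C$ such that $\mathcal O_D\to k_*\mathcal O_U$ is surjective with kernel of finite type. An *atlas* is a family $\mathcal A=(U_i,k_i,D_i)_{i\in I}$ of embedding triples, indexed by a totally ordered set $I$, such that $\mathcal U=\mathrm{cov}(\mathcal A)=(U_i)_{i\in I}$ covers $X$; then $(X,\mathcal A)$ is called a *locally embedded analytic space*. For $\alpha=(i_0<\dots<i_p)$ in $I$ put $|\alpha|=p$, $U_\alpha=U_{i_0}\cap\dots\cap U_{i_p}$, $D_\alpha=D_{i_0}\times\dots\times D_{i_p}$, let $b_\alpha:U_\alpha\to X$ be the inclusion, $k_\alpha:U_\alpha\to D_\alpha$ the diagonal embedding deduced from the $k_i$, and $\mathcal I_\alpha\subset\mathcal O_{D_\alpha}$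 its ideal (along $U_\alpha$ it is generated by the differences $f\circ\mathrm{pr}_a-g\circ\mathrm{pr}_b$, where $f$ and $g$ are holomorphic germs on $D_{i_a}$ and $D_{i_b}$ with the same pullback to $\mathcal O_X$). Let $\mathcal E^{0,q}_D$ be the sheaf of smooth forms of type $(0,q)$ on a complex manifold $D$. $\mathrm{Dolb}(\mathcal A,\mathcal O_X)$ is the complex of sheaves on $X$ associated to the double complex $$\prod_{|\alpha|=p} b_{\alpha*}\big((\mathcal E^{0,q}_{D_\alpha}/\mathcal I_\alpha\mathcal E^{0,q}_{D_\alpha})|_{U_\alpha}\big),\qquad p,q\ge 0,$$ whose total differential is $\delta+(-1)^p\bar\partial$ on the component of bidegree $(p,q)$, where $(\delta s)_\beta=\sum_j(-1)^j s_{\partial_j\beta}|_\beta$ ($\partial_j\beta$ is $\beta$ without its $j$-th vertex), the restriction from a face $\alpha$ of $\beta$ to $\beta$ being the pullback of forms along the projection $D_\beta\to D_\alpha$. The complex $\mathcal E_X^{0,\bullet}$ of smooth forms on $X$ is the complex of sheaves on $X$ given locally, for a closed embedding $U\hookrightarrow D$ of an open $U\subset X$ in a complex manifold $D$ with ideal $\mathcal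 I$, by $\mathcal E^{0,q}_X|_U=(\mathcal E^{0,q}_D/\mathcal M^q)|_U$, where $\mathcal M^q$ is the $\mathcal O_D$-submodule generated by $\mathcal I\mathcal E_D^{0,q}$, $\overline{\mathcal I}\mathcal E_D^{0,q}$ and $\bar\partial(\overline{\mathcal I}\mathcal E_D^{0,q-1})$, with differential induced by $\bar\partial$; the descriptions by different embeddings are identified by pullback along the projections from products of the ambient manifolds. $\mathcal C^\bullet(\mathcal U,\mathcal E_X^{0,\bullet})$ is the Čech complex of sheaves, i.e. the total complex, with the same signs, of the double complex $\prod_{|\alpha|=p}b_{\alpha*}(\mathcal E_X^{0,q}|_{U_\alpha})$. **Theorem.** Let $(X,\mathcal A)$ be a locally embedded analytic space. Then there is a surjective morphism of complexes of sheaves of complex vector spaces on $X$ $$\mathrm{Dolb}(\mathcal A,\mathcal O_X)\longrightarrow \mathcal C^{\bullet}(\mathrm{cov}(\mathcal A),\mathcal E_X^{0,\bullet}),$$ (surjective as a morphism of sheaves in each degree), which on the component of index $\alpha$ and bidegree $(p,q)$ is induced by the natural quotient morphism $(\mathcal E^{0,q}_{D_\alpha}/\mathcal I_\alpha\mathcal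 E^{0,q}_{D_\alpha})|_{U_\alpha}\to\mathcal E^{0,q}_X|_{U_\alpha}$. -/

import Mathlib

set_option maxSynthPendingDepth 3
open CategoryTheory TopologicalSpace Opposite Filter
open scoped Manifold ContDiff Topology

universe u

noncomputable section
namespace DolbeaultForms

section Part1

section Comp
open ContinuousAlternatingMap

lemma contDiff_aux {E E' Y Z W V : Type*} [NormedAddCommGroup E] [NormedSpace ℝ E]
    [NormedAddCommGroup E'] [NormedSpace ℝ E'] [NormedAddCommGroup Y] [NormedSpace ℝ Y]
    [NormedAddCommGroup Z] [NormedSpace ℝ Z] [NormedAddCommGroup W] [NormedSpace ℝ W]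
    [NormedAddCommGroup V] [NormedSpace ℝ V] {f : (E →L[ℝ] E') → (Y →L[ℝ] Z)}
    (hf : ContDiff ℝ ∞ f) (r : ℝ) (c : (E →L[ℝ] Z) →L[ℝ] V) (a : W →L[ℝ] (E' →L[ℝ] Y)) :
    ContDiff ℝ ∞ (fun L : E →L[ℝ] E' => r • (c ∘L ((ContinuousLinearMap.compL ℝ E Y Z (f L)) ∘L
      ((ContinuousLinearMap.compL ℝ E E' Y).flip L)) ∘L a)) := by
  have hA : ContDiff ℝ ∞ (fun L : E →L[ℝ] E' => ContinuousLinearMap.compL ℝ E Y Z (f L)) :=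
    ContDiff.clm_apply (contDiff_const (c := ContinuousLinearMap.compL ℝ E Y Z)) hf
  have hB : ContDiff ℝ ∞ (fun L : E →L[ℝ] E' => (ContinuousLinearMap.compL ℝ E E' Y).flip L) :=
    ContDiff.clm_apply (contDiff_const (c := (ContinuousLinearMap.compL ℝ E E' Y).flip)) contDiff_id
  have h1 := (hA.clm_comp hB).clm_comp (contDiff_const (c := a))
  have h2 := (contDiff_const (c := c)).clm_comp h1
  exact (contDiff_const (c := r)).smul h2
lemma contDiff_compCLM (E E' : Type*) [NormedAddCommGroup E] [NormedSpace ℝ E]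
   [NormedAddCommGroup E'] [NormedSpace ℝ E'] (q : ℕ) :
   ContDiff ℝ ∞ (fun L : E →L[ℝ] E' =>
     (compContinuousLinearMapCLM L : (E' [⋀^Fin q]→L[ℝ] ℂ) →L[ℝ] (E [⋀^Fin q]→L[ℝ] ℂ))) := by
  induction q with
  | zero =>
    have : (fun L : E →L[ℝ] E' =>
     (compContinuousLinearMapCLM L : (E' [⋀^Fin 0]→L[ℝ] ℂ) →L[ℝ] (E [⋀^Fin 0]→L[ℝ] ℂ))) =
      fun L => compContinuousLinearMapCLM 0 := by
      ext L f v
      simp only [compContinuousLinearMapCLM_apply, compContinuousLinearMap_apply]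
      congr 1
      exact Subsingleton.elim _ _
    rw [this]
    exact contDiff_const
  | succ q ih =>
    have : (fun L : E →L[ℝ] E' =>
       (compContinuousLinearMapCLM L : (E' [⋀^Fin (q+1)]→L[ℝ] ℂ) →L[ℝ] (E [⋀^Fin (q+1)]→L[ℝ] ℂ))) =
      fun L => (((q:ℝ)+1)⁻¹) • ((alternatizeUncurryFinCLM ℝ E ℂ) ∘L
        ((ContinuousLinearMap.compL ℝ E (E' [⋀^Fin q]→L[ℝ] ℂ) (E [⋀^Fin q]→L[ℝ] ℂ)
          (compContinuousLinearMapCLM L)) ∘L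
         ((ContinuousLinearMap.compL ℝ E E' (E' [⋀^Fin q]→L[ℝ] ℂ)).flip L)) ∘L
         (curryLeftLI (𝕜 := ℝ) (E := E') (F := ℂ) (n := q)).toContinuousLinearMap) := by
      ext1 L
      ext1 f
      have h := alternatizeUncurryFin_curryLeft (f.compContinuousLinearMap L)
      have h' : (curryLeft (f.compContinuousLinearMap L)) = 
        (compContinuousLinearMapCLM L) ∘L (curryLeft f ∘L L) := by
        ext v w
        simp only [curryLeft_apply_apply, compContinuousLinearMap_apply,
          ContinuousLinearMap.comp_apply, compContinuousLinearMapCLM_apply]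
        congr 1
        ext i
        refine Fin.cases ?_ (fun j => ?_) i <;> simp
      rw [h'] at h
      have hq : ((q:ℝ)+1) ≠ 0 := by positivity
      rw [eq_comm]
      change (((q:ℝ)+1)⁻¹) • alternatizeUncurryFin
        ((compContinuousLinearMapCLM L) ∘L (curryLeft f ∘L L)) = f.compContinuousLinearMap L
      rw [h, ← Nat.cast_smul_eq_nsmul ℝ, smul_smul]
      push_cast
      rw [inv_mul_cancel₀ hq, one_smul]
    rw [this]
    exact contDiff_aux ih _ _ _

end Comp

section Vec
variable (E : Type*) [NormedAddCommGroup E] [NormedSpace ℂ E]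

/-- Alternating real multilinear complex valued `q`-forms on the complex vector space `E`. -/
abbrev Alt (q : ℕ) : Type _ := E [⋀^Fin q]→L[ℝ] ℂ

/-- The forms of type `(0,q)`: those which are conjugate-linear in every argument. -/
def antiForms (q : ℕ) : Submodule ℂ (Alt E q) where
  carrier := {η | ∀ (v : Fin q → E) (j : Fin q),
    η (Function.update v j (Complex.I • v j)) = -Complex.I * η v}
  add_mem' := by
    intro a b ha hb v j
    simp only [ContinuousAlternatingMap.add_apply, ha v j, hb v j]; ring
  zero_mem' := by intro v j; simp
  smul_mem' := by
    intro c a ha v j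
    simp only [ContinuousAlternatingMap.smul_apply, ha v j, smul_eq_mul]; ring

variable {E}
variable {G : Type*} [NormedAddCommGroup G] [NormedSpace ℂ G]

/-- Multiplication by `i` as a real linear map. -/
def mulI : E →L[ℝ] E := (Complex.I • ContinuousLinearMap.id ℂ E).restrictScalars ℝ

/-- The conjugate-linear part `v ↦ (A v + i A (i v)) / 2` of a real linear map `A`. -/
def antiPart (A : E →L[ℝ] G) : E →L[ℝ] G :=
  (2⁻¹ : ℂ) • (A + Complex.I • A.comp mulI)

/-- The operator `∂̄` on forms of type `(0,q)` on a complex vector space: alternatization of the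
conjugate-linear part of the derivative. -/
def dbarVec {q : ℕ} (η : E → Alt E q) (x : E) : Alt E (q + 1) :=
  ContinuousAlternatingMap.alternatizeUncurryFin (antiPart (fderiv ℝ η x))

@[simp] lemma mulI_apply (v : E) : mulI v = Complex.I • v := rfl

lemma antiPart_apply (A : E →L[ℝ] G) (v : E) :
    antiPart A v = (2⁻¹ : ℂ) • (A v + Complex.I • A (Complex.I • v)) := by
  simp [antiPart]

lemma antiPart_I (A : E →L[ℝ] G) (v : E) :
    antiPart A (Complex.I • v) = -(Complex.I • antiPart A v) := by
  simp only [antiPart_apply, smul_smul, Complex.I_mul_I, smul_add, neg_smul, one_smul, map_neg,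
    smul_neg]
  rw [show Complex.I * (2⁻¹ * Complex.I) = -2⁻¹ by
    rw [mul_comm, mul_assoc, Complex.I_mul_I]; ring, mul_comm Complex.I]
  simp only [neg_smul]; abel

/-- `antiPart` as a continuous linear map. -/
def antiPartCLM : (E →L[ℝ] G) →L[ℝ] (E →L[ℝ] G) :=
  (2⁻¹ : ℂ) • (ContinuousLinearMap.id ℝ (E →L[ℝ] G) +
    Complex.I • (ContinuousLinearMap.compL ℝ E E G).flip mulI)

lemma antiPartCLM_apply (A : E →L[ℝ] G) : antiPartCLM A = antiPart A := by
  simp [antiPartCLM, antiPart]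

lemma alt_anti_mem {q : ℕ} {B : E →L[ℝ] Alt E q}
    (h1 : ∀ v, B (Complex.I • v) = -(Complex.I • B v)) (h2 : ∀ v, B v ∈ antiForms E q) :
    ContinuousAlternatingMap.alternatizeUncurryFin B ∈ antiForms E (q + 1) := by
  intro v j
  simp only [ContinuousAlternatingMap.alternatizeUncurryFin_apply, Finset.mul_sum]
  refine Finset.sum_congr rfl fun i _ => ?_
  rw [mul_smul_comm]
  congr 1
  rcases eq_or_ne i j with rfl | hij
  · rw [Function.update_self, h1, Fin.removeNth_update]
    simp
  · obtain ⟨k, rfl⟩ := Fin.exists_succAbove_eq hij.symm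
    rw [Function.update_of_ne hij, Fin.removeNth_update_succAbove]
    exact h2 (v i) (i.removeNth v) k

lemma antiPart_mem {q : ℕ} {A : E →L[ℝ] Alt E q} (h : ∀ v, A v ∈ antiForms E q) (v : E) :
    antiPart A v ∈ antiForms E q := by
  rw [antiPart_apply]
  exact Submodule.smul_mem _ _ (Submodule.add_mem _ (h _) (Submodule.smul_mem _ _ (h _)))

lemma antiForms_comp {q : ℕ} {E' : Type*} [NormedAddCommGroup E'] [NormedSpace ℂ E']
    {η : Alt E' q} (h : η ∈ antiForms E' q) (L : E →L[ℂ] E') :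
    η.compContinuousLinearMap (L.restrictScalars ℝ) ∈ antiForms E q := by
  intro v j
  have := h (L ∘ v) j
  simp only [ContinuousAlternatingMap.compContinuousLinearMap_apply]
  have e : (L.restrictScalars ℝ : E → E') ∘ Function.update v j (Complex.I • v j) =
      Function.update (L ∘ v) j (Complex.I • (L ∘ v) j) := by
    ext k
    rcases eq_or_ne k j with rfl | hk
    · simp
    · simp [hk]
  rw [e]
  exact this

lemma isClosed_antiForms (q : ℕ) : IsClosed (antiForms E q : Set (Alt E q)) := by
  have : (antiForms E q : Set (Alt E q)) = ⋂ (v : Fin q → E) (j : Fin q),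
      {η | η (Function.update v j (Complex.I • v j)) = -Complex.I * η v} := by
    ext η; simp [antiForms]
  rw [this]
  refine isClosed_iInter fun v => isClosed_iInter fun j => isClosed_eq ?_ ?_
  · exact (ContinuousAlternatingMap.apply ℝ E ℂ _).continuous
  · exact continuous_const.mul ((ContinuousAlternatingMap.apply ℝ E ℂ _).continuous)

/-- The derivative of a map with values in a closed complex subspace has values in it. -/
lemma fderiv_mem_anti {q : ℕ} {η : E → Alt E q} {x : E}
    (h : ∀ᶠ y in 𝓝 x, η y ∈ antiForms E q) (v : E) : fderiv ℝ η x v ∈ antiForms E q := by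
  by_cases hd : DifferentiableAt ℝ η x
  · have h1 := (hd.hasFDerivAt.hasLineDerivAt v).tendsto_slope_zero
    refine (isClosed_antiForms (E := E) q).mem_of_tendsto h1 ?_
    have hx := h.self_of_nhds
    have h2 : Tendsto (fun t : ℝ => x + t • v) (𝓝[≠] 0) (𝓝 x) := by
      have : Tendsto (fun t : ℝ => x + t • v) (𝓝 0) (𝓝 (x + (0 : ℝ) • v)) :=
        (continuous_const.add (continuous_id.smul continuous_const)).tendsto 0
      simpa using this.mono_left nhdsWithin_le_nhds
    filter_upwards [h2.eventually h] with t ht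
    exact ((antiForms E q).restrictScalars ℝ).smul_mem _ ((antiForms E q).sub_mem ht hx)
  · rw [fderiv_zero_of_not_differentiableAt hd]; exact (antiForms E q).zero_mem

lemma dbarVec_mem {q : ℕ} {η : E → Alt E q} {x : E} (h : ∀ᶠ y in 𝓝 x, η y ∈ antiForms E q) :
    dbarVec η x ∈ antiForms E (q + 1) :=
  alt_anti_mem (antiPart_I _) (antiPart_mem (fderiv_mem_anti h))

lemma antiForms_I {q : ℕ} {η : Alt E q} (h : η ∈ antiForms E q) (v : Fin q → E) :
    η (fun i => Complex.I • v i) = (-Complex.I) ^ q * η v := by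
  have key : ∀ s : Finset (Fin q), η (fun i => if i ∈ s then Complex.I • v i else v i)
      = (-Complex.I) ^ s.card * η v := by
    intro s
    induction s using Finset.induction_on with
    | empty => simp
    | insert a s ha ih =>
      have := h (fun i => if i ∈ s then Complex.I • v i else v i) a
      rw [Finset.card_insert_of_notMem ha, pow_succ', mul_assoc, ← ih, ← this]
      congr 1
      ext i
      rcases eq_or_ne i a with rfl | hi
      · simp [ha]
      · simp [hi]
  simpa using key Finset.univ

/-- `∂̄` is the component of type `(0,q+1)` of the exterior derivative. -/
lemma dbarVec_eq {q : ℕ} {η : E → Alt E q} {x : E} (h : ∀ᶠ y in 𝓝 x, η y ∈ antiForms E q) :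
    dbarVec η x = (2⁻¹ : ℂ) • (extDeriv η x +
      Complex.I ^ (q + 1) • (extDeriv η x).compContinuousLinearMap mulI) := by
  ext v
  have h1 := fderiv_mem_anti h
  simp only [dbarVec, extDeriv, ContinuousAlternatingMap.smul_apply,
    ContinuousAlternatingMap.add_apply, ContinuousAlternatingMap.compContinuousLinearMap_apply,
    ContinuousAlternatingMap.alternatizeUncurryFin_apply, Finset.smul_sum,
    ← Finset.sum_add_distrib]
  refine Finset.sum_congr rfl fun i _ => ?_
  have h2 := antiForms_I (h1 (Complex.I • v i)) (i.removeNth v)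
  have h3 : i.removeNth (⇑mulI ∘ v) = fun k => Complex.I • (i.removeNth v) k := rfl
  have h4 : Complex.I ^ (q + 1) * (-Complex.I) ^ q = Complex.I := by
    rw [pow_succ, mul_assoc, mul_comm Complex.I, ← mul_assoc, ← mul_pow]
    simp
  rw [antiPart_apply, h3, Function.comp_apply, mulI_apply, h2]
  simp only [ContinuousAlternatingMap.smul_apply, ContinuousAlternatingMap.add_apply, smul_eq_mul,
    zsmul_eq_mul]
  push_cast
  linear_combination (-(1/2 : ℂ) * (-1) ^ (i : ℕ) *
    ((fderiv ℝ η x) (Complex.I • v i)) (i.removeNth v)) * h4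

lemma dbarVec_comp {E' : Type*} [NormedAddCommGroup E'] [NormedSpace ℂ E'] {q : ℕ}
    {η : E' → Alt E' q} {g : E → E'} {x : E} (hη : DifferentiableAt ℝ η (g x))
    (h : ∀ᶠ y in 𝓝 (g x), η y ∈ antiForms E' q) (hg : ContDiffAt ℂ ω g x) :
    dbarVec (fun y => (η (g y)).compContinuousLinearMap ((fderiv ℂ g y).restrictScalars ℝ)) x =
      (dbarVec η (g x)).compContinuousLinearMap ((fderiv ℂ g x).restrictScalars ℝ) := by
  have hev : ∀ᶠ y in 𝓝 x, DifferentiableAt ℂ g y := by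
    filter_upwards [hg.eventually (by simp)] with y hy
    exact hy.differentiableAt (by simp)
  have hfd : ∀ᶠ y in 𝓝 x, (fderiv ℂ g y).restrictScalars ℝ = fderiv ℝ g y :=
    hev.mono fun y hy => (hy.fderiv_restrictScalars ℝ).symm
  have hcongr : (fun y => (η (g y)).compContinuousLinearMap ((fderiv ℂ g y).restrictScalars ℝ))
      =ᶠ[𝓝 x] fun y => (η (g y)).compContinuousLinearMap (fderiv ℝ g y) :=
    hfd.mono fun y hy => by simp only [hy]
  have hext : extDeriv (fun y => (η (g y)).compContinuousLinearMap
      ((fderiv ℂ g y).restrictScalars ℝ)) x =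
      (extDeriv η (g x)).compContinuousLinearMap ((fderiv ℂ g x).restrictScalars ℝ) := by
    rw [hcongr.extDeriv_eq, hfd.self_of_nhds]
    exact extDeriv_pullback (r := ω) hη (hg.restrict_scalars ℝ) (by simp)
  rw [dbarVec_eq, dbarVec_eq h, hext]
  · ext v
    simp only [ContinuousAlternatingMap.smul_apply, ContinuousAlternatingMap.add_apply,
      ContinuousAlternatingMap.compContinuousLinearMap_apply]
    congr 4
    ext k; simp
  · filter_upwards [hg.continuousAt.eventually h] with y hy
    exact antiForms_comp hy _

lemma dbarVec_congr {q : ℕ} {η η' : E → Alt E q} {x : E} (h : η =ᶠ[𝓝 x] η') :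
    dbarVec η x = dbarVec η' x := by
  rw [dbarVec, dbarVec, h.fderiv_eq]

lemma dbarVec_contDiffAt {q : ℕ} {η : E → Alt E q} {x : E} (h : ContDiffAt ℝ ∞ η x) :
    ContDiffAt ℝ ∞ (dbarVec η) x := by
  have h1 : ContDiffAt ℝ ∞ (fderiv ℝ η) x := h.fderiv_right (by simp)
  have h2 : dbarVec η = fun y =>
      (ContinuousAlternatingMap.alternatizeUncurryFinCLM ℝ E ℂ ∘L antiPartCLM) (fderiv ℝ η y) := by
    ext1 y
    simp [dbarVec, antiPartCLM_apply]
  rw [h2]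
  exact (ContinuousLinearMap.contDiff _).contDiffAt.comp x h1

lemma dbarVec_dbarVec {q : ℕ} {η : E → Alt E q} {x : E} (h : ContDiffAt ℝ ∞ η x) :
    dbarVec (dbarVec η) x = 0 := by
  have h1 : ContDiffAt ℝ ∞ (fderiv ℝ η) x := h.fderiv_right (by simp)
  have h2 : dbarVec η = fun y =>
      (ContinuousAlternatingMap.alternatizeUncurryFinCLM ℝ E ℂ ∘L antiPartCLM) (fderiv ℝ η y) := by
    ext1 y
    simp [dbarVec, antiPartCLM_apply]
  have hd : DifferentiableAt ℝ (fderiv ℝ η) x := h1.differentiableAt (by simp)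
  have h3 : fderiv ℝ (dbarVec η) x =
      (ContinuousAlternatingMap.alternatizeUncurryFinCLM ℝ E ℂ ∘L antiPartCLM) ∘L
        fderiv ℝ (fderiv ℝ η) x := by
    rw [h2]
    exact ((ContinuousLinearMap.hasFDerivAt _).comp x hd.hasFDerivAt).fderiv
  have hs : ∀ v w, fderiv ℝ (fderiv ℝ η) x v w = fderiv ℝ (fderiv ℝ η) x w v :=
    fun v w => (h.isSymmSndFDerivAt (by simp; exact WithTop.coe_le_coe.2 (le_top : (2 : ℕ∞) ≤ ⊤))).eq v w
  have h4 : antiPart (fderiv ℝ (dbarVec η) x) =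
      ContinuousAlternatingMap.alternatizeUncurryFinCLM ℝ E ℂ ∘L
        (antiPartCLM ∘L antiPart (fderiv ℝ (fderiv ℝ η) x)) := by
    rw [h3]
    ext v : 1
    simp only [antiPart_apply, ContinuousLinearMap.comp_apply, antiPartCLM_apply,
      ContinuousAlternatingMap.alternatizeUncurryFinCLM_apply]
    rw [← ContinuousAlternatingMap.alternatizeUncurryFin_smul,
      ← ContinuousAlternatingMap.alternatizeUncurryFin_add,
      ← ContinuousAlternatingMap.alternatizeUncurryFin_smul]
    congr 1
    ext w : 1
    simp only [antiPart_apply, _root_.smul_apply, _root_.add_apply,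
      smul_add, smul_smul]
    module
  rw [dbarVec, h4]
  apply ContinuousAlternatingMap.alternatizeUncurryFin_alternatizeUncurryFinCLM_comp_of_symmetric
  intro v w
  simp only [ContinuousLinearMap.comp_apply, antiPartCLM_apply, antiPart_apply,
    _root_.smul_apply, _root_.add_apply]
  rw [hs v w, hs (Complex.I • v) w, hs v (Complex.I • w), hs (Complex.I • v) (Complex.I • w)]
  module

lemma dbarVec_smul {q : ℕ} {η : E → Alt E q} {f : E → ℂ} {x : E} (h : DifferentiableAt ℝ η x)
    (hf : DifferentiableAt ℂ f x) :
    dbarVec (fun y => f y • η y) x = f x • dbarVec η x := by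
  have hfr : DifferentiableAt ℝ f x := hf.restrictScalars ℝ
  have h1 := (hfr.hasFDerivAt.smul h.hasFDerivAt).fderiv
  have h2 : antiPart (fderiv ℝ (fun y => f y • η y) x) = f x • antiPart (fderiv ℝ η x) := by
    have h1' : fderiv ℝ (fun y => f y • η y) x = _ := h1
    rw [h1', hf.fderiv_restrictScalars ℝ]
    ext v : 1
    simp only [antiPart_apply, _root_.add_apply, _root_.smul_apply,
      ContinuousLinearMap.smulRight_apply, ContinuousLinearMap.coe_restrictScalars', map_smul,
      smul_eq_mul, smul_add, smul_smul]
    have : (2:ℂ)⁻¹ * (Complex.I * (Complex.I * (fderiv ℂ f x) v)) =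
      - ((2:ℂ)⁻¹ * (fderiv ℂ f x) v) := by
      linear_combination ((2:ℂ)⁻¹ * (fderiv ℂ f x) v) * Complex.I_mul_I
    rw [this]
    module
  rw [dbarVec, h2, ContinuousAlternatingMap.alternatizeUncurryFin_smul, dbarVec]

lemma dbarVec_add {q : ℕ} {η η' : E → Alt E q} {x : E} (h : DifferentiableAt ℝ η x)
    (h' : DifferentiableAt ℝ η' x) :
    dbarVec (fun y => η y + η' y) x = dbarVec η x + dbarVec η' x := by
  have : antiPart (fderiv ℝ (fun y => η y + η' y) x) =
      antiPart (fderiv ℝ η x) + antiPart (fderiv ℝ η' x) := by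
    rw [fderiv_fun_add h h', ← antiPartCLM_apply, map_add]
    simp [antiPartCLM_apply]
  rw [dbarVec, this, ContinuousAlternatingMap.alternatizeUncurryFin_add, dbarVec, dbarVec]

end Vec

end Part1

section Part2

section Mfd
set_option linter.unusedSectionVars false
variable (E E' E'' : Type*) [NormedAddCommGroup E] [NormedSpace ℂ E] [NormedAddCommGroup E']
  [NormedSpace ℂ E'] [NormedAddCommGroup E''] [NormedSpace ℂ E'']
variable {M M' M'' : Type*} [TopologicalSpace M] [ChartedSpace E M]
  [TopologicalSpace M'] [ChartedSpace E' M'] [TopologicalSpace M''] [ChartedSpace E'' M'']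

/-- `F` is holomorphic near `y`. -/
abbrev HolAt (F : M → M') (y : M) : Prop := ContMDiffAt 𝓘(ℂ, E) 𝓘(ℂ, E') ω F y

/-- The complex derivative of `F` at `y`, in the preferred charts at `y` and `F y`. -/
def fd (F : M → M') (y : M) : E →L[ℂ] E' := mfderiv 𝓘(ℂ, E) 𝓘(ℂ, E') F y

/-- Pullback of a differential form. A form on `M` is a function with values in `Alt E q`: the
tangent space of `M` at `y` is identified with `E` by the preferred chart at `y`, as in Mathlib. -/
def pullback {q : ℕ} (F : M → M') (η : M' → Alt E' q) (y : M) : Alt E q :=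
  (η (F y)).compContinuousLinearMap ((fd E E' F y).restrictScalars ℝ)

/-- The expression of the form `η` in the preferred chart at `y`. -/
def localRep {q : ℕ} (y : M) (η : M → Alt E q) : E → Alt E q :=
  pullback E E (chartAt E y).symm η

/-- The operator `∂̄` on forms of type `(0,q)` on a complex manifold. -/
def dbar {q : ℕ} (η : M → Alt E q) (y : M) : Alt E (q + 1) :=
  dbarVec (localRep E y η) (chartAt E y y)

/-- `η` is at `y` of type `(0,q)` and smooth. -/
def SmoothAt {q : ℕ} (η : M → Alt E q) (y : M) : Prop :=
  η y ∈ antiForms E q ∧ ContDiffAt ℝ ∞ (localRep E y η) (chartAt E y y)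

variable {E E' E''}

lemma HolAt.eventually [IsManifold 𝓘(ℂ, E) ω M] [IsManifold 𝓘(ℂ, E') ω M'] {F : M → M'} {y : M}
    (h : HolAt E E' F y) : ∀ᶠ z in 𝓝 y, HolAt E E' F z :=
  (contMDiffAt_iff_contMDiffAt_nhds (by simp)).1 h

lemma HolAt.mdiff {F : M → M'} {y : M} (h : HolAt E E' F y) :
    MDifferentiableAt 𝓘(ℂ, E) 𝓘(ℂ, E') F y := h.mdifferentiableAt (by simp)

lemma fd_comp {F : M → M'} {G : M' → M''} {y : M} (hG : HolAt E' E'' G (F y))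
    (hF : HolAt E E' F y) : fd E E'' (G ∘ F) y = (fd E' E'' G (F y)).comp (fd E E' F y) :=
  mfderiv_comp y hG.mdiff hF.mdiff

lemma fd_congr {F G : M → M'} {y : M} (h : F =ᶠ[𝓝 y] G) : fd E E' F y = fd E E' G y :=
  h.mfderiv_eq

lemma fd_vec {F : E → E'} {y : E} : fd E E' F y = fderiv ℂ F y := mfderiv_eq_fderiv

lemma fd_id {y : M} : fd E E (id : M → M) y = ContinuousLinearMap.id ℂ E := mfderiv_id

lemma pullback_comp {q : ℕ} {F : M → M'} {G : M' → M''} {y : M} (hG : HolAt E' E'' G (F y))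
    (hF : HolAt E E' F y) (η : M'' → Alt E'' q) :
    pullback E E'' (G ∘ F) η y = pullback E E' F (pullback E' E'' G η) y := by
  simp only [pullback, fd_comp hG hF]; rfl

lemma pullback_congr {q : ℕ} {F G : M → M'} {y : M} (h : F =ᶠ[𝓝 y] G) (η : M' → Alt E' q) :
    pullback E E' F η =ᶠ[𝓝 y] pullback E E' G η := by
  filter_upwards [h.eventuallyEq_nhds] with z hz
  simp only [pullback, fd_congr hz, hz.self_of_nhds]

lemma pullback_id {q : ℕ} (η : M → Alt E q) : pullback E E id η = η := by
  ext y v; simp [pullback, fd_id]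

lemma holAt_chart [IsManifold 𝓘(ℂ, E) ω M] {y z : M} (hz : z ∈ (chartAt E y).source) :
    HolAt E E (chartAt E y) z :=
  contMDiffOn_chart.contMDiffAt ((chartAt E y).open_source.mem_nhds hz)

lemma holAt_chart_symm [IsManifold 𝓘(ℂ, E) ω M] {y : M} {z : E}
    (hz : z ∈ (chartAt E y).target) : HolAt E E (chartAt E y).symm z :=
  contMDiffOn_chart_symm.contMDiffAt ((chartAt E y).open_target.mem_nhds hz)

variable [IsManifold 𝓘(ℂ, E) ω M] [IsManifold 𝓘(ℂ, E') ω M'] [IsManifold 𝓘(ℂ, E'') ω M'']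

lemma chartAt_vec (y : E) : ⇑(chartAt E y) = id ∧ ⇑(chartAt E y).symm = id := by
  rw [chartAt_self_eq]; exact ⟨rfl, rfl⟩

lemma localRep_vec {q : ℕ} (y : E) (η : E → Alt E q) : localRep E y η = η := by
  rw [localRep, (chartAt_vec y).2, pullback_id]

lemma dbar_vec {q : ℕ} (η : E → Alt E q) : dbar E η = dbarVec η := by
  ext1 y; rw [dbar, localRep_vec, (chartAt_vec y).1]; rfl

/-- Pullback along a holomorphic map can be computed in charts. -/
lemma pullback_chart {q : ℕ} {F : M → M'} {y : M} {y' : M'} (hF : HolAt E E' F y)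
    (hy : F y ∈ (chartAt E' y').source) (η : M' → Alt E' q) :
    pullback E E' F η =ᶠ[𝓝 y] pullback E E' (chartAt E' y' ∘ F) (localRep E' y' η) := by
  have h1 := hF.continuousAt.eventually_mem ((chartAt E' y').open_source.mem_nhds hy)
  filter_upwards [hF.eventually, h1.eventually_nhds] with z hz hz'
  have h2 : F =ᶠ[𝓝 z] (chartAt E' y').symm ∘ (chartAt E' y' ∘ F) := by
    filter_upwards [hz'] with t ht
    exact ((chartAt E' y').left_inv ht).symm
  have h3 : HolAt E E' (chartAt E' y' ∘ F) z :=
    ContMDiffAt.comp z (holAt_chart hz'.self_of_nhds) hz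
  rw [(pullback_congr h2 η).self_of_nhds, pullback_comp _ h3]
  · rfl
  · exact holAt_chart_symm ((chartAt E' y').map_source hz'.self_of_nhds)

/-- The local expression of a holomorphic map. -/
lemma localRep_pullback {q : ℕ} {F : M → M'} {y : M} (hF : HolAt E E' F y)
    (η : M' → Alt E' q) :
    localRep E y (pullback E E' F η) =ᶠ[𝓝 (chartAt E y y)]
      pullback E E' (chartAt E' (F y) ∘ F ∘ (chartAt E y).symm) (localRep E' (F y) η) := by
  have hs : HolAt E E (chartAt E y).symm (chartAt E y y) :=
    holAt_chart_symm (mem_chart_target E y)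
  have hy : (chartAt E y).symm (chartAt E y y) = y := (chartAt E y).left_inv (mem_chart_source E y)
  have hF' : HolAt E E' F ((chartAt E y).symm (chartAt E y y)) := by rwa [hy]
  have hc : HolAt E E' (F ∘ (chartAt E y).symm) (chartAt E y y) := ContMDiffAt.comp _ hF' hs
  have h1 := pullback_chart (y' := F y) hc (by simp [hy]) η
  refine EventuallyEq.trans ?_ h1
  filter_upwards [hs.eventually, hs.continuousAt.eventually hF'.eventually] with z hz hz'
  exact (pullback_comp hz' hz η).symm

lemma holAt_local {F : M → M'} {y : M} (hF : HolAt E E' F y) :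
    ContDiffAt ℂ ω (chartAt E' (F y) ∘ F ∘ (chartAt E y).symm) (chartAt E y y) := by
  have := (contMDiffAt_iff.1 hF).2
  rw [modelWithCornersSelf_coe, Set.range_id, contDiffWithinAt_univ] at this
  exact this

lemma fd_local {F : M → M'} {y : M} (hF : HolAt E E' F y) :
    fd E E' F y = fderiv ℂ (chartAt E' (F y) ∘ F ∘ (chartAt E y).symm) (chartAt E y y) := by
  have h := hF.mdiff.mfderiv
  rw [modelWithCornersSelf_coe, Set.range_id] at h
  rw [fderivWithin_univ] at h
  exact h

lemma contDiffAt_pullback_vec {q : ℕ} {g : E → E'} {x : E} {η : E' → Alt E' q}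
    (hη : ContDiffAt ℝ ∞ η (g x)) (hg : ContDiffAt ℂ ω g x) :
    ContDiffAt ℝ ∞ (pullback E E' g η) x := by
  have h0 : ContDiffAt ℝ ∞ g x := (hg.restrict_scalars ℝ).of_le (by simp)
  have h1 : ContDiffAt ℝ ∞ (fderiv ℝ g) x :=
    (hg.restrict_scalars ℝ).fderiv_right (by simp)
  have hev : ∀ᶠ y in 𝓝 x, DifferentiableAt ℂ g y := by
    filter_upwards [hg.eventually (by simp)] with y hy
    exact hy.differentiableAt (by simp)
  have h2 : pullback E E' g η =ᶠ[𝓝 x] fun y =>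
      ContinuousAlternatingMap.compContinuousLinearMapCLM (fderiv ℝ g y) (η (g y)) := by
    filter_upwards [hev] with y hy
    rw [pullback, fd_vec, ← hy.fderiv_restrictScalars ℝ]; rfl
  refine ContDiffAt.congr_of_eventuallyEq ?_ h2
  exact (((contDiff_compCLM E E' q).contDiffAt).comp x h1).clm_apply (hη.comp x h0)

lemma SmoothAt.anti_localRep {q : ℕ} {η : M → Alt E q} {y : M} (h : ∀ᶠ z in 𝓝 y, SmoothAt E η z) :
    ∀ᶠ z in 𝓝 (chartAt E y y), localRep E y η z ∈ antiForms E q := by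
  have hs : HolAt E E (chartAt E y).symm (chartAt E y y) :=
    holAt_chart_symm (mem_chart_target E y)
  have hy : (chartAt E y).symm (chartAt E y y) = y := (chartAt E y).left_inv (mem_chart_source E y)
  have h' := hs.continuousAt
  rw [ContinuousAt, hy] at h'
  filter_upwards [h'.eventually h] with z hz
  exact antiForms_comp hz.1 _

lemma SmoothAt.pullback {q : ℕ} {F : M → M'} {y : M} {η : M' → Alt E' q} (hF : HolAt E E' F y)
    (h : SmoothAt E' η (F y)) : SmoothAt E (pullback E E' F η) y := by
  refine ⟨antiForms_comp h.1 _, ?_⟩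
  refine ContDiffAt.congr_of_eventuallyEq ?_ (localRep_pullback hF η)
  refine contDiffAt_pullback_vec ?_ (holAt_local hF)
  simpa using h.2

/-- Pullback along holomorphic maps commutes with `∂̄`. -/
lemma dbar_pullback {q : ℕ} {F : M → M'} {y : M} {η : M' → Alt E' q} (hF : HolAt E E' F y)
    (h : ∀ᶠ z in 𝓝 (F y), SmoothAt E' η z) :
    dbar E (DolbeaultForms.pullback E E' F η) y =
      DolbeaultForms.pullback E E' F (dbar E' η) y := by
  have hgy : (chartAt E' (F y) ∘ F ∘ (chartAt E y).symm) (chartAt E y y) =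
    chartAt E' (F y) (F y) := by simp
  rw [dbar, dbarVec_congr (localRep_pullback hF η)]
  have h1 := dbarVec_comp (η := localRep E' (F y) η)
    (g := chartAt E' (F y) ∘ F ∘ (chartAt E y).symm) (x := chartAt E y y)
    (by rw [hgy]; exact h.self_of_nhds.2.differentiableAt (by simp))
    (by rw [hgy]; exact SmoothAt.anti_localRep h) (holAt_local hF)
  have h2 : DolbeaultForms.pullback E E' (chartAt E' (F y) ∘ F ∘ (chartAt E y).symm)
      (localRep E' (F y) η) = fun z => (localRep E' (F y) η
        ((chartAt E' (F y) ∘ F ∘ (chartAt E y).symm) z)).compContinuousLinearMap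
          ((fderiv ℂ (chartAt E' (F y) ∘ F ∘ (chartAt E y).symm) z).restrictScalars ℝ) := by
    ext1 z; rw [DolbeaultForms.pullback, fd_vec]
  rw [h2, h1, hgy, ← fd_local hF]
  rfl

lemma localRep_dbar {q : ℕ} {η : M → Alt E q} {y : M} (h : ∀ᶠ z in 𝓝 y, SmoothAt E η z) :
    localRep E y (dbar E η) =ᶠ[𝓝 (chartAt E y y)] dbarVec (localRep E y η) := by
  have hs : HolAt E E (chartAt E y).symm (chartAt E y y) :=
    holAt_chart_symm (mem_chart_target E y)
  have hy : (chartAt E y).symm (chartAt E y y) = y := (chartAt E y).left_inv (mem_chart_source E y)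
  have h' := hs.continuousAt
  rw [ContinuousAt, hy] at h'
  filter_upwards [hs.eventually, h'.eventually h.eventually_nhds] with z hz hz'
  rw [← dbar_vec]
  exact (dbar_pullback hz hz').symm

lemma SmoothAt.dbar {q : ℕ} {η : M → Alt E q} {y : M} (h : ∀ᶠ z in 𝓝 y, SmoothAt E η z) :
    SmoothAt E (dbar E η) y := by
  refine ⟨dbarVec_mem (SmoothAt.anti_localRep h), ?_⟩
  exact (dbarVec_contDiffAt h.self_of_nhds.2).congr_of_eventuallyEq (localRep_dbar h)

lemma dbar_dbar {q : ℕ} {η : M → Alt E q} {y : M} (h : ∀ᶠ z in 𝓝 y, SmoothAt E η z) :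
    DolbeaultForms.dbar E (DolbeaultForms.dbar E η) y = 0 := by
  rw [DolbeaultForms.dbar, dbarVec_congr (localRep_dbar h)]
  exact dbarVec_dbarVec h.self_of_nhds.2

lemma localRep_congr {q : ℕ} {η η' : M → Alt E q} {y : M} (h : η =ᶠ[𝓝 y] η') :
    localRep E y η =ᶠ[𝓝 (chartAt E y y)] localRep E y η' := by
  have h' : Tendsto (chartAt E y).symm (𝓝 (chartAt E y y)) (𝓝 y) := by
    have := (chartAt E y).continuousAt_symm (mem_chart_target E y)
    rwa [ContinuousAt, (chartAt E y).left_inv (mem_chart_source E y)] at this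
  filter_upwards [h'.eventually h] with z hz
  simp only [localRep, DolbeaultForms.pullback, hz]

lemma dbar_congr {q : ℕ} {η η' : M → Alt E q} {y : M} (h : η =ᶠ[𝓝 y] η') :
    DolbeaultForms.dbar E η y = DolbeaultForms.dbar E η' y := dbarVec_congr (localRep_congr h)

lemma SmoothAt.congr {q : ℕ} {η η' : M → Alt E q} {y : M} (h : η =ᶠ[𝓝 y] η')
    (hη : SmoothAt E η' y) : SmoothAt E η y :=
  ⟨h.self_of_nhds ▸ hη.1, hη.2.congr_of_eventuallyEq (localRep_congr h)⟩

lemma localRep_add {q : ℕ} (η η' : M → Alt E q) (y : M) :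
    localRep E y (η + η') = fun z => localRep E y η z + localRep E y η' z := by
  ext z v; simp [localRep, DolbeaultForms.pullback]

lemma localRep_smul {q : ℕ} (f : M → ℂ) (η : M → Alt E q) (y : M) :
    localRep E y (fun z => f z • η z) =
      fun z => f ((chartAt E y).symm z) • localRep E y η z := by
  ext z v; simp [localRep, DolbeaultForms.pullback]

lemma SmoothAt.add {q : ℕ} {η η' : M → Alt E q} {y : M} (h : SmoothAt E η y)
    (h' : SmoothAt E η' y) : SmoothAt E (η + η') y :=
  ⟨(antiForms E q).add_mem h.1 h'.1, by rw [localRep_add]; exact h.2.add h'.2⟩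

lemma SmoothAt.zero {q : ℕ} {y : M} : SmoothAt E (0 : M → Alt E q) y := by
  refine ⟨(antiForms E q).zero_mem, ?_⟩
  have : localRep E y (0 : M → Alt E q) = fun _ => 0 := by
    ext z v; simp [localRep, DolbeaultForms.pullback]
  rw [this]; exact contDiffAt_const

lemma dbar_add {q : ℕ} {η η' : M → Alt E q} {y : M} (h : SmoothAt E η y)
    (h' : SmoothAt E η' y) : DolbeaultForms.dbar E (η + η') y =
      DolbeaultForms.dbar E η y + DolbeaultForms.dbar E η' y := by
  rw [DolbeaultForms.dbar, localRep_add]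
  exact dbarVec_add (h.2.differentiableAt (by simp)) (h'.2.differentiableAt (by simp))

/-- Smooth complex valued functions. -/
def SmoothFun (E : Type*) {M : Type*} [NormedAddCommGroup E] [NormedSpace ℂ E]
    [TopologicalSpace M] [ChartedSpace E M] (f : M → ℂ) (y : M) : Prop :=
  ContDiffAt ℝ ∞ (f ∘ (chartAt E y).symm) (chartAt E y y)

lemma holAt_fun_local {f : M → ℂ} {y : M} (hf : ContMDiffAt 𝓘(ℂ, E) 𝓘(ℂ, ℂ) ω f y) :
    ContDiffAt ℂ ω (f ∘ (chartAt E y).symm) (chartAt E y y) := by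
  have := (contMDiffAt_iff.1 hf).2
  rw [modelWithCornersSelf_coe, Set.range_id, contDiffWithinAt_univ] at this
  exact this

lemma smoothFun_hol {f : M → ℂ} {y : M} (hf : ContMDiffAt 𝓘(ℂ, E) 𝓘(ℂ, ℂ) ω f y) :
    SmoothFun E f y :=
  ((holAt_fun_local hf).restrict_scalars ℝ).of_le (by simp)

lemma smoothFun_conj {f : M → ℂ} {y : M} (hf : SmoothFun E f y) :
    SmoothFun E (fun z => starRingEnd ℂ (f z)) y :=
  (Complex.conjCLE.contDiff.contDiffAt.comp _ hf :)

lemma SmoothAt.smul {q : ℕ} {η : M → Alt E q} {f : M → ℂ} {y : M} (hf : SmoothFun E f y)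
    (h : SmoothAt E η y) : SmoothAt E (fun z => f z • η z) y :=
  ⟨(antiForms E q).smul_mem _ h.1, by rw [localRep_smul]; exact hf.smul h.2⟩

lemma dbar_smul {q : ℕ} {η : M → Alt E q} {f : M → ℂ} {y : M}
    (hf : ContMDiffAt 𝓘(ℂ, E) 𝓘(ℂ, ℂ) ω f y) (h : SmoothAt E η y) :
    DolbeaultForms.dbar E (fun z => f z • η z) y = f y • DolbeaultForms.dbar E η y := by
  rw [DolbeaultForms.dbar, localRep_smul,
    dbarVec_smul (f := fun z => f ((chartAt E y).symm z)) (h.2.differentiableAt (by simp))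
      ((holAt_fun_local hf).differentiableAt (by simp)),
    (chartAt E y).left_inv (mem_chart_source E y), DolbeaultForms.dbar]

end Mfd

end Part2

section Part3

/-- Complex manifolds, modelled on a finite dimensional complex vector space. -/
structure ComplexManifold : Type (u + 1) where
  carrier : Type u
  E : Type
  [normed : NormedAddCommGroup E]
  [space : NormedSpace ℂ E]
  [finite : FiniteDimensional ℂ E]
  [top : TopologicalSpace carrier]
  [charted : ChartedSpace E carrier]
  [mfd : IsManifold 𝓘(ℂ, E) ω carrier]

namespace ComplexManifold

attribute [instance] normed space finite top charted mfd

variable {m : ℕ} (T : Fin m → ComplexManifold.{u})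

/-- Finite products of complex manifolds, with the product charts. -/
def pi : ComplexManifold.{u} where
  carrier := ∀ a, (T a).carrier
  E := ∀ a, (T a).E
  charted := piChartedSpace (fun a => (T a).E) (fun a => (T a).carrier)
  mfd := by
    let _ : ChartedSpace (∀ a, (T a).E) (∀ a, (T a).carrier) :=
      piChartedSpace (fun a => (T a).E) (fun a => (T a).carrier)
    refine isManifold_of_contDiffOn _ _ _ fun e e' he he' => ?_
    obtain ⟨e, he, rfl⟩ := he
    obtain ⟨e', he', rfl⟩ := he'
    refine contDiffOn_pi.2 fun a => ?_
    have h := HasGroupoid.compatible (G := contDiffGroupoid ω 𝓘(ℂ, (T a).E))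
      (he a (Set.mem_univ a)) (he' a (Set.mem_univ a))
    have h1 := (mem_groupoid_of_pregroupoid.1 h).1
    have h2 : ContDiffOn ℂ ω (fun z => (e' a) ((e a).symm z)) ((e a).symm ≫ₕ e' a).source :=
      ContDiffOn.mono h1 fun z hz => ⟨hz, z, rfl⟩
    refine h2.comp (f := fun z : ∀ a, (T a).E => z a)
      (contDiff_pi.1 contDiff_id a).contDiffOn ?_
    rintro z ⟨⟨hz1, hz2⟩, -⟩
    exact ⟨hz1 a trivial, hz2 a trivial⟩

lemma holAt_pi {M : ComplexManifold.{u}} {F : M.carrier → (pi T).carrier} {y : M.carrier}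
    (h : ∀ a, HolAt M.E (T a).E (fun z => F z a) y) : HolAt M.E (pi T).E F y := by
  refine contMDiffAt_iff.2 ⟨?_, ?_⟩
  · exact continuousAt_pi.2 fun a => (h a).continuousAt
  · exact contDiffWithinAt_pi.2 fun a => (contMDiffAt_iff.1 (h a)).2

lemma holAt_eval (a : Fin m) (y : (pi T).carrier) :
    HolAt (pi T).E (T a).E (fun z : (pi T).carrier => z a) y := by
  refine contMDiffAt_iff.2 ⟨(continuous_apply a).continuousAt, ?_⟩
  have h2 : ContDiffWithinAt ℂ ω (fun z : (pi T).E => z a) (Set.range 𝓘(ℂ, (pi T).E))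
      (extChartAt 𝓘(ℂ, (pi T).E) y y) := (contDiff_pi.1 contDiff_id a).contDiffWithinAt
  have h3 : ∀ z : (pi T).E, z a ∈ (chartAt (T a).E (y a)).target →
      (extChartAt 𝓘(ℂ, (T a).E) (y a) ∘ (fun z : (pi T).carrier => z a) ∘
        (extChartAt 𝓘(ℂ, (pi T).E) y).symm) z = z a := fun z hz =>
    (chartAt (T a).E (y a)).right_inv hz
  refine h2.congr_of_eventuallyEq ?_ (h3 _ (mem_chart_target (T a).E (y a)))
  have h4 : Tendsto (fun z : (pi T).E => z a) (𝓝 (extChartAt 𝓘(ℂ, (pi T).E) y y))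
    (𝓝 (chartAt (T a).E (y a) (y a))) := (continuous_apply a).tendsto _
  refine Eventually.filter_mono nhdsWithin_le_nhds ?_
  filter_upwards [h4.eventually ((chartAt (T a).E (y a)).open_target.mem_nhds
    (mem_chart_target (T a).E (y a)))] with z hz using h3 z hz

/-- The map between products given by a reindexing. -/
def reindex {m' : ℕ} (f : Fin m → Fin m') (T : Fin m' → ComplexManifold.{u})
    (z : (pi T).carrier) : (pi (T ∘ f)).carrier := fun a => z (f a)

lemma holAt_reindex {m' : ℕ} (f : Fin m → Fin m') (T : Fin m' → ComplexManifold.{u})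
    (z : (pi T).carrier) : HolAt (pi T).E (pi (T ∘ f)).E (reindex f T) z :=
  holAt_pi (T ∘ f) fun a => holAt_eval T (f a) z

end ComplexManifold

end Part3

section Part4

section Germs
variable (D D' : ComplexManifold.{u}) (y : D.carrier)

lemma SmoothAt.const_smul {D : ComplexManifold.{u}} {y : D.carrier} {q : ℕ} (c : ℂ)
    {η : D.carrier → Alt D.E q} (h : SmoothAt D.E η y) : SmoothAt D.E (c • η) y :=
  SmoothAt.smul (f := fun _ => c) contDiffAt_const h

/-- The forms of type `(0,q)` which are smooth near `y`. -/
def smoothForms (q : ℕ) : Submodule ℂ (D.carrier → Alt D.E q) where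
  carrier := {η | ∀ᶠ z in 𝓝 y, SmoothAt D.E η z}
  add_mem' h h' := by filter_upwards [h, h'] with z hz hz' using hz.add hz'
  zero_mem' := Eventually.of_forall fun _ => SmoothAt.zero
  smul_mem' c _ h := by filter_upwards [h] with z hz using hz.const_smul c

/-- The forms which vanish near `y`. -/
def nullForms (q : ℕ) : Submodule ℂ (smoothForms D y q) where
  carrier := {η | (η : D.carrier → Alt D.E q) =ᶠ[𝓝 y] 0}
  add_mem' {a b} h h' := by
    filter_upwards [h, h'] with z hz hz'
    have e : (↑(a + b) : D.carrier → Alt D.E q) z = a.1 z + b.1 z := rfl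
    rw [e, hz, hz']; simp
  zero_mem' := EventuallyEq.rfl
  smul_mem' c a h := by
    filter_upwards [h] with z hz
    have e : (↑(c • a) : D.carrier → Alt D.E q) z = c • a.1 z := rfl
    rw [e, hz]; simp

/-- The stalk at `y` of the sheaf of smooth forms of type `(0,q)`. -/
abbrev FormGerm (q : ℕ) : Type u := smoothForms D y q ⧸ nullForms D y q

variable {D D' y}

/-- The germ of a form. -/
abbrev FormGerm.mk {q : ℕ} : smoothForms D y q →ₗ[ℂ] FormGerm D y q := (nullForms D y q).mkQ

lemma FormGerm.mk_eq {q : ℕ} {η η' : smoothForms D y q}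
    (h : (η : D.carrier → Alt D.E q) =ᶠ[𝓝 y] η') : FormGerm.mk η = FormGerm.mk η' := by
  refine (Submodule.Quotient.eq _).2 ?_
  filter_upwards [h] with z hz
  have e : (↑(η - η') : D.carrier → Alt D.E q) z = η.1 z - η'.1 z := rfl
  rw [e, hz]; simp

lemma FormGerm.mk_eq_iff {q : ℕ} {η η' : smoothForms D y q} :
    FormGerm.mk η = FormGerm.mk η' ↔ (η : D.carrier → Alt D.E q) =ᶠ[𝓝 y] η' := by
  refine ⟨fun h => ?_, FormGerm.mk_eq⟩
  have h' := (Submodule.Quotient.eq _).1 h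
  filter_upwards [h'] with z hz
  have e : (↑(η - η') : D.carrier → Alt D.E q) z = η.1 z - η'.1 z := rfl
  rw [e] at hz
  exact sub_eq_zero.1 hz

lemma dbar_mem {q : ℕ} (η : smoothForms D y q) : dbar D.E η.1 ∈ smoothForms D y (q + 1) := by
  filter_upwards [η.2.eventually_nhds] with z hz using SmoothAt.dbar hz

/-- The operator `∂̄` on germs of forms. -/
def dbarGerm {q : ℕ} : FormGerm D y q →ₗ[ℂ] FormGerm D y (q + 1) :=
  (nullForms D y q).liftQ
    { toFun η := FormGerm.mk ⟨dbar D.E η.1, dbar_mem η⟩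
      map_add' η η' := by
        rw [← map_add]
        refine FormGerm.mk_eq ?_
        filter_upwards [η.2, η'.2] with z hz hz' using dbar_add hz hz'
      map_smul' c η := by
        rw [RingHom.id_apply, ← map_smul]
        refine FormGerm.mk_eq ?_
        filter_upwards [η.2] with z hz
        exact dbar_smul (f := fun _ => c) contMDiffAt_const hz }
    (by
      intro η hη
      refine (FormGerm.mk_eq (η' := 0) ?_).trans (map_zero _)
      filter_upwards [EventuallyEq.eventuallyEq_nhds hη] with z hz
      refine (dbar_congr hz).trans ?_
      have := dbar_add (E := D.E) (η := (0 : D.carrier → Alt D.E q)) (η' := 0) (y := z)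
        SmoothAt.zero SmoothAt.zero
      simpa using this)

lemma dbarGerm_mk {q : ℕ} (η : smoothForms D y q) :
    dbarGerm (FormGerm.mk η) = FormGerm.mk ⟨dbar D.E η.1, dbar_mem η⟩ := rfl

lemma dbarGerm_dbarGerm {q : ℕ} (g : FormGerm D y q) : dbarGerm (dbarGerm g) = 0 := by
  obtain ⟨η, rfl⟩ := Submodule.mkQ_surjective _ g
  refine (FormGerm.mk_eq (η' := 0) ?_).trans (map_zero _)
  filter_upwards [η.2.eventually_nhds] with z hz using dbar_dbar hz

lemma pullback_mem {q : ℕ} {F : D.carrier → D'.carrier} (hF : HolAt D.E D'.E F y)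
    (η : smoothForms D' (F y) q) : pullback D.E D'.E F η.1 ∈ smoothForms D y q := by
  filter_upwards [hF.eventually, hF.continuousAt.eventually η.2] with z hz hz'
  exact SmoothAt.pullback hz hz'

/-- Pullback of germs of forms along a holomorphic map. -/
def pullGerm {q : ℕ} (F : D.carrier → D'.carrier) (hF : HolAt D.E D'.E F y) :
    FormGerm D' (F y) q →ₗ[ℂ] FormGerm D y q :=
  (nullForms D' (F y) q).liftQ
    { toFun η := FormGerm.mk ⟨pullback D.E D'.E F η.1, pullback_mem hF η⟩
      map_add' η η' := by
        rw [← map_add]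
        refine FormGerm.mk_eq (Eventually.of_forall fun z => ?_)
        ext v; simp [pullback]
      map_smul' c η := by
        rw [RingHom.id_apply, ← map_smul]
        refine FormGerm.mk_eq (Eventually.of_forall fun z => ?_)
        ext v; simp [pullback] }
    (by
      intro η hη
      refine (FormGerm.mk_eq (η' := 0) ?_).trans (map_zero _)
      filter_upwards [hF.continuousAt.eventually hη] with z hz
      ext v; simp [pullback, hz])

lemma pullGerm_mk {q : ℕ} (F : D.carrier → D'.carrier) (hF : HolAt D.E D'.E F y)
    (η : smoothForms D' (F y) q) : pullGerm F hF (FormGerm.mk η) =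
      FormGerm.mk ⟨pullback D.E D'.E F η.1, pullback_mem hF η⟩ := rfl

lemma pullGerm_dbarGerm {q : ℕ} (F : D.carrier → D'.carrier) (hF : HolAt D.E D'.E F y)
    (g : FormGerm D' (F y) q) : pullGerm F hF (dbarGerm g) = dbarGerm (pullGerm F hF g) := by
  obtain ⟨η, rfl⟩ := Submodule.mkQ_surjective _ g
  refine FormGerm.mk_eq ?_
  filter_upwards [hF.eventually, hF.continuousAt.eventually η.2.eventually_nhds] with z hz hz'
  exact (dbar_pullback hz hz').symm

variable (I : Set (D.carrier → ℂ))

/-- For a set `I` of functions, the subspace `I·ℰ^{0,q}` of the stalk of the forms. -/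
def relI (q : ℕ) : Submodule ℂ (FormGerm D y q) :=
  Submodule.span ℂ {g | ∃ f ∈ I, ∃ η η' : smoothForms D y q,
    (∀ z, η'.1 z = f z • η.1 z) ∧ g = FormGerm.mk η'}

/-- The subspace `Ī·ℰ^{0,q}` of the stalk of the forms. -/
def relConj (q : ℕ) : Submodule ℂ (FormGerm D y q) :=
  Submodule.span ℂ {g | ∃ f ∈ I, ∃ η η' : smoothForms D y q,
    (∀ z, η'.1 z = starRingEnd ℂ (f z) • η.1 z) ∧ g = FormGerm.mk η'}

/-- The subspace generated by `I·ℰ^{0,q}`, `Ī·ℰ^{0,q}` and `∂̄(Ī·ℰ^{0,q-1})`. -/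
def relM : ∀ q : ℕ, Submodule ℂ (FormGerm D y q)
  | 0 => relI I 0 ⊔ relConj I 0
  | q + 1 => relI I (q + 1) ⊔ relConj I (q + 1) ⊔ (relConj I q).map dbarGerm

variable {I}

lemma relI_le_relM (q : ℕ) : relI (y := y) I q ≤ relM I q := by
  cases q with
  | zero => exact le_sup_left
  | succ q => exact le_sup_left.trans le_sup_left

lemma relConj_le_relM (q : ℕ) : relConj (y := y) I q ≤ relM I q := by
  cases q with
  | zero => exact le_sup_right
  | succ q => exact le_sup_right.trans le_sup_left

lemma relI_dbar (hI : ∀ f ∈ I, ContMDiffAt 𝓘(ℂ, D.E) 𝓘(ℂ, ℂ) ω f y) (q : ℕ) :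
    relI (y := y) I q ≤ (relI I (q + 1)).comap dbarGerm := by
  refine Submodule.span_le.2 ?_
  rintro _ ⟨f, hf, η, η', h, rfl⟩
  have hev : ∀ᶠ z in 𝓝 y, ContMDiffAt 𝓘(ℂ, D.E) 𝓘(ℂ, ℂ) ω f z :=
    (contMDiffAt_iff_contMDiffAt_nhds (by simp)).1 (hI f hf)
  have h1 : η'.1 = fun z => f z • η.1 z := funext h
  have h2 : (fun z => f z • dbar D.E η.1 z) ∈ smoothForms D y (q + 1) := by
    filter_upwards [hev, dbar_mem η] with z hz hz' using SmoothAt.smul (smoothFun_hol hz) hz'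
  refine Submodule.subset_span ⟨f, hf, ⟨_, dbar_mem η⟩, ⟨_, h2⟩, fun _ => rfl, ?_⟩
  refine FormGerm.mk_eq ?_
  filter_upwards [hev, η.2] with z hz hz'
  rw [h1]
  exact dbar_smul hz hz'

lemma relM_dbar (hI : ∀ f ∈ I, ContMDiffAt 𝓘(ℂ, D.E) 𝓘(ℂ, ℂ) ω f y) (q : ℕ) :
    relM (y := y) I q ≤ (relM I (q + 1)).comap dbarGerm := by
  have h1 : relI (y := y) I q ≤ (relM I (q + 1)).comap dbarGerm :=
    (relI_dbar hI q).trans (Submodule.comap_mono (relI_le_relM _))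
  have h2 : relConj (y := y) I q ≤ (relM I (q + 1)).comap dbarGerm :=
    Submodule.map_le_iff_le_comap.1 le_sup_right
  cases q with
  | zero => exact sup_le h1 h2
  | succ q =>
    refine sup_le (sup_le h1 h2) ?_
    rintro _ ⟨g, -, rfl⟩
    rw [Submodule.mem_comap, dbarGerm_dbarGerm]
    exact Submodule.zero_mem _

variable {I' : Set (D'.carrier → ℂ)} {F : D.carrier → D'.carrier}

lemma relI_pull (hF : HolAt D.E D'.E F y) (hI : ∀ f ∈ I', f ∘ F ∈ I) (q : ℕ) :
    relI (y := F y) I' q ≤ (relI I q).comap (pullGerm F hF) := by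
  refine Submodule.span_le.2 ?_
  rintro _ ⟨f, hf, η, η', h, rfl⟩
  refine Submodule.subset_span ⟨f ∘ F, hI f hf, ⟨_, pullback_mem hF η⟩, ⟨_, pullback_mem hF η'⟩,
    fun z => ?_, rfl⟩
  ext v; simp [pullback, h]

lemma relConj_pull (hF : HolAt D.E D'.E F y) (hI : ∀ f ∈ I', f ∘ F ∈ I) (q : ℕ) :
    relConj (y := F y) I' q ≤ (relConj I q).comap (pullGerm F hF) := by
  refine Submodule.span_le.2 ?_
  rintro _ ⟨f, hf, η, η', h, rfl⟩
  refine Submodule.subset_span ⟨f ∘ F, hI f hf, ⟨_, pullback_mem hF η⟩, ⟨_, pullback_mem hF η'⟩,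
    fun z => ?_, rfl⟩
  ext v; simp [pullback, h]

lemma relM_pull (hF : HolAt D.E D'.E F y) (hI : ∀ f ∈ I', f ∘ F ∈ I) (q : ℕ) :
    relM (y := F y) I' q ≤ (relM I q).comap (pullGerm F hF) := by
  have h1 := (relI_pull hF hI q).trans (Submodule.comap_mono (relI_le_relM (I := I) (y := y) q))
  have h2 := (relConj_pull hF hI q).trans
    (Submodule.comap_mono (relConj_le_relM (I := I) (y := y) q))
  cases q with
  | zero => exact sup_le h1 h2
  | succ q =>
    refine sup_le (sup_le h1 h2) ?_
    rintro _ ⟨g, hg, rfl⟩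
    refine Submodule.mem_sup_right ⟨pullGerm F hF g, relConj_pull hF hI q hg, ?_⟩
    exact (pullGerm_dbarGerm F hF g).symm

end Germs

end Part4

section Part5

/-- A locally ringed space over the complex numbers. -/
structure ComplexRingedSpace : Type (u + 1) where
  toLRS : AlgebraicGeometry.LocallyRingedSpace.{u}
  scalars : ℂ →+* toLRS.presheaf.obj (op ⊤)

namespace ComplexRingedSpace

/-- The underlying topological space. -/
abbrev top (X : ComplexRingedSpace.{u}) : TopCat.{u} := X.toLRS.toTopCat

/-- The structure sheaf. -/
abbrev str (X : ComplexRingedSpace.{u}) : TopCat.Presheaf CommRingCat.{u} X.top :=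
  X.toLRS.presheaf

/-- The constant functions on an open set. -/
def const (X : ComplexRingedSpace.{u}) (V : Opens X.top) : ℂ →+* X.str.obj (op V) :=
  (X.str.map (homOfLE le_top : V ⟶ ⊤).op).hom.comp X.scalars

end ComplexRingedSpace

/-- The inverse image, as an open subset of `X`, of an open set under a continuous map from an open
subset of `X`. -/
def preimageOpens {X : TopCat.{u}} {D : Type u} [TopologicalSpace D] {U : Opens X} {k : U → D}
    (hk : Continuous k) (W : Opens D) : Opens X :=
  ⟨Subtype.val '' (k ⁻¹' W), U.isOpen.isOpenMap_subtype_val _ (W.isOpen.preimage hk)⟩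

lemma preimageOpens_mono {X : TopCat.{u}} {D : Type u} [TopologicalSpace D] {U : Opens X}
    {k : U → D} (hk : Continuous k) {W' W : Opens D} (h : W' ≤ W) :
    preimageOpens hk W' ≤ preimageOpens hk W := Set.image_mono (Set.preimage_mono h)

lemma mem_preimageOpens {X : TopCat.{u}} {D : Type u} [TopologicalSpace D] {U : Opens X}
    {k : U → D} (hk : Continuous k) {W : Opens D} (x : U) (h : k x ∈ W) :
    x.1 ∈ preimageOpens hk W := ⟨x, h, rfl⟩

/-- The ring of holomorphic functions on an open subset of a complex manifold. -/
abbrev Hol (D : ComplexManifold.{u}) (W : Opens D.carrier) : Type u :=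
  C^ω⟮𝓘(ℂ, D.E), W; 𝓘(ℂ, ℂ), ℂ⟯

/-- Restriction of holomorphic functions. -/
abbrev Hol.res {D : ComplexManifold.{u}} {W' W : Opens D.carrier} (h : W' ≤ W) :
    Hol D W →+* Hol D W' :=
  ContMDiffMap.restrictRingHom 𝓘(ℂ, D.E) 𝓘(ℂ, ℂ) ℂ h

/-- An embedding triple of `X`: an open subspace `U` of `X` and a closed embedding of (locally)
ringed spaces `k` of `U` in a complex manifold `D`, such that `𝒪_U` is the quotient of `𝒪_D` by an
ideal of finite type. -/
structure EmbeddingTriple (X : ComplexRingedSpace.{u}) : Type (u + 1) where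
  U : Opens X.top
  D : ComplexManifold.{u}
  t2 : T2Space D.carrier
  paracompact : ParacompactSpace D.carrier
  k : U → D.carrier
  isClosedEmbedding : Topology.IsClosedEmbedding k
  /-- the comorphism `𝒪_D → k_* 𝒪_U` -/
  comap (W : Opens D.carrier) :
    Hol D W →+* X.str.obj (op (preimageOpens isClosedEmbedding.continuous W))
  comap_res {W' W : Opens D.carrier} (h : W' ≤ W) (F : Hol D W) :
    comap W' (Hol.res h F) =
      X.str.map (homOfLE (preimageOpens_mono isClosedEmbedding.continuous h)).op (comap W F)
  comap_const (W : Opens D.carrier) (c : ℂ) :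
    comap W (algebraMap ℂ (Hol D W) c) = X.const _ c
  /-- the comorphism is surjective on stalks -/
  surjective (x : U) (s : X.str.stalk x.1) : ∃ (W : Opens D.carrier) (h : k x ∈ W) (F : Hol D W),
    X.str.germ _ x.1 (mem_preimageOpens isClosedEmbedding.continuous x h) (comap W F) = s
  /-- the kernel of the comorphism is locally finitely generated -/
  finite_type (y : D.carrier) : ∃ W : Opens D.carrier, y ∈ W ∧ ∃ (r : ℕ) (g : Fin r → Hol D W),
    (∀ i, comap W (g i) = 0) ∧
    ∀ (V : Opens D.carrier) (hV : V ≤ W) (F : Hol D V), comap V F = 0 → ∀ z ∈ V,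
      ∃ (V' : Opens D.carrier) (h : V' ≤ V), z ∈ V' ∧ ∃ c : Fin r → Hol D V',
        Hol.res h F = ∑ i, c i * Hol.res (h.trans hV) (g i)

/-- A (complex) analytic space: a locally ringed space over `ℂ` which is locally a closed subspace
of a complex manifold, defined by an ideal of finite type. -/
structure AnalyticSpace : Type (u + 1) extends ComplexRingedSpace.{u} where
  locally_embedded : ∀ x : toComplexRingedSpace.top,
    ∃ T : EmbeddingTriple toComplexRingedSpace, x ∈ T.U

/-- An atlas of embedding triples, indexed by `ι`. -/
structure EmbeddingAtlas (X : AnalyticSpace.{u}) (ι : Type u) where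
  triple : ι → EmbeddingTriple X.toComplexRingedSpace
  covers : ∀ x : X.top, ∃ i, x ∈ (triple i).U

variable {X : ComplexRingedSpace.{u}}

namespace EmbeddingTriple

/-- The germ `s ∈ 𝒪_{X,x}` is the pullback along `k` of the germ of `f` at `k x`; in particular `f`
is holomorphic near `k x`. -/
def Pulls (T : EmbeddingTriple X) (x : X.top) (hx : x ∈ T.U) (f : T.D.carrier → ℂ)
    (s : X.str.stalk x) : Prop :=
  ∃ (W : Opens T.D.carrier) (h : T.k ⟨x, hx⟩ ∈ W) (F : Hol T.D W), (∀ z : W, F z = f z) ∧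
    X.str.germ _ x (mem_preimageOpens T.isClosedEmbedding.continuous ⟨x, hx⟩ h) (T.comap W F) = s

lemma Pulls.holAt {T : EmbeddingTriple X} {x : X.top} {hx : x ∈ T.U} {f : T.D.carrier → ℂ}
    {s : X.str.stalk x} (h : T.Pulls x hx f s) :
    ContMDiffAt 𝓘(ℂ, T.D.E) 𝓘(ℂ, ℂ) ω f (T.k ⟨x, hx⟩) := by
  obtain ⟨W, h, F, hF, -⟩ := h
  have h1 : ContMDiffAt 𝓘(ℂ, T.D.E) 𝓘(ℂ, ℂ) ω (fun z : W => f z) ⟨_, h⟩ := by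
    have := F.contMDiff ⟨_, h⟩
    rwa [show (F : W → ℂ) = fun z : W => f z from funext hF] at this
  exact contMDiffAt_subtype_iff.1 h1

end EmbeddingTriple

section Families

variable {m m' m'' : ℕ} (T : Fin m → EmbeddingTriple X) (x : X.top)

/-- The product of the ambient manifolds of a finite family of embedding triples. -/
def famD : ComplexManifold.{u} := ComplexManifold.pi fun a => (T a).D

variable {x} (hx : ∀ a, x ∈ (T a).U)

/-- The image of `x` under the diagonal embedding. -/
def famPt : (famD T).carrier := fun a => (T a).k ⟨x, hx a⟩

/-- The ideal at the image of `x` of the diagonal embedding of the intersection of the open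
sets `U_a` in the product of the manifolds `D_a`, that is, of the fibre product over `X`: it is generated by the differences `f ∘ pr_a - g ∘ pr_b`, where `f` and `g` are
germs of holomorphic functions on `D_a` and `D_b` with the same pullback to `X`. -/
def famIdeal : Set ((famD T).carrier → ℂ) :=
  Submodule.span ℂ {F | ∃ c : (famD T).carrier → ℂ,
    ContMDiffAt 𝓘(ℂ, (famD T).E) 𝓘(ℂ, ℂ) ω c (famPt T hx) ∧
    ∃ (a b : Fin m) (s : X.str.stalk x) (f : (T a).D.carrier → ℂ) (g : (T b).D.carrier → ℂ),
      (T a).Pulls x (hx a) f s ∧ (T b).Pulls x (hx b) g s ∧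
      F = fun z => c z * (f (z a) - g (z b))}

lemma famIdeal_hol : ∀ F ∈ famIdeal T hx,
    ContMDiffAt 𝓘(ℂ, (famD T).E) 𝓘(ℂ, ℂ) ω F (famPt T hx) := by
  intro F hF
  induction hF using Submodule.span_induction with
  | mem F hF =>
    obtain ⟨c, hc, a, b, s, f, g, hf, hg, rfl⟩ := hF
    refine hc.mul (ContMDiffAt.sub ?_ ?_)
    · exact ContMDiffAt.comp (famPt T hx) (g := f) (f := fun z : (famD T).carrier => z a)
        hf.holAt (ComplexManifold.holAt_eval _ a _)
    · exact ContMDiffAt.comp (famPt T hx) (g := g) (f := fun z : (famD T).carrier => z b)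
        hg.holAt (ComplexManifold.holAt_eval _ b _)
  | zero => exact contMDiffAt_const
  | add F G _ _ hF hG => exact hF.add hG
  | smul c F _ hF => exact (contMDiffAt_const (c := c)).mul hF

/-- The projection between products of ambient manifolds given by a reindexing of families. -/
def famMap (f : Fin m → Fin m') (T : Fin m' → EmbeddingTriple X) :
    (famD T).carrier → (famD (T ∘ f)).carrier :=
  ComplexManifold.reindex f fun a => (T a).D

lemma holAt_famMap (f : Fin m → Fin m') (T : Fin m' → EmbeddingTriple X) (z : (famD T).carrier) :
    HolAt (famD T).E (famD (T ∘ f)).E (famMap f T) z :=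
  ComplexManifold.holAt_reindex f (fun a => (T a).D) z

lemma famIdeal_reindex (f : Fin m → Fin m') (T : Fin m' → EmbeddingTriple X)
    (hx : ∀ a, x ∈ (T a).U) : ∀ F ∈ famIdeal (T ∘ f) (fun a => hx (f a)),
      F ∘ famMap f T ∈ famIdeal T hx := by
  intro F hF
  induction hF using Submodule.span_induction with
  | mem F hF =>
    obtain ⟨c, hc, a, b, s, g, h, hg, hh, rfl⟩ := hF
    refine Submodule.subset_span ⟨c ∘ famMap f T, ?_, f a, f b, s, g, h, hg, hh, rfl⟩
    exact ContMDiffAt.comp (famPt T hx) hc (holAt_famMap f T _)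
  | zero => exact Submodule.zero_mem _
  | add F G _ _ hF hG => exact Submodule.add_mem _ hF hG
  | smul c F _ hF => exact Submodule.smul_mem _ c hF

end Families

end Part5

section Part6

variable {X : ComplexRingedSpace.{u}}

section Stalks
variable {m m' m'' : ℕ} (T : Fin m → EmbeddingTriple X) {x : X.top} (hx : ∀ a, x ∈ (T a).U)

/-- The stalk of `ℰ^{0,q}_D / I ℰ^{0,q}_D`, for the diagonal embedding in the product `D`. -/
def DolbStalk (q : ℕ) : Type u :=
  FormGerm (famD T) (famPt T hx) q ⧸ relI (y := famPt T hx) (famIdeal T hx) q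

/-- The stalk of `ℰ^{0,q}_D / ℳ^q`, for the diagonal embedding in the product `D`. -/
def ModelStalk (q : ℕ) : Type u :=
  FormGerm (famD T) (famPt T hx) q ⧸ relM (y := famPt T hx) (famIdeal T hx) q

instance (q : ℕ) : AddCommGroup (DolbStalk T hx q) :=
  inferInstanceAs (AddCommGroup (_ ⧸ relI (y := famPt T hx) (famIdeal T hx) q))

instance (q : ℕ) : Module ℂ (DolbStalk T hx q) :=
  inferInstanceAs (Module ℂ (_ ⧸ relI (y := famPt T hx) (famIdeal T hx) q))

instance (q : ℕ) : AddCommGroup (ModelStalk T hx q) :=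
  inferInstanceAs (AddCommGroup (_ ⧸ relM (y := famPt T hx) (famIdeal T hx) q))

instance (q : ℕ) : Module ℂ (ModelStalk T hx q) :=
  inferInstanceAs (Module ℂ (_ ⧸ relM (y := famPt T hx) (famIdeal T hx) q))

variable {T}

/-- The class of a germ of a form. -/
def DolbStalk.mk (q : ℕ) : FormGerm (famD T) (famPt T hx) q →ₗ[ℂ] DolbStalk T hx q :=
  Submodule.mkQ (relI (y := famPt T hx) (famIdeal T hx) q)

/-- The class of a germ of a form. -/
def ModelStalk.mk (q : ℕ) : FormGerm (famD T) (famPt T hx) q →ₗ[ℂ] ModelStalk T hx q :=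
  Submodule.mkQ (relM (y := famPt T hx) (famIdeal T hx) q)

lemma DolbStalk.mk_surjective (q : ℕ) : Function.Surjective (DolbStalk.mk (T := T) hx q) :=
  Submodule.mkQ_surjective _

lemma ModelStalk.mk_surjective (q : ℕ) : Function.Surjective (ModelStalk.mk (T := T) hx q) :=
  Submodule.mkQ_surjective _

/-- `∂̄` on `ℰ^{0,q}_D / I ℰ^{0,q}_D`. -/
def DolbStalk.d (q : ℕ) : DolbStalk T hx q →ₗ[ℂ] DolbStalk T hx (q + 1) :=
  Submodule.mapQ _ _ dbarGerm (relI_dbar (famIdeal_hol T hx) q)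

/-- `∂̄` on `ℰ^{0,q}_D / ℳ^q`. -/
def ModelStalk.d (q : ℕ) : ModelStalk T hx q →ₗ[ℂ] ModelStalk T hx (q + 1) :=
  Submodule.mapQ _ _ dbarGerm (relM_dbar (famIdeal_hol T hx) q)

/-- The natural quotient map `ℰ^{0,q}_D / I ℰ^{0,q}_D → ℰ^{0,q}_D / ℳ^q`. -/
def toModelStalk (q : ℕ) : DolbStalk T hx q →ₗ[ℂ] ModelStalk T hx q :=
  Submodule.factor (relI_le_relM q)

variable (f : Fin m → Fin m') {T' : Fin m' → EmbeddingTriple X} (hx' : ∀ a, x ∈ (T' a).U)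

/-- Pullback along the projection of a product on a smaller product. -/
def DolbStalk.pull (q : ℕ) : DolbStalk (T' ∘ f) (fun a => hx' (f a)) q →ₗ[ℂ] DolbStalk T' hx' q :=
  Submodule.mapQ _ _ (pullGerm (y := famPt T' hx') (famMap f T') (holAt_famMap f T' _))
    (relI_pull (y := famPt T' hx') (holAt_famMap f T' _) (famIdeal_reindex f T' hx') q)

/-- Pullback along the projection of a product on a smaller product. -/
def ModelStalk.pull (q : ℕ) :
    ModelStalk (T' ∘ f) (fun a => hx' (f a)) q →ₗ[ℂ] ModelStalk T' hx' q :=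
  Submodule.mapQ _ _ (pullGerm (y := famPt T' hx') (famMap f T') (holAt_famMap f T' _))
    (relM_pull (y := famPt T' hx') (holAt_famMap f T' _) (famIdeal_reindex f T' hx') q)

lemma DolbStalk.d_d (q : ℕ) (s : DolbStalk T hx q) :
    DolbStalk.d hx (q + 1) (DolbStalk.d hx q s) = 0 := by
  obtain ⟨g, rfl⟩ := DolbStalk.mk_surjective hx q s
  change DolbStalk.mk hx _ (dbarGerm (dbarGerm g)) = 0
  rw [dbarGerm_dbarGerm, map_zero]

lemma ModelStalk.d_d (q : ℕ) (s : ModelStalk T hx q) :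
    ModelStalk.d hx (q + 1) (ModelStalk.d hx q s) = 0 := by
  obtain ⟨g, rfl⟩ := ModelStalk.mk_surjective hx q s
  change ModelStalk.mk hx _ (dbarGerm (dbarGerm g)) = 0
  rw [dbarGerm_dbarGerm, map_zero]

lemma DolbStalk.d_pull (q : ℕ) (s : DolbStalk (T' ∘ f) (fun a => hx' (f a)) q) :
    DolbStalk.d hx' q (DolbStalk.pull f hx' q s) =
      DolbStalk.pull f hx' (q + 1) (DolbStalk.d _ q s) := by
  obtain ⟨g, rfl⟩ := DolbStalk.mk_surjective _ q s
  exact congrArg (DolbStalk.mk _ _)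
    (pullGerm_dbarGerm (y := famPt T' hx') (famMap f T') (holAt_famMap f T' _) g).symm

lemma ModelStalk.d_pull (q : ℕ) (s : ModelStalk (T' ∘ f) (fun a => hx' (f a)) q) :
    ModelStalk.d hx' q (ModelStalk.pull f hx' q s) =
      ModelStalk.pull f hx' (q + 1) (ModelStalk.d _ q s) := by
  obtain ⟨g, rfl⟩ := ModelStalk.mk_surjective _ q s
  exact congrArg (ModelStalk.mk _ _)
    (pullGerm_dbarGerm (y := famPt T' hx') (famMap f T') (holAt_famMap f T' _) g).symm

lemma DolbStalk.pull_pull (g : Fin m' → Fin m'') {T'' : Fin m'' → EmbeddingTriple X}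
    (hx'' : ∀ a, x ∈ (T'' a).U) (q : ℕ)
    (s : DolbStalk ((T'' ∘ g) ∘ f) (fun a => hx'' (g (f a))) q) :
    DolbStalk.pull g hx'' q (DolbStalk.pull f (fun a => hx'' (g a)) q s) =
      DolbStalk.pull (g ∘ f) hx'' q s := by
  obtain ⟨h, rfl⟩ := DolbStalk.mk_surjective _ q s
  obtain ⟨η, rfl⟩ := Submodule.mkQ_surjective _ h
  refine congrArg (DolbStalk.mk _ _) (FormGerm.mk_eq (Eventually.of_forall fun z => ?_))
  exact (pullback_comp (F := famMap g T'') (G := famMap f (T'' ∘ g)) (holAt_famMap f (T'' ∘ g) _)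
    (holAt_famMap g T'' z) η.1).symm

end Stalks

section Intrinsic
variable (x : X.top)

/-- Finite families of embedding triples around `x`. -/
structure EmbeddingsAt : Type (u + 1) where
  m : ℕ
  T : Fin (m + 1) → EmbeddingTriple X
  mem : ∀ a, x ∈ (T a).U

variable {x}

/-- The family deduced from a family by a reindexing. -/
abbrev EmbeddingsAt.reindex (S : EmbeddingsAt x) {m : ℕ} (f : Fin (m + 1) → Fin (S.m + 1)) :
    EmbeddingsAt x := ⟨m, S.T ∘ f, fun a => S.mem (f a)⟩

variable (x)

open Classical in
/-- The relations between forms on different embeddings. -/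
def smoothFormRel (q : ℕ) : Submodule ℂ (DirectSum (EmbeddingsAt x) fun S => ModelStalk S.T S.mem q) :=
  Submodule.span ℂ {g | ∃ (S : EmbeddingsAt x) (m : ℕ) (f : Fin (m + 1) → Fin (S.m + 1))
    (s : ModelStalk (S.T ∘ f) (fun a => S.mem (f a)) q),
    g = DirectSum.lof ℂ (EmbeddingsAt x) (fun S => ModelStalk S.T S.mem q) S
        (ModelStalk.pull f S.mem q s) -
      DirectSum.lof ℂ (EmbeddingsAt x) (fun S => ModelStalk S.T S.mem q) (S.reindex f) s}

/-- The stalk at `x` of the sheaf `ℰ^{0,q}_X` of smooth forms of type `(0,q)` on `X`: the colimit of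
the stalks `ℰ^{0,q}_D / ℳ^q` over all finite families of embedding triples around `x`, the
transition maps being the pullbacks along the projections of the ambient manifolds. -/
def SmoothFormStalk (q : ℕ) : Type (u + 1) :=
  DirectSum (EmbeddingsAt x) (fun S => ModelStalk S.T S.mem q) ⧸ smoothFormRel x q

instance (q : ℕ) : AddCommGroup (SmoothFormStalk x q) :=
  inferInstanceAs (AddCommGroup (_ ⧸ smoothFormRel x q))

instance (q : ℕ) : Module ℂ (SmoothFormStalk x q) :=
  inferInstanceAs (Module ℂ (_ ⧸ smoothFormRel x q))

variable {x}

open Classical in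
/-- The element of the stalk of `ℰ^{0,q}_X` given by a form on an ambient manifold. -/
def SmoothFormStalk.of (S : EmbeddingsAt x) (q : ℕ) :
    ModelStalk S.T S.mem q →ₗ[ℂ] SmoothFormStalk x q :=
  (Submodule.mkQ (smoothFormRel x q)).comp
    (DirectSum.lof ℂ (EmbeddingsAt x) (fun S => ModelStalk S.T S.mem q) S)

lemma SmoothFormStalk.of_pull (S : EmbeddingsAt x) {m : ℕ} (f : Fin (m + 1) → Fin (S.m + 1))
    (q : ℕ) (s : ModelStalk (S.T ∘ f) (fun a => S.mem (f a)) q) :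
    SmoothFormStalk.of S q (ModelStalk.pull f S.mem q s) =
      SmoothFormStalk.of (S.reindex f) q s :=
  (Submodule.Quotient.eq _).2 (Submodule.subset_span ⟨S, m, f, s, rfl⟩)

open Classical in
/-- The operator `∂̄` of `X`. -/
def SmoothFormStalk.d (q : ℕ) : SmoothFormStalk x q →ₗ[ℂ] SmoothFormStalk x (q + 1) :=
  Submodule.liftQ _ (DirectSum.toModule ℂ (EmbeddingsAt x) _
      fun S => (SmoothFormStalk.of S (q + 1)).comp (ModelStalk.d S.mem q)) (by
    refine Submodule.span_le.2 ?_
    rintro _ ⟨S, m, f, s, rfl⟩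
    rw [SetLike.mem_coe, LinearMap.mem_ker, map_sub, DirectSum.toModule_lof,
      DirectSum.toModule_lof, LinearMap.comp_apply, ModelStalk.d_pull, SmoothFormStalk.of_pull,
      sub_eq_zero]
    rfl)

lemma SmoothFormStalk.d_of (S : EmbeddingsAt x) (q : ℕ) (s : ModelStalk S.T S.mem q) :
    SmoothFormStalk.d q (SmoothFormStalk.of S q s) =
      SmoothFormStalk.of S (q + 1) (ModelStalk.d S.mem q s) := by
  classical
  exact DirectSum.toModule_lof (R := ℂ) (M := fun S : EmbeddingsAt x => ModelStalk S.T S.mem q)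
    (φ := fun S => (SmoothFormStalk.of S (q + 1)).comp (ModelStalk.d S.mem q)) S s

lemma SmoothFormStalk.hom_ext {q : ℕ} {N : Type*} [AddCommGroup N] [Module ℂ N]
    {φ ψ : SmoothFormStalk x q →ₗ[ℂ] N}
    (h : ∀ S s, φ (SmoothFormStalk.of S q s) = ψ (SmoothFormStalk.of S q s)) : φ = ψ := by
  classical
  refine Submodule.linearMap_qext _ (DirectSum.linearMap_ext _ fun S => ?_)
  ext1 s
  exact h S s

lemma SmoothFormStalk.d_d (q : ℕ) (s : SmoothFormStalk x q) :
    SmoothFormStalk.d (q + 1) (SmoothFormStalk.d q s) = 0 := by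
  have : (SmoothFormStalk.d (q + 1)).comp (SmoothFormStalk.d (x := x) q) = 0 :=
    SmoothFormStalk.hom_ext fun S s => by
      rw [LinearMap.comp_apply, SmoothFormStalk.d_of, SmoothFormStalk.d_of, ModelStalk.d_d,
        map_zero]; rfl
  exact LinearMap.congr_fun this s

end Intrinsic

end Part6

section Part7

lemma alternating_sum_faces {p : ℕ} {N : Type*} [AddCommGroup N] [Module ℂ N]
    (Ψ : (Fin (p + 1) ↪o Fin (p + 3)) → N) :
    ∑ i : Fin (p + 3), ∑ j : Fin (p + 2), ((-1 : ℂ) ^ (i : ℕ) * (-1) ^ (j : ℕ)) •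
      Ψ ((Fin.succAboveOrderEmb j).trans (Fin.succAboveOrderEmb i)) = 0 := by
  rw [← Finset.sum_product']
  refine Finset.sum_involution (fun a _ => (a.1.succAbove a.2, a.2.predAbove a.1)) ?_ ?_ ?_ ?_
  · rintro ⟨i, j⟩ -
    have h : (Fin.succAboveOrderEmb (j.predAbove i)).trans
        (Fin.succAboveOrderEmb (i.succAbove j)) =
        (Fin.succAboveOrderEmb j).trans (Fin.succAboveOrderEmb i) := by
      ext k : 1
      exact Fin.succAbove_succAbove_succAbove_predAbove i j k
    simp only [h]
    rw [← add_smul, ← pow_add, ← pow_add, Fin.neg_one_pow_succAbove_add_predAbove,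
      add_comm, neg_add_cancel, zero_smul]
  · rintro ⟨i, j⟩ - - h
    exact Fin.succAbove_ne i j (congrArg Prod.fst h)
  · intro a _; simp
  · rintro ⟨i, j⟩ -
    simp only [Fin.succAbove_succAbove_predAbove, Fin.predAbove_predAbove_succAbove]

/-- Sheaves of complex vector spaces on `X`. -/
abbrev VecSheaf (X : TopCat.{u}) : Type (u + 2) :=
  CategoryTheory.Sheaf (Opens.grothendieckTopology X) (ModuleCat.{u + 1} ℂ)

section
variable {X : TopCat.{u}} {ι : Type u} [LinearOrder ι] (U : ι → Opens X)

/-- The intersection `U_α = U_{α 0} ∩ ... ∩ U_{α p}`. -/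
abbrev Inter {p : ℕ} (α : Fin (p + 1) ↪o ι) : Type u := {x : X // ∀ j, x ∈ U (α j)}

variable {U}

/-- The inclusion of `U_β` in `U_α`, for a face `α` of `β`. -/
abbrev Inter.face {p p' : ℕ} {β : Fin (p' + 1) ↪o ι} (f : Fin (p + 1) ↪o Fin (p' + 1))
    (x : Inter U β) : Inter U (f.trans β) := ⟨x.1, fun j => x.2 (f j)⟩

end

/-- A system of complexes of sheaves of complex vector spaces on the intersections `U_α`, with
connecting morphisms `r` from a face of a simplex to the simplex. The sheaves are given by their
stalks and by the germs of their sections, viewed as families of elements of the stalks. -/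
structure CoeffSystem (X : TopCat.{u}) {ι : Type u} [LinearOrder ι] (U : ι → Opens X) where
  /-- the stalk at `x` of the sheaf of degree `q` on `U_α` -/
  S {p : ℕ} (α : Fin (p + 1) ↪o ι) (q : ℕ) (x : Inter U α) : ModuleCat.{u + 1} ℂ
  /-- the families which represent a section near `x` -/
  Loc {p : ℕ} (α : Fin (p + 1) ↪o ι) (q : ℕ) (x : Inter U α) :
    Submodule ℂ (∀ x' : Inter U α, S α q x')
  d {p : ℕ} (α : Fin (p + 1) ↪o ι) (q : ℕ) (x : Inter U α) : S α q x →ₗ[ℂ] S α (q + 1) x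
  r {p p' : ℕ} (β : Fin (p' + 1) ↪o ι) (f : Fin (p + 1) ↪o Fin (p' + 1)) (q : ℕ) (x : Inter U β) :
    S (f.trans β) q (x.face f) →ₗ[ℂ] S β q x
  d_loc {p : ℕ} (α : Fin (p + 1) ↪o ι) (q : ℕ) (x : Inter U α) (g : ∀ x', S α q x')
    (hg : g ∈ Loc α q x) : (fun x' => d α q x' (g x')) ∈ Loc α (q + 1) x
  r_loc {p p' : ℕ} (β : Fin (p' + 1) ↪o ι) (f : Fin (p + 1) ↪o Fin (p' + 1)) (q : ℕ)
    (x : Inter U β) (g : ∀ x', S (f.trans β) q x') (hg : g ∈ Loc (f.trans β) q (x.face f)) :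
    (fun x' => r β f q x' (g (x'.face f))) ∈ Loc β q x
  d_d {p : ℕ} (α : Fin (p + 1) ↪o ι) (q : ℕ) (x : Inter U α) (s : S α q x) :
    d α (q + 1) x (d α q x s) = 0
  d_r {p p' : ℕ} (β : Fin (p' + 1) ↪o ι) (f : Fin (p + 1) ↪o Fin (p' + 1)) (q : ℕ) (x : Inter U β)
    (s : S (f.trans β) q (x.face f)) :
    d β q x (r β f q x s) = r β f (q + 1) x (d (f.trans β) q (x.face f) s)
  r_r {p p' p'' : ℕ} (β : Fin (p'' + 1) ↪o ι) (g : Fin (p' + 1) ↪o Fin (p'' + 1))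
    (f : Fin (p + 1) ↪o Fin (p' + 1)) (q : ℕ) (x : Inter U β)
    (s : S ((f.trans g).trans β) q (x.face (f.trans g))) :
    r β g q x (r (g.trans β) f q (x.face g) s) = r β (f.trans g) q x s

namespace CoeffSystem

variable {X : TopCat.{u}} {ι : Type u} [LinearOrder ι] {U : ι → Opens X} (F : CoeffSystem X U)

/-- The points of `V ∩ U_α`. -/
abbrev Pts (U : ι → Opens X) (V : Opens X) {p : ℕ} (α : Fin (p + 1) ↪o ι) : Type u :=
  {x : Inter U α // x.1 ∈ V}

/-- The sections over `V` of the product over the `p`-simplices `α` of the direct images of the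
sheaves on `U_α`: families of sections over the intersections `V ∩ U_α`. -/
def sections (p q : ℕ) (V : Opens X) :
    Submodule ℂ (∀ (α : Fin (p + 1) ↪o ι) (x : Pts U V α), F.S α q x.1) where
  carrier := {s | ∀ (α : Fin (p + 1) ↪o ι) (x : Pts U V α), ∃ g ∈ F.Loc α q x.1,
    ∀ᶠ x' in 𝓝 x, s α x' = g x'.1}
  add_mem' {s t} hs ht α x := by
    obtain ⟨g, hg, h⟩ := hs α x
    obtain ⟨g', hg', h'⟩ := ht α x
    refine ⟨g + g', Submodule.add_mem _ hg hg', ?_⟩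
    filter_upwards [h, h'] with x' h1 h2
    simp only [Pi.add_apply, h1, h2]
  zero_mem' α x := ⟨0, Submodule.zero_mem _, Eventually.of_forall fun _ => rfl⟩
  smul_mem' c s hs α x := by
    obtain ⟨g, hg, h⟩ := hs α x
    refine ⟨c • g, Submodule.smul_mem _ c hg, ?_⟩
    filter_upwards [h] with x' h1
    simp only [Pi.smul_apply, h1]

/-- The inclusion of `V' ∩ U_α` in `V ∩ U_α`. -/
abbrev incl {V V' : Opens X} (h : V' ≤ V) {p : ℕ} {α : Fin (p + 1) ↪o ι} (x : Pts U V' α) :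
    Pts U V α := ⟨x.1, h x.2⟩

lemma isOpenEmbedding_incl {V V' : Opens X} (h : V' ≤ V) {p : ℕ} (α : Fin (p + 1) ↪o ι) :
    Topology.IsOpenEmbedding (incl (U := U) h (α := α)) := by
  have hc : Continuous (incl (U := U) h (α := α)) := by fun_prop
  refine ⟨Topology.IsEmbedding.of_comp hc continuous_subtype_val
    (Topology.IsEmbedding.subtypeVal (p := fun x : Inter U α => x.1 ∈ V')), ?_⟩
  · have : Set.range (incl (U := U) h (α := α)) = {x | x.1.1 ∈ V'} := by
      ext x; exact ⟨fun ⟨y, hy⟩ => hy ▸ y.2, fun hx => ⟨⟨x.1, hx⟩, rfl⟩⟩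
    rw [this]
    exact V'.isOpen.preimage (continuous_subtype_val.comp continuous_subtype_val)

/-- Restriction of sections. -/
def res (p q : ℕ) {V V' : Opens X} (h : V' ≤ V) : F.sections p q V →ₗ[ℂ] F.sections p q V' where
  toFun s := ⟨fun α x => s.1 α (incl h x), fun α x => by
    obtain ⟨g, hg, h1⟩ := s.2 α (incl h x)
    exact ⟨g, hg, (isOpenEmbedding_incl h α).continuous.continuousAt.eventually h1⟩⟩
  map_add' _ _ := rfl
  map_smul' _ _ := rfl

/-- The presheaf of the sections. -/
def presheaf (p q : ℕ) : TopCat.Presheaf (ModuleCat.{u + 1} ℂ) X where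
  obj V := ModuleCat.of ℂ (F.sections p q V.unop)
  map i := ModuleCat.ofHom (F.res p q i.unop.le)

lemma isSheaf (p q : ℕ) : (F.presheaf p q).IsSheaf := by
  have h1 : UnivLE.{u, u + 1} := inferInstance
  have h2 : Limits.HasLimitsOfSize.{u, u} (ModuleCat.{u + 1} ℂ) := ModuleCat.hasLimitsOfSize.{u, u, u + 1}
  rw [TopCat.Presheaf.isSheaf_iff_isSheafUniqueGluing]
  intro κ V sf hsf
  have hsf' : ∀ i j α (x : Inter U α) (hi : x.1 ∈ V i) (hj : x.1 ∈ V j),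
      (sf i).1 α ⟨x, hi⟩ = (sf j).1 α ⟨x, hj⟩ := fun i j α x hi hj =>
    congrArg (fun s : F.sections p q (V i ⊓ V j) => s.1 α ⟨x, hi, hj⟩) (hsf i j)
  have hex : ∀ (α : Fin (p + 1) ↪o ι) (x : Pts U (iSup V) α), ∃ i, x.1.1 ∈ V i := fun α x => Opens.mem_iSup.1 x.2
  choose c hc using hex
  refine ⟨⟨fun α x => (sf (c α x)).1 α ⟨x.1, hc α x⟩, fun α x => ?_⟩, fun i => ?_, fun t ht => ?_⟩
  · obtain ⟨g, hg, h⟩ := (sf (c α x)).2 α ⟨x.1, hc α x⟩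
    refine ⟨g, hg, ?_⟩
    have he := isOpenEmbedding_incl (U := U) (le_iSup V (c α x)) α
    rw [← he.map_nhds_eq ⟨x.1, hc α x⟩ |>.trans rfl, eventually_map]
    filter_upwards [h] with x' hx'
    rw [← hx']
    exact hsf' _ _ α x'.1 _ _
  · refine Subtype.ext (funext fun α => funext fun x => ?_)
    exact hsf' _ _ α x.1 _ _
  · refine Subtype.ext (funext fun α => funext fun x => ?_)
    exact congrArg (fun s : F.sections p q (V (c α x)) => s.1 α ⟨x.1, hc α x⟩) (ht (c α x))

/-- The sheaf of the sections. -/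
def sheaf (p q : ℕ) : VecSheaf X := ⟨F.presheaf p q, F.isSheaf p q⟩

/-- Morphisms of the sheaves of sections. -/
def homMk {F G : CoeffSystem X U} {p q p' q' : ℕ}
    (φ : ∀ V, F.sections p q V →ₗ[ℂ] G.sections p' q' V)
    (hφ : ∀ {V V' : Opens X} (h : V' ≤ V) s, φ V' (F.res p q h s) = G.res p' q' h (φ V s)) :
    F.sheaf p q ⟶ G.sheaf p' q' :=
  ⟨{ app V := ModuleCat.ofHom (φ V.unop)
     naturality {V V'} i := by
        ext s
        exact hφ i.unop.le s }⟩

lemma hom_ext {F G : CoeffSystem X U} {p q p' q' : ℕ} {φ ψ : F.sheaf p q ⟶ G.sheaf p' q'}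
    (h : ∀ (V : Opens X) (s : F.sections p q V), φ.hom.app (op V) s = ψ.hom.app (op V) s) :
    φ = ψ := by
  apply Sheaf.hom_ext
  ext V s
  exact h V.unop s

/-- The differential of the coefficients. -/
def dbar (p q : ℕ) : F.sheaf p q ⟶ F.sheaf p (q + 1) :=
  homMk (fun V =>
    { toFun s := ⟨fun α x => F.d α q x.1 (s.1 α x), fun α x => by
        obtain ⟨g, hg, h⟩ := s.2 α x
        exact ⟨_, F.d_loc α q x.1 g hg, h.mono fun x' hx' => congrArg (F.d α q x'.1) hx'⟩⟩
      map_add' s t := Subtype.ext (funext fun α => funext fun x => map_add _ _ _)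
      map_smul' c s := Subtype.ext (funext fun α => funext fun x => map_smul _ _ _) })
    (fun _ _ => rfl)

/-- The sum `∑ j, (-1) ^ j • r s_{∂_j β}`. -/
def deltaFun (p q : ℕ) {V : Opens X} (s : ∀ (α : Fin (p + 1) ↪o ι) (x : Pts U V α), F.S α q x.1)
    (β : Fin (p + 1 + 1) ↪o ι) (x : Pts U V β) : F.S β q x.1 :=
  ∑ j : Fin (p + 2), (-1 : ℂ) ^ (j : ℕ) • F.r β (Fin.succAboveOrderEmb j) q x.1
    (s ((Fin.succAboveOrderEmb j).trans β) ⟨x.1.face _, x.2⟩)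

lemma deltaFun_mem (p q : ℕ) {V : Opens X} (s : F.sections p q V) :
    F.deltaFun p q s.1 ∈ F.sections (p + 1) q V := by
  intro β x
  have h1 := fun j : Fin (p + 2) =>
    s.2 ((Fin.succAboveOrderEmb j).trans β) ⟨x.1.face _, x.2⟩
  choose g hg h using h1
  refine ⟨fun x' => ∑ j : Fin (p + 2), (-1 : ℂ) ^ (j : ℕ) • F.r β (Fin.succAboveOrderEmb j) q x'
    (g j (x'.face _)), ?_, ?_⟩
  · have : (fun x' => ∑ j : Fin (p + 2), (-1 : ℂ) ^ (j : ℕ) •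
        F.r β (Fin.succAboveOrderEmb j) q x' (g j (x'.face _))) =
        ∑ j : Fin (p + 2), (-1 : ℂ) ^ (j : ℕ) •
          fun x' => F.r β (Fin.succAboveOrderEmb j) q x' (g j (x'.face _)) := by
      ext x'; simp [Finset.sum_apply]
    rw [this]
    exact Submodule.sum_mem _ fun j _ => Submodule.smul_mem _ _ (F.r_loc β _ q x.1 (g j) (hg j))
  · have h2 : ∀ j : Fin (p + 2), ∀ᶠ x' : Pts U V β in 𝓝 x,
        s.1 ((Fin.succAboveOrderEmb j).trans β) ⟨x'.1.face _, x'.2⟩ = g j (x'.1.face _) := by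
      intro j
      have hc : Continuous (fun x' : Pts U V β =>
          (⟨x'.1.face (Fin.succAboveOrderEmb j), x'.2⟩ :
            Pts U V ((Fin.succAboveOrderEmb j).trans β))) := by fun_prop
      exact hc.continuousAt.eventually (h j)
    filter_upwards [eventually_all.2 h2] with x' hx'
    simp only [deltaFun, hx']

/-- The differential in the direction of the simplices. -/
def delta (p q : ℕ) : F.sheaf p q ⟶ F.sheaf (p + 1) q :=
  homMk (fun V =>
    { toFun s := ⟨F.deltaFun p q s.1, F.deltaFun_mem p q s⟩
      map_add' s t := Subtype.ext (funext fun α => funext fun x => by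
        simp [deltaFun, Finset.sum_add_distrib])
      map_smul' c s := Subtype.ext (funext fun α => funext fun x => by
        simp [deltaFun, Finset.smul_sum, smul_comm c]) })
    (fun _ _ => rfl)

lemma dbar_dbar (p q : ℕ) : F.dbar p q ≫ F.dbar p (q + 1) = 0 :=
  hom_ext fun _ s => Subtype.ext (funext fun α => funext fun x => F.d_d α q x.1 (s.1 α x))

lemma dbar_delta (p q : ℕ) : F.dbar p q ≫ F.delta p (q + 1) = F.delta p q ≫ F.dbar (p + 1) q :=
  hom_ext fun _ s => Subtype.ext (funext fun β => funext fun x => by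
    change F.deltaFun p (q + 1) (fun α x => F.d α q x.1 (s.1 α x)) β x =
      F.d β q x.1 (F.deltaFun p q s.1 β x)
    simp only [deltaFun, map_sum, map_smul, F.d_r])

lemma delta_delta (p q : ℕ) : F.delta p q ≫ F.delta (p + 1) q = 0 :=
  hom_ext fun _ s => Subtype.ext (funext fun β => funext fun x => by
    change F.deltaFun (p + 1) q (F.deltaFun p q s.1) β x = 0
    simp only [deltaFun, map_sum, map_smul, Finset.smul_sum, smul_smul]
    refine Eq.trans ?_ (alternating_sum_faces (p := p)
      fun f => F.r β f q x.1 (s.1 (f.trans β) ⟨x.1.face f, x.2⟩))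
    refine Finset.sum_congr rfl fun i _ => Finset.sum_congr rfl fun j _ => ?_
    congr 1
    exact F.r_r β (Fin.succAboveOrderEmb i) (Fin.succAboveOrderEmb j) q x.1
      (s.1 (((Fin.succAboveOrderEmb j).trans (Fin.succAboveOrderEmb i)).trans β) ⟨_, x.2⟩))

end CoeffSystem

end Part7

section Part8

section Total

/-- The signs of the total complex of a double complex: `δ + (-1) ^ p d` on the component of
bidegree `(p, q)`, where `δ` is the first and `d` the second differential. -/
instance totalShape : TotalComplexShape (ComplexShape.up ℕ) (ComplexShape.up ℕ)
    (ComplexShape.up ℕ) where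
  π := fun pq => pq.1 + pq.2
  ε₁ := fun _ => 1
  ε₂ := fun pq => (-1) ^ pq.1
  rel₁ {p p'} h q := by
    simp only [ComplexShape.up_Rel] at h ⊢; omega
  rel₂ p {q q'} h := by
    simp only [ComplexShape.up_Rel] at h ⊢; omega
  ε₂_ε₁ {p p' q q'} h h' := by
    simp only [ComplexShape.up_Rel] at h
    subst h
    simp [pow_succ]

instance finite_totalFiber (n : ℕ) : Finite (ComplexShape.π (ComplexShape.up ℕ)
    (ComplexShape.up ℕ) (ComplexShape.up ℕ) ⁻¹' {n}) := by
  refine Set.Finite.subset (Finset.HasAntidiagonal.antidiagonal n).finite_toSet fun pq h => ?_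
  exact Finset.mem_coe.2 (Finset.HasAntidiagonal.mem_antidiagonal.2 h)

variable (X : TopCat.{u})

instance hasFiniteCoproducts_vecSheaf : Limits.HasFiniteCoproducts (VecSheaf X) := by
  have h : Limits.HasFiniteProducts (VecSheaf X) := ⟨fun n => by
    have h0 : Limits.HasLimitsOfShape (Discrete (Fin n)) (ModuleCat.{u + 1} ℂ) :=
      ModuleCat.hasLimitsOfShape
    exact Sheaf.instHasLimitsOfShape⟩
  have h' : Limits.HasFiniteBiproducts (VecSheaf X) := Limits.HasFiniteBiproducts.of_hasFiniteProducts
  exact Limits.hasFiniteCoproducts_of_hasFiniteBiproducts _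

variable {X}

instance hasTotal_vecSheaf
    (K : HomologicalComplex₂ (VecSheaf X) (ComplexShape.up ℕ) (ComplexShape.up ℕ)) :
    K.HasTotal (ComplexShape.up ℕ) := fun n => by
  have := finite_totalFiber n
  exact Limits.hasColimitsOfShape_discrete _ _ |>.has_colimit _

end Total

namespace CoeffSystem

variable {X : TopCat.{u}} {ι : Type u} [LinearOrder ι] {U : ι → Opens X} (F : CoeffSystem X U)

/-- The complex of sheaves with differential `d`, on the simplices of dimension `p`. -/
def column (p : ℕ) : CochainComplex (VecSheaf X) ℕ :=
  CochainComplex.of (F.sheaf p) (F.dbar p) (F.dbar_dbar p)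

lemma column_d (p q : ℕ) : (F.column p).d q (q + 1) = F.dbar p q :=
  CochainComplex.of_d _ _ _

/-- The differential in the direction of the simplices. -/
def columnHom (p : ℕ) : F.column p ⟶ F.column (p + 1) :=
  CochainComplex.ofHom (F.delta p) (fun q => by
    rw [column_d, column_d]; exact (F.dbar_delta p q).symm)

/-- The double complex. -/
def bicomplex : HomologicalComplex₂ (VecSheaf X) (ComplexShape.up ℕ) (ComplexShape.up ℕ) :=
  CochainComplex.of F.column F.columnHom fun p => by
    ext q : 1
    rw [HomologicalComplex.comp_f, HomologicalComplex.zero_f]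
    exact F.delta_delta p q

/-- The total complex of the double complex. -/
def total : CochainComplex (VecSheaf X) ℕ := F.bicomplex.total (ComplexShape.up ℕ)

/-- The inclusion of the component of bidegree `(p, q)`. -/
def inc (p q n : ℕ) (h : p + q = n) : F.sheaf p q ⟶ F.total.X n :=
  F.bicomplex.ιTotal (ComplexShape.up ℕ) p q n h

end CoeffSystem

end Part8

section Part9

section Sections
variable {X : ComplexRingedSpace.{u}} {m m' : ℕ}

/-- `s` is the class at `x` of the form `η` on the product of the ambient manifolds. -/
def DolbStalk.Rep {T : Fin m → EmbeddingTriple X} {x : X.top} (hx : ∀ a, x ∈ (T a).U) {q : ℕ}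
    (η : (famD T).carrier → Alt (famD T).E q) (s : DolbStalk T hx q) : Prop :=
  ∃ h : η ∈ smoothForms (famD T) (famPt T hx) q, s = DolbStalk.mk hx q (FormGerm.mk ⟨η, h⟩)

/-- `s` is the class at `x` of the form `η` on the product of the ambient manifolds. -/
def ModelStalk.Rep {T : Fin m → EmbeddingTriple X} {x : X.top} (hx : ∀ a, x ∈ (T a).U) {q : ℕ}
    (η : (famD T).carrier → Alt (famD T).E q) (s : ModelStalk T hx q) : Prop :=
  ∃ h : η ∈ smoothForms (famD T) (famPt T hx) q, s = ModelStalk.mk hx q (FormGerm.mk ⟨η, h⟩)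

variable {T : Fin m → EmbeddingTriple X} {x : X.top} {hx : ∀ a, x ∈ (T a).U} {q : ℕ}
  {η η' : (famD T).carrier → Alt (famD T).E q}

lemma DolbStalk.Rep.add {s s' : DolbStalk T hx q} (h : DolbStalk.Rep hx η s)
    (h' : DolbStalk.Rep hx η' s') : DolbStalk.Rep hx (η + η') (s + s') := by
  obtain ⟨h, rfl⟩ := h
  obtain ⟨h', rfl⟩ := h'
  exact ⟨Submodule.add_mem _ h h', rfl⟩

lemma DolbStalk.Rep.zero : DolbStalk.Rep hx (0 : (famD T).carrier → Alt (famD T).E q) 0 :=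
  ⟨Submodule.zero_mem _, rfl⟩

lemma DolbStalk.Rep.smul {s : DolbStalk T hx q} (c : ℂ) (h : DolbStalk.Rep hx η s) :
    DolbStalk.Rep hx (c • η) (c • s) := by
  obtain ⟨h, rfl⟩ := h
  exact ⟨Submodule.smul_mem _ c h, rfl⟩

lemma DolbStalk.Rep.d {s : DolbStalk T hx q} (h : DolbStalk.Rep hx η s) :
    DolbStalk.Rep hx (dbar (famD T).E η) (DolbStalk.d hx q s) := by
  obtain ⟨h, rfl⟩ := h
  exact ⟨dbar_mem ⟨η, h⟩, rfl⟩

lemma ModelStalk.Rep.d {s : ModelStalk T hx q} (h : ModelStalk.Rep hx η s) :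
    ModelStalk.Rep hx (dbar (famD T).E η) (ModelStalk.d hx q s) := by
  obtain ⟨h, rfl⟩ := h
  exact ⟨dbar_mem ⟨η, h⟩, rfl⟩

lemma DolbStalk.Rep.toModel {s : DolbStalk T hx q} (h : DolbStalk.Rep hx η s) :
    ModelStalk.Rep hx η (toModelStalk hx q s) := by
  obtain ⟨h, rfl⟩ := h
  exact ⟨h, rfl⟩

lemma DolbStalk.Rep.pull {f : Fin m → Fin m'} {T : Fin m' → EmbeddingTriple X} {x : X.top}
    {hx : ∀ a, x ∈ (T a).U} {η : (famD (T ∘ f)).carrier → Alt (famD (T ∘ f)).E q}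
    {s : DolbStalk (T ∘ f) (fun a => hx (f a)) q} (h : DolbStalk.Rep (fun a => hx (f a)) η s) :
    DolbStalk.Rep hx (pullback (famD T).E (famD (T ∘ f)).E (famMap f T) η)
      (DolbStalk.pull f hx q s) := by
  obtain ⟨h, rfl⟩ := h
  exact ⟨pullback_mem (y := famPt T hx) (holAt_famMap f T _) ⟨η, h⟩, rfl⟩

/-- The germs at `x` of sections of the sheaf `ℰ^{0,q}_X`, viewed as families of elements of the
stalks: locally, sections are given by (sums of) forms on ambient manifolds. -/
def smoothFormLoc (x : X.top) (q : ℕ) : Submodule ℂ (∀ x' : X.top, SmoothFormStalk x' q) :=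
  Submodule.span ℂ {g | ∃ (S : EmbeddingsAt x) (η : (famD S.T).carrier → Alt (famD S.T).E q),
    ∀ᶠ x' in 𝓝 x, ∃ (hx' : ∀ a, x' ∈ (S.T a).U) (s : ModelStalk S.T hx' q),
      ModelStalk.Rep hx' η s ∧ g x' = SmoothFormStalk.of ⟨S.m, S.T, hx'⟩ q s}

lemma smoothFormLoc_d (x : X.top) (q : ℕ) (g : ∀ x' : X.top, SmoothFormStalk x' q)
    (hg : g ∈ smoothFormLoc x q) :
    (fun x' => SmoothFormStalk.d q (g x')) ∈ smoothFormLoc x (q + 1) := by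
  induction hg using Submodule.span_induction with
  | mem g hg =>
    obtain ⟨S, η, h⟩ := hg
    refine Submodule.subset_span ⟨S, dbar (famD S.T).E η, h.mono fun x' h' => ?_⟩
    obtain ⟨hx', s, hs, e⟩ := h'
    exact ⟨hx', ModelStalk.d hx' q s, hs.d, 
      (congrArg (SmoothFormStalk.d q) e).trans (SmoothFormStalk.d_of ⟨S.m, S.T, hx'⟩ q s)⟩
  | zero =>
    have e : (fun x' : X.top => SmoothFormStalk.d q ((0 : ∀ x' : X.top, SmoothFormStalk x' q) x')) =
        0 := funext fun x' => map_zero _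
    rw [e]; exact Submodule.zero_mem _
  | add g g' _ _ h h' =>
    have e : (fun x' => SmoothFormStalk.d q ((g + g') x')) =
        (fun x' => SmoothFormStalk.d q (g x')) + fun x' => SmoothFormStalk.d q (g' x') :=
      funext fun x' => map_add _ _ _
    rw [e]; exact Submodule.add_mem _ h h'
  | smul c g _ h =>
    have e : (fun x' => SmoothFormStalk.d q ((c • g) x')) =
        c • fun x' => SmoothFormStalk.d q (g x') :=
      funext fun x' => (SmoothFormStalk.d q).map_smul c (g x')
    rw [e]; exact Submodule.smul_mem _ c h

end Sections

namespace EmbeddingAtlas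

variable {X : AnalyticSpace.{u}} {ι : Type u} [LinearOrder ι] (A : EmbeddingAtlas X ι)

/-- The open covering of `X` given by the atlas. -/
abbrev cov (i : ι) : Opens X.top := (A.triple i).U

/-- The embedding triples of the vertices of a simplex. -/
abbrev fam {p : ℕ} (α : Fin (p + 1) ↪o ι) (a : Fin (p + 1)) :
    EmbeddingTriple X.toComplexRingedSpace := A.triple (α a)

/-- The system of complexes of sheaves `(ℰ^{0,•}_{D_α} / I_α ℰ^{0,•}_{D_α})|U_α`, where `D_α` is the
product of the ambient manifolds of the vertices of `α` and `I_α` the ideal of the diagonal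
embedding of `U_α` in `D_α`. -/
def dolbSystem : CoeffSystem X.top A.cov where
  S α q x := ModuleCat.of ℂ (ULift.{u + 1} (DolbStalk (A.fam α) x.2 q))
  Loc α q x :=
    { carrier := {g | ∃ η : (famD (A.fam α)).carrier → Alt (famD (A.fam α)).E q,
        ∀ᶠ x' in 𝓝 x, DolbStalk.Rep x'.2 η (g x').down}
      add_mem' := fun ⟨η, h⟩ ⟨η', h'⟩ => ⟨η + η', by
        filter_upwards [h, h'] with x' h1 h2 using h1.add h2⟩
      zero_mem' := ⟨0, Eventually.of_forall fun x' => DolbStalk.Rep.zero⟩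
      smul_mem' := fun c _ ⟨η, h⟩ => ⟨c • η, h.mono fun x' h1 => h1.smul c⟩ }
  d α q x := ULift.moduleEquiv.symm.toLinearMap ∘ₗ DolbStalk.d x.2 q ∘ₗ
    ULift.moduleEquiv.toLinearMap
  r β f q x :=
    { toFun s := ULift.up (DolbStalk.pull (T' := A.fam β) f x.2 q s.down)
      map_add' s t := congrArg ULift.up (map_add (DolbStalk.pull (T' := A.fam β) f x.2 q) _ _)
      map_smul' c s := congrArg ULift.up
        ((DolbStalk.pull (T' := A.fam β) f x.2 q).map_smul c s.down) }
  d_loc α q x g := fun ⟨η, h⟩ => ⟨dbar (famD (A.fam α)).E η, h.mono fun x' h1 => h1.d⟩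
  r_loc β f q x g := fun ⟨η, h⟩ =>
    ⟨pullback (famD (A.fam β)).E (famD (A.fam β ∘ f)).E (famMap f (A.fam β)) η, by
      have hc : Continuous (Inter.face (U := A.cov) (β := β) f) := by fun_prop
      filter_upwards [hc.continuousAt.eventually h] with x' h1
      exact DolbStalk.Rep.pull h1⟩
  d_d α q x s := congrArg ULift.up (DolbStalk.d_d x.2 q s.down)
  d_r β f q x s := congrArg ULift.up (DolbStalk.d_pull f x.2 q s.down)
  r_r β g f q x s := congrArg ULift.up (DolbStalk.pull_pull f g x.2 q s.down)

/-- The complex `ℰ^{0,•}_X` of sheaves of smooth differential forms on `X`, restricted to the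
intersections of the open sets of the covering. -/
def formSystem : CoeffSystem X.top A.cov where
  S α q x := ModuleCat.of ℂ (SmoothFormStalk (X := X.toComplexRingedSpace) x.1 q)
  Loc α q x :=
    { carrier := {g | ∃ g' ∈ smoothFormLoc x.1 q, ∀ᶠ x' in 𝓝 x, g x' = g' x'.1}
      add_mem' := fun ⟨g, hg, h⟩ ⟨g', hg', h'⟩ => ⟨g + g', Submodule.add_mem _ hg hg', by
        filter_upwards [h, h'] with x' h1 h2
        simp only [Pi.add_apply, h1, h2]⟩
      zero_mem' := ⟨0, Submodule.zero_mem _, Eventually.of_forall fun x' => rfl⟩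
      smul_mem' := fun c _ ⟨g, hg, h⟩ => ⟨c • g, Submodule.smul_mem _ c hg, h.mono fun x' h1 => by
        simp only [Pi.smul_apply, h1]⟩ }
  d α q x := SmoothFormStalk.d q
  r β f q x := LinearMap.id
  d_loc α q x g := fun ⟨g', hg', h⟩ => ⟨_, smoothFormLoc_d x.1 q g' hg', h.mono fun x' h1 => by
    simp only [h1]⟩
  r_loc β f q x g := fun ⟨g', hg', h⟩ => ⟨g', hg', by
    have hc : Continuous (Inter.face (U := A.cov) (β := β) f) := by fun_prop
    filter_upwards [hc.continuousAt.eventually h] with x' h1 using h1⟩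
  d_d α q x s := SmoothFormStalk.d_d q s
  d_r β f q x s := rfl
  r_r β g f q x s := rfl

/-- The complex of sheaves `Dolb(𝒜, 𝒪_X)`. -/
def dolb : CochainComplex (VecSheaf X.top) ℕ := A.dolbSystem.total

/-- The Čech complex of sheaves of `ℰ^{0,•}_X` on the covering given by the atlas. -/
def cech : CochainComplex (VecSheaf X.top) ℕ := A.formSystem.total

/-- The natural morphism from forms on an ambient manifold to forms on `X`. -/
def toForm {p : ℕ} (α : Fin (p + 1) ↪o ι) (q : ℕ) (x : Inter A.cov α) :
    A.dolbSystem.S α q x →ₗ[ℂ] A.formSystem.S α q x :=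
  SmoothFormStalk.of ⟨p, A.fam α, x.2⟩ q ∘ₗ toModelStalk x.2 q ∘ₗ ULift.moduleEquiv.toLinearMap

lemma isOpen_inter {p : ℕ} (α : Fin (p + 1) ↪o ι) : IsOpen {x | ∀ j, x ∈ A.cov (α j)} := by
  rw [Set.ofPred_forall]
  exact isOpen_iInter_of_finite fun j => (A.cov (α j)).isOpen

lemma toForm_loc {p : ℕ} (α : Fin (p + 1) ↪o ι) (q : ℕ) (x : Inter A.cov α)
    (g : ∀ x' : Inter A.cov α, A.dolbSystem.S α q x') (hg : g ∈ A.dolbSystem.Loc α q x) :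
    (fun x' => A.toForm α q x' (g x')) ∈ A.formSystem.Loc α q x := by
  classical
  obtain ⟨η, hη⟩ : ∃ η : (famD (A.fam α)).carrier → Alt (famD (A.fam α)).E q,
    ∀ᶠ x' in 𝓝 x, DolbStalk.Rep x'.2 η (g x').down := hg
  set G : ∀ y : X.top, SmoothFormStalk (X := X.toComplexRingedSpace) y q := fun y =>
    if hy : ∀ j, y ∈ A.cov (α j) then A.toForm α q ⟨y, hy⟩ (g ⟨y, hy⟩) else 0 with hG
  have key : ∀ x' : Inter A.cov α, G x'.1 = A.toForm α q x' (g x') := fun x' => dif_pos x'.2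
  refine ⟨G, Submodule.subset_span ⟨⟨p, A.fam α, x.2⟩, η, ?_⟩,
    Eventually.of_forall fun x' => (key x').symm⟩
  rw [← (A.isOpen_inter α).isOpenEmbedding_subtypeVal.map_nhds_eq x, eventually_map]
  filter_upwards [hη] with x' h'
  exact ⟨x'.2, _, h'.toModel, key x'⟩

/-- The natural quotient morphism in bidegree `(p, q)`. -/
def quotientMap (p q : ℕ) : A.dolbSystem.sheaf p q ⟶ A.formSystem.sheaf p q :=
  CoeffSystem.homMk (fun V =>
    { toFun s := ⟨fun α x => A.toForm α q x.1 (s.1 α x), fun α x => by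
        obtain ⟨g, hg, h⟩ := s.2 α x
        exact ⟨_, A.toForm_loc α q x.1 g hg, h.mono fun x' h' => congrArg (A.toForm α q x'.1) h'⟩⟩
      map_add' s t := Subtype.ext (funext fun α => funext fun x => map_add _ _ _)
      map_smul' c s := Subtype.ext (funext fun α => funext fun x =>
        (A.toForm α q x.1).map_smul c (s.1 α x)) })
    (fun _ _ => rfl)

end EmbeddingAtlas

end Part9

end DolbeaultForms
end

/-!
# From the Dolbeault complex of an atlas to the Čech complex of the smooth forms

The quotient morphisms `ℰ^{0,q}_{D_α} / I_α ℰ^{0,q}_{D_α} → ℰ^{0,q}_X|U_α` commute with `∂̄` and with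
the restrictions to larger simplices, so they induce a morphism of total complexes. What has to be
shown is that it is surjective. It is in fact surjective on the sections over every open subset `V`
(`quotientMap_surjective`), which passes from the components to the total complex
(`exists_total_hom`). Lifting sections over `V`, and not only germs, is necessary since there may be
infinitely many simplices `α` near a point, and the neighbourhoods on which germs lift depend on
`α`.

Locally, a section of `ℰ^{0,q}_X` is given by a form on the product of the ambient manifolds of some
family of embedding triples, unrelated to `α`, and has to be rewritten as a form on `D_α`
(`exists_form_single`, `exists_local_rep`). The coordinates of an embedding lift to holomorphic
functions on another embedding, and thus give a holomorphic map `g` to be used for pulling forms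
back. That the result represents the same section means that two holomorphic maps `f` and `g` which
agree modulo an ideal `I` have congruent pullbacks of forms modulo the submodule `ℳ`
(`InM.sub_pullback`). For functions this follows from Hadamard's lemma: `a ∘ f - a ∘ g` is a
combination of the components of `f - g` and of their conjugates with smooth coefficients. For forms
with constant coefficients one writes `θ = ∂̄K / (q + 1)`, where the coefficients of `K` are conjugates
of coordinates, and argues by induction, as `ℳ` is stable under `∂̄`. The general case follows since
`ℳ` is also stable under the multiplication by smooth functions (`relM_smul`), because the
commutator of such a multiplication with `∂̄` is linear over functions.

The local lifts are glued by a smooth partition of unity (`exists_global_rep`). It is constructed on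
the manifold `D_{α 0}`, for a family of open subsets whose union need not be the whole manifold
(`exists_partition`). It operates on `D_α` through the projection, and functions on `D_{α 0}` also
operate on the stalks of `ℰ^{0,q}_X` (`SmoothFormStalk.smul`); since the partition adds up to `1`,
the glued form still represents the given section.
-/

noncomputable section
namespace DolbeaultForms

/-! ### Total complexes of coefficient systems -/

namespace CoeffSystem

variable {X : TopCat.{u}} {ι : Type u} [LinearOrder ι] {U : ι → Opens X}

lemma bicomplex_d (F : CoeffSystem X U) (p : ℕ) :
    F.bicomplex.d p (p + 1) = F.columnHom p :=
  CochainComplex.of_d _ _ _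

/-- A family of morphisms between the sheaves of sections of two systems which commutes with both
differentials induces a morphism of double complexes. -/
def bicomplexHom (F G : CoeffSystem X U) (ψ : ∀ p q, F.sheaf p q ⟶ G.sheaf p q)
    (hd : ∀ p q, ψ p q ≫ G.dbar p q = F.dbar p q ≫ ψ p (q + 1))
    (hδ : ∀ p q, ψ p q ≫ G.delta p q = F.delta p q ≫ ψ (p + 1) q) :
    F.bicomplex ⟶ G.bicomplex :=
  CochainComplex.ofHom
    (fun p => (CochainComplex.ofHom (ψ p) (fun q => by
      rw [column_d, column_d]; exact hd p q) : F.column p ⟶ G.column p))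
    (fun p => by
      rw [bicomplex_d, bicomplex_d]
      ext q : 1
      exact hδ p q)

/-- The projection of the total complex on the component of bidegree `(p, q)`. -/
def proj (F : CoeffSystem X U) (p q n : ℕ) (h : p + q = n) : F.total.X n ⟶ F.sheaf p q :=
  F.bicomplex.totalDesc fun p' q' h' =>
    if e : p' = p then eqToHom (by
      change p' + q' = n at h'
      obtain rfl : q' = q := by omega
      subst e; rfl) else 0

lemma inc_proj (F : CoeffSystem X U) (p q n : ℕ) (h : p + q = n) :
    F.inc p q n h ≫ F.proj p q n h = 𝟙 _ := by
  rw [inc, proj]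
  erw [HomologicalComplex₂.ι_totalDesc]
  rw [dif_pos rfl]; rfl

lemma inc_proj_ne (F : CoeffSystem X U) {p q p' q' n : ℕ} (h : p + q = n) (h' : p' + q' = n)
    (hp : p' ≠ p) : F.inc p' q' n h' ≫ F.proj p q n h = 0 := by
  rw [inc, proj]
  erw [HomologicalComplex₂.ι_totalDesc]
  rw [dif_neg hp]; rfl

/-- The total complex is in each degree the direct sum of the components of bidegree
`(p, n - p)`. -/
lemma sum_proj_inc (F : CoeffSystem X U) (n : ℕ) :
    ∑ p : Fin (n + 1), F.proj p (n - p) n (by omega) ≫ F.inc p (n - p) n (by omega) =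
      𝟙 (F.total.X n) := by
  apply HomologicalComplex₂.total.hom_ext
  intro p q h
  change p + q = n at h
  change F.inc p q n h ≫ _ = F.inc p q n h ≫ _
  rw [Preadditive.comp_sum, Finset.sum_eq_single (⟨p, by omega⟩ : Fin (n + 1))]
  · obtain rfl : q = n - p := by omega
    rw [← Category.assoc, inc_proj]
    simp
  · intro j _ hj
    rw [← Category.assoc, inc_proj_ne, Limits.zero_comp]
    rintro rfl
    exact hj rfl
  · simp

end CoeffSystem

/-! ### The morphism of total complexes -/

namespace EmbeddingAtlas

variable {X : AnalyticSpace.{u}} {ι : Type u} [LinearOrder ι] (A : EmbeddingAtlas X ι)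

lemma quotientMap_dbar (p q : ℕ) :
    A.quotientMap p q ≫ A.formSystem.dbar p q = A.dolbSystem.dbar p q ≫ A.quotientMap p (q + 1) :=
  CoeffSystem.hom_ext fun V s => Subtype.ext (funext fun α => funext fun x => by
    obtain ⟨g, hg⟩ := DolbStalk.mk_surjective x.1.2 q (s.1 α x).down
    change SmoothFormStalk.d q (SmoothFormStalk.of ⟨p, A.fam α, x.1.2⟩ q
      (toModelStalk x.1.2 q (s.1 α x).down)) = SmoothFormStalk.of ⟨p, A.fam α, x.1.2⟩ (q + 1)
      (toModelStalk x.1.2 (q + 1) (DolbStalk.d x.1.2 q (s.1 α x).down))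
    rw [SmoothFormStalk.d_of, ← hg]
    rfl)

lemma quotientMap_delta (p q : ℕ) :
    A.quotientMap p q ≫ A.formSystem.delta p q =
      A.dolbSystem.delta p q ≫ A.quotientMap (p + 1) q :=
  CoeffSystem.hom_ext fun V s => Subtype.ext (funext fun β => funext fun x => by
    change A.formSystem.deltaFun p q (fun α x => A.toForm α q x.1 (s.1 α x)) β x =
      A.toForm β q x.1 (A.dolbSystem.deltaFun p q s.1 β x)
    simp only [CoeffSystem.deltaFun, map_sum, map_smul]
    refine Finset.sum_congr rfl fun j _ => congrArg _ ?_
    generalize s.1 ((Fin.succAboveOrderEmb j).trans β) ⟨x.1.face _, x.2⟩ = t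
    obtain ⟨g, hg⟩ := DolbStalk.mk_surjective _ q t.down
    obtain ⟨t⟩ := t
    subst hg
    exact (SmoothFormStalk.of_pull ⟨p + 1, A.fam β, x.1.2⟩ (Fin.succAboveOrderEmb j) q
      (ModelStalk.mk _ q g)).symm)

/-- If the natural quotient morphisms are surjective on sections, then so is the induced morphism
of total complexes, and in particular it is surjective as a morphism of sheaves. -/
lemma exists_total_hom (h : ∀ (p q : ℕ) (V : Opens X.top),
      Function.Surjective ((A.quotientMap p q).hom.app (op V))) :
    ∃ φ : A.dolb ⟶ A.cech,
      (∀ n : ℕ, Sheaf.IsLocallySurjective (φ.f n)) ∧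
      ∀ (p q n : ℕ) (h : p + q = n),
        A.dolbSystem.inc p q n h ≫ φ.f n = A.quotientMap p q ≫ A.formSystem.inc p q n h := by
  let φ : A.dolb ⟶ A.cech := HomologicalComplex₂.total.map
    (CoeffSystem.bicomplexHom A.dolbSystem A.formSystem A.quotientMap A.quotientMap_dbar
      A.quotientMap_delta) (ComplexShape.up ℕ)
  have hφ : ∀ (p q n : ℕ) (h : p + q = n),
      A.dolbSystem.inc p q n h ≫ φ.f n = A.quotientMap p q ≫ A.formSystem.inc p q n h :=
    fun p q n h => HomologicalComplex₂.ιTotal_map (i₁ := p) (i₂ := q) (i₁₂ := n) (h := h) ..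
  refine ⟨φ, fun n => ?_, hφ⟩
  -- A section of the total complex is the sum of its components, each of which lifts.
  refine Presheaf.isLocallySurjective_of_surjective _ _ fun V t => ?_
  have hs : ∀ p : Fin (n + 1), ∃ r, (A.quotientMap p (n - p)).hom.app V r =
      (A.formSystem.proj p (n - p) n (by omega)).hom.app V t := fun p => h _ _ V.unop _
  choose r hr using hs
  refine ⟨∑ p : Fin (n + 1), (A.dolbSystem.inc p (n - p) n (by omega)).hom.app V (r p), ?_⟩
  have e1 : ∀ p : Fin (n + 1), (φ.f n).hom.app V
      ((A.dolbSystem.inc p (n - p) n (by omega)).hom.app V (r p)) =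
      (A.formSystem.inc p (n - p) n (by omega)).hom.app V
        ((A.formSystem.proj p (n - p) n (by omega)).hom.app V t) := fun p => by
    have e := hφ p (n - p) n (by omega)
    have e2 := congrArg (fun ψ => (ψ.hom.app V) (r p)) e
    refine Eq.trans e2 ?_
    rw [← hr]; rfl
  refine (map_sum _ _ _).trans ?_
  rw [Finset.sum_congr rfl fun p _ => e1 p]
  have e3 := congrArg (fun ψ => (ψ.hom.app V) t) (CoeffSystem.sum_proj_inc A.formSystem n)
  refine Eq.trans ?_ e3
  -- Taking sections is an additive functor.
  have key : ∀ (K L : VecSheaf X.top) (S : Finset (Fin (n + 1))) (ψ : Fin (n + 1) → (K ⟶ L))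
      (t : K.obj.obj V), ∑ p ∈ S, (ψ p).hom.app V t = (∑ p ∈ S, ψ p).hom.app V t := by
    intro K L S ψ t
    induction S using Finset.induction_on with
    | empty => rfl
    | insert a S ha ih => rw [Finset.sum_insert ha, Finset.sum_insert ha, ih]; rfl
  exact key _ _ _ (fun p : Fin (n + 1) => A.formSystem.proj p (n - p) n (by omega) ≫
    A.formSystem.inc p (n - p) n (by omega)) t

end EmbeddingAtlas

/-! ### The Leibniz rule for `∂̄` -/

section Leibniz

variable {E : Type*} [NormedAddCommGroup E] [NormedSpace ℂ E]

/-- The Leibniz rule for a function which need not be holomorphic; the second summand is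
`∂̄ρ ∧ η`. -/
lemma dbarVec_smul_real {q : ℕ} {η : E → Alt E q} {ρ : E → ℂ} {x : E}
    (hρ : DifferentiableAt ℝ ρ x) (h : DifferentiableAt ℝ η x) :
    dbarVec (fun y => ρ y • η y) x = ρ x • dbarVec η x +
      ContinuousAlternatingMap.alternatizeUncurryFin
        (antiPart ((fderiv ℝ ρ x).smulRight (η x))) := by
  have h1 : fderiv ℝ (fun y => ρ y • η y) x = _ := (hρ.hasFDerivAt.smul h.hasFDerivAt).fderiv
  have h2 : antiPart (fderiv ℝ (fun y => ρ y • η y) x) =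
      ρ x • antiPart (fderiv ℝ η x) + antiPart ((fderiv ℝ ρ x).smulRight (η x)) := by
    rw [h1]
    ext v : 1
    simp only [antiPart_apply, _root_.add_apply, _root_.smul_apply,
      ContinuousLinearMap.smulRight_apply]
    module
  rw [dbarVec, h2, ContinuousAlternatingMap.alternatizeUncurryFin_add,
    ContinuousAlternatingMap.alternatizeUncurryFin_smul, dbarVec]

/-- The commutator of `∂̄` with the multiplication by a function `ρ`, which is `∂̄ρ ∧ ·`, is linear
over functions. -/
lemma dbarVec_commutator {q : ℕ} {η : E → Alt E q} {ρ h : E → ℂ} {x : E}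
    (hρ : DifferentiableAt ℝ ρ x) (hh : DifferentiableAt ℝ h x) (hη : DifferentiableAt ℝ η x) :
    dbarVec (fun y => ρ y • (h y • η y)) x - ρ x • dbarVec (fun y => h y • η y) x =
      h x • (dbarVec (fun y => ρ y • η y) x - ρ x • dbarVec η x) := by
  rw [dbarVec_smul_real (η := fun y => h y • η y) hρ (hh.smul hη), dbarVec_smul_real hρ hη,
    add_sub_cancel_left, add_sub_cancel_left, ← ContinuousAlternatingMap.alternatizeUncurryFin_smul]
  congr 1
  ext v : 1
  simp only [antiPart_apply, _root_.smul_apply, ContinuousLinearMap.smulRight_apply]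
  module

end Leibniz

/-! ### Smooth functions -/

section SmoothFunctions

variable {E E' : Type*} [NormedAddCommGroup E] [NormedSpace ℂ E] [NormedAddCommGroup E']
  [NormedSpace ℂ E'] {M M' : Type*} [TopologicalSpace M] [ChartedSpace E M]
  [TopologicalSpace M'] [ChartedSpace E' M']

lemma tendsto_chartAt_symm {E M : Type*} [NormedAddCommGroup E] [TopologicalSpace M]
    [ChartedSpace E M] (y : M) : Tendsto (chartAt E y).symm (𝓝 (chartAt E y y)) (𝓝 y) := by
  have := (chartAt E y).continuousAt_symm (mem_chart_target E y)
  rwa [ContinuousAt, (chartAt E y).left_inv (mem_chart_source E y)] at this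

lemma SmoothFun.congr {f g : M → ℂ} {y : M} (h : f =ᶠ[𝓝 y] g) (hg : SmoothFun E g y) :
    SmoothFun E f y :=
  ContDiffAt.congr_of_eventuallyEq hg ((tendsto_chartAt_symm y).eventually h)

lemma SmoothFun.const (c : ℂ) (y : M) : SmoothFun E (fun _ : M => c) y := contDiffAt_const

lemma SmoothFun.comp [IsManifold 𝓘(ℂ, E) ω M] [IsManifold 𝓘(ℂ, E') ω M'] {f : M' → ℂ}
    {F : M → M'} {y : M} (hf : SmoothFun E' f (F y)) (hF : HolAt E E' F y) :
    SmoothFun E (f ∘ F) y := by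
  have h1 : ContDiffAt ℝ ∞ (chartAt E' (F y) ∘ F ∘ (chartAt E y).symm) (chartAt E y y) :=
    ((holAt_local hF).restrict_scalars ℝ).of_le (by simp)
  have h2 : ContDiffAt ℝ ∞ ((f ∘ (chartAt E' (F y)).symm) ∘
      (chartAt E' (F y) ∘ F ∘ (chartAt E y).symm)) (chartAt E y y) := by
    refine ContDiffAt.comp _ ?_ h1
    simpa [SmoothFun, Function.comp_apply, (chartAt E y).left_inv (mem_chart_source E y)] using hf
  refine h2.congr_of_eventuallyEq ?_
  have h3 : ∀ᶠ z in 𝓝 y, F z ∈ (chartAt E' (F y)).source :=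
    hF.continuousAt.eventually_mem ((chartAt E' (F y)).open_source.mem_nhds (mem_chart_source _ _))
  filter_upwards [(tendsto_chartAt_symm y).eventually h3] with z hz
  simp only [Function.comp_apply]
  rw [(chartAt E' (F y)).left_inv hz]

end SmoothFunctions

/-! ### Multiplication of germs of forms by smooth functions -/

section Module

variable {D D' : ComplexManifold.{u}} {y : D.carrier}

lemma dbar_commutator {q : ℕ} {η : D.carrier → Alt D.E q} {ρ h : D.carrier → ℂ}
    (hρ : SmoothFun D.E ρ y) (hh : SmoothFun D.E h y) (hη : SmoothAt D.E η y) :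
    dbar D.E (fun z => ρ z • (h z • η z)) y - ρ y • dbar D.E (fun z => h z • η z) y =
      h y • (dbar D.E (fun z => ρ z • η z) y - ρ y • dbar D.E η y) := by
  have h1 := dbarVec_commutator (ρ := ρ ∘ (chartAt D.E y).symm) (h := h ∘ (chartAt D.E y).symm)
    (η := localRep D.E y η) (ContDiffAt.differentiableAt hρ (by simp))
    (ContDiffAt.differentiableAt hh (by simp)) (hη.2.differentiableAt (by simp))
  simp only [Function.comp_apply, (chartAt D.E y).left_inv (mem_chart_source D.E y)] at h1
  simp only [dbar, localRep_smul]
  exact h1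

lemma smul_mem_smoothForms {q : ℕ} {ρ : D.carrier → ℂ} (hρ : ∀ᶠ z in 𝓝 y, SmoothFun D.E ρ z)
    {η : D.carrier → Alt D.E q} (h : η ∈ smoothForms D y q) :
    (fun z => ρ z • η z) ∈ smoothForms D y q := by
  filter_upwards [hρ, h] with z hz hz' using hz'.smul hz

/-- Multiplication of germs of forms by a smooth function. -/
def smulGerm {q : ℕ} (ρ : D.carrier → ℂ) (hρ : ∀ᶠ z in 𝓝 y, SmoothFun D.E ρ z) :
    FormGerm D y q →ₗ[ℂ] FormGerm D y q :=
  (nullForms D y q).liftQ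
    { toFun η := FormGerm.mk ⟨fun z => ρ z • η.1 z, smul_mem_smoothForms hρ η.2⟩
      map_add' η η' := by
        rw [← map_add]
        exact FormGerm.mk_eq (Eventually.of_forall fun z => smul_add _ _ _)
      map_smul' c η := by
        rw [RingHom.id_apply, ← map_smul]
        exact FormGerm.mk_eq (Eventually.of_forall fun z => smul_comm (ρ z) c (η.1 z)) }
    (by
      intro η hη
      refine (FormGerm.mk_eq (η' := 0) ?_).trans (map_zero _)
      have hη' : (η : D.carrier → Alt D.E q) =ᶠ[𝓝 y] 0 := hη
      filter_upwards [hη'] with z hz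
      simp [hz])

variable {I : Set (D.carrier → ℂ)}

lemma mk_mem_relI {q : ℕ} {f : D.carrier → ℂ} (hf : f ∈ I)
    (hs : ∀ᶠ z in 𝓝 y, SmoothFun D.E f z) (η η' : smoothForms D y q)
    (h : ∀ᶠ z in 𝓝 y, η'.1 z = f z • η.1 z) : FormGerm.mk η' ∈ relI (y := y) I q :=
  Submodule.subset_span ⟨f, hf, η, ⟨_, smul_mem_smoothForms hs η.2⟩, fun _ => rfl,
    FormGerm.mk_eq h⟩

lemma mk_mem_relConj {q : ℕ} {f : D.carrier → ℂ} (hf : f ∈ I)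
    (hs : ∀ᶠ z in 𝓝 y, SmoothFun D.E f z) (η η' : smoothForms D y q)
    (h : ∀ᶠ z in 𝓝 y, η'.1 z = starRingEnd ℂ (f z) • η.1 z) :
    FormGerm.mk η' ∈ relConj (y := y) I q :=
  Submodule.subset_span ⟨f, hf, η,
    ⟨_, smul_mem_smoothForms (hs.mono fun _ hz => smoothFun_conj hz) η.2⟩, fun _ => rfl,
    FormGerm.mk_eq h⟩

lemma hol_smoothFun {f : D.carrier → ℂ} (hf : ContMDiffAt 𝓘(ℂ, D.E) 𝓘(ℂ, ℂ) ω f y) :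
    ∀ᶠ z in 𝓝 y, SmoothFun D.E f z :=
  ((contMDiffAt_iff_contMDiffAt_nhds (by simp)).1 hf).mono fun _ hz => smoothFun_hol hz

lemma relI_smul {q : ℕ} {ρ : D.carrier → ℂ} (hρ : ∀ᶠ z in 𝓝 y, SmoothFun D.E ρ z) :
    relI (y := y) I q ≤ (relI I q).comap (smulGerm ρ hρ) := by
  refine Submodule.span_le.2 ?_
  rintro _ ⟨f, hf, η, η', h, rfl⟩
  refine Submodule.subset_span ⟨f, hf, ⟨_, smul_mem_smoothForms hρ η.2⟩,
    ⟨_, smul_mem_smoothForms hρ η'.2⟩, fun z => ?_, rfl⟩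
  change ρ z • η'.1 z = f z • (ρ z • η.1 z)
  rw [h, smul_comm]

lemma relConj_smul {q : ℕ} {ρ : D.carrier → ℂ} (hρ : ∀ᶠ z in 𝓝 y, SmoothFun D.E ρ z) :
    relConj (y := y) I q ≤ (relConj I q).comap (smulGerm ρ hρ) := by
  refine Submodule.span_le.2 ?_
  rintro _ ⟨f, hf, η, η', h, rfl⟩
  refine Submodule.subset_span ⟨f, hf, ⟨_, smul_mem_smoothForms hρ η.2⟩,
    ⟨_, smul_mem_smoothForms hρ η'.2⟩, fun z => ?_, rfl⟩
  change ρ z • η'.1 z = starRingEnd ℂ (f z) • (ρ z • η.1 z)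
  rw [h, smul_comm]

/-- The commutator of `∂̄` with the multiplication by a smooth function preserves `Īℰ^{0,•}`, since
it is linear over functions. -/
lemma relConj_commutator (hI : ∀ f ∈ I, ContMDiffAt 𝓘(ℂ, D.E) 𝓘(ℂ, ℂ) ω f y) {q : ℕ}
    {ρ : D.carrier → ℂ} (hρ : ∀ᶠ z in 𝓝 y, SmoothFun D.E ρ z) {g : FormGerm D y q}
    (hg : g ∈ relConj (y := y) I q) :
    dbarGerm (smulGerm ρ hρ g) - smulGerm ρ hρ (dbarGerm g) ∈ relConj (y := y) I (q + 1) := by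
  suffices key : relConj (y := y) I q ≤ (relConj I (q + 1)).comap
      (dbarGerm ∘ₗ smulGerm ρ hρ - smulGerm ρ hρ ∘ₗ dbarGerm :
        FormGerm D y q →ₗ[ℂ] FormGerm D y (q + 1)) from key hg
  refine Submodule.span_le.2 ?_
  rintro _ ⟨f, hf, η, η', h, rfl⟩
  have hs := hol_smoothFun (hI f hf)
  have hw : (fun z => dbar D.E (fun z => ρ z • η.1 z) z - ρ z • dbar D.E η.1 z) ∈
      smoothForms D y (q + 1) :=
    Submodule.sub_mem _ (dbar_mem ⟨_, smul_mem_smoothForms hρ η.2⟩)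
      (smul_mem_smoothForms hρ (dbar_mem η))
  change FormGerm.mk (y := y) (⟨_, dbar_mem ⟨_, smul_mem_smoothForms hρ η'.2⟩⟩ -
    ⟨_, smul_mem_smoothForms hρ (dbar_mem η')⟩) ∈ relConj (y := y) I (q + 1)
  refine mk_mem_relConj hf hs ⟨_, hw⟩ _ ?_
  have h1 : η'.1 = fun z => starRingEnd ℂ (f z) • η.1 z := funext h
  filter_upwards [hρ, hs, η.2] with z h2 h3 h4
  have := dbar_commutator h2 (smoothFun_conj h3) h4
  rw [← this, ← h1]
  simp only [← h]
  rfl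

/-- `ℳ^q` is stable under the multiplication by smooth functions, although it is only defined as an
`𝒪_D`-submodule: `ρ ∂̄g` differs from `∂̄(ρ g)` by an element of `Īℰ^{0,q}` when
`g ∈ Īℰ^{0,q-1}`. -/
lemma relM_smul (hI : ∀ f ∈ I, ContMDiffAt 𝓘(ℂ, D.E) 𝓘(ℂ, ℂ) ω f y) {q : ℕ}
    {ρ : D.carrier → ℂ} (hρ : ∀ᶠ z in 𝓝 y, SmoothFun D.E ρ z) :
    relM (y := y) I q ≤ (relM I q).comap (smulGerm ρ hρ) := by
  have h1 := (relI_smul hρ).trans (Submodule.comap_mono (relI_le_relM (I := I) (y := y) q))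
  have h2 := (relConj_smul hρ).trans (Submodule.comap_mono (relConj_le_relM (I := I) (y := y) q))
  cases q with
  | zero => exact sup_le h1 h2
  | succ q =>
    refine sup_le (sup_le h1 h2) ?_
    rintro _ ⟨g, hg, rfl⟩
    have e : smulGerm ρ hρ (dbarGerm g) = dbarGerm (smulGerm ρ hρ g) -
      (dbarGerm (smulGerm ρ hρ g) - smulGerm ρ hρ (dbarGerm g)) := (sub_sub_cancel _ _).symm
    rw [Submodule.mem_comap, e]
    refine Submodule.sub_mem _ ?_ (relConj_le_relM _ (relConj_commutator hI hρ hg))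
    exact Submodule.mem_sup_right ⟨_, relConj_smul hρ hg, rfl⟩

end Module

/-! ### The lemma of Hadamard -/

section Hadamard

open MeasureTheory

/-- Hadamard's lemma: the increments of a smooth function are values of smoothly varying linear
forms. -/
lemma exists_contDiff_sub_eq {E F : Type*} [NormedAddCommGroup E] [NormedSpace ℝ E]
    [NormedAddCommGroup F] [NormedSpace ℝ F] [CompleteSpace F] {a : E → F}
    (ha : ContDiff ℝ ∞ a) :
    ∃ L : E × E → (E →L[ℝ] F), ContDiff ℝ ∞ L ∧ ∀ z w, a z - a w = L (z, w) (z - w) := by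
  -- `L (z, w)` is the integral of `fderiv ℝ a (w + t (z - w))` over `0 ≤ t ≤ 1`. Its smoothness in
  -- `(z, w)` follows when it is written as the value at `0` of the convolution of the indicator
  -- function of `[0, 1]` with a function of compact support: hence the cut-off function `χ`, equal to
  -- `1` on `[-1, 0]`.
  let χ : ContDiffBump (0 : ℝ) := ⟨2, 3, by norm_num, by norm_num⟩
  have hχ : ∀ t ∈ Set.Icc (0 : ℝ) 1, χ (-t) = 1 := fun t ht => χ.one_of_mem_closedBall (by
    rw [mem_closedBall_zero_iff, norm_neg, Real.norm_eq_abs, abs_of_nonneg ht.1]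
    exact ht.2.trans one_le_two)
  have hγ : ContDiff ℝ ∞ (fun x : (E × E) × ℝ => x.1.2 + x.2 • (x.1.1 - x.1.2)) := by fun_prop
  have ha' : ContDiff ℝ ∞ (fderiv ℝ a) := ha.fderiv_right (by simp)
  let g : E × E → ℝ → (E →L[ℝ] F) := fun p s => χ s • fderiv ℝ a (p.2 + (-s) • (p.1 - p.2))
  have hg : ContDiff ℝ ∞ (Function.uncurry g) := by
    have h1 : ContDiff ℝ ∞ (fun x : (E × E) × ℝ => χ x.2) := χ.contDiff.comp contDiff_snd
    have h2 : ContDiff ℝ ∞ (fun x : (E × E) × ℝ => x.1.2 + (-x.2) • (x.1.1 - x.1.2)) := by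
      fun_prop
    exact h1.smul (ha'.comp h2)
  let f : ℝ → ℝ := Set.indicator (Set.Icc 0 1) 1
  have hf : LocallyIntegrable f volume := by
    refine Integrable.locallyIntegrable ?_
    exact (integrableOn_const (by simp)).integrable_indicator measurableSet_Icc
  have h1 := contDiffOn_convolution_right_with_param (μ := volume) (n := ⊤)
    (ContinuousLinearMap.lsmul ℝ ℝ) (g := g) (s := Set.univ)
    (k := Metric.closedBall (0 : ℝ) 3) isOpen_univ (isCompact_closedBall _ _) (fun p x _ hx => by
      have : χ x = 0 := χ.zero_of_le_dist (by
        rw [Metric.mem_closedBall, not_le] at hx; exact hx.le)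
      simp [g, this]) hf hg.contDiffOn
  rw [Set.univ_prod_univ, contDiffOn_univ] at h1
  have h2 : ContDiff ℝ ∞ (fun p : E × E => (p, (0 : ℝ))) := by fun_prop
  refine ⟨_, h1.comp h2, fun z w => ?_⟩
  have h3 : ∀ t : ℝ, f t • g (z, w) (0 - t) =
      Set.indicator (Set.Icc 0 1) (fun t : ℝ => fderiv ℝ a (w + t • (z - w))) t := fun t => by
    by_cases ht : t ∈ Set.Icc (0 : ℝ) 1
    · simp only [f, g, Set.indicator_of_mem ht, zero_sub, hχ t ht, neg_neg, one_smul, Pi.one_apply]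
    · simp only [f, Set.indicator_of_notMem ht, zero_smul]
  have hc : Continuous (fun t : ℝ => fderiv ℝ a (w + t • (z - w))) := by
    have := ha'.continuous
    fun_prop
  have h4 : MeasureTheory.convolution f (g (z, w)) (ContinuousLinearMap.lsmul ℝ ℝ) volume 0 =
      ∫ t in (0 : ℝ)..1, fderiv ℝ a (w + t • (z - w)) := by
    rw [MeasureTheory.convolution, intervalIntegral.integral_of_le zero_le_one,
      ← integral_Icc_eq_integral_Ioc, ← integral_indicator measurableSet_Icc]
    exact integral_congr_ae (Eventually.of_forall h3)
  change a z - a w = (MeasureTheory.convolution f (g (z, w))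
    (ContinuousLinearMap.lsmul ℝ ℝ) volume 0) (z - w)
  rw [h4, ContinuousLinearMap.intervalIntegral_apply (hc.intervalIntegrable _ _)]
  have h5 : ∀ t ∈ Set.uIcc (0 : ℝ) 1, HasDerivAt (fun t : ℝ => a (w + t • (z - w)))
      (fderiv ℝ a (w + t • (z - w)) (z - w)) t := fun t _ => by
    have h6 : HasDerivAt (fun t : ℝ => w + t • (z - w)) (z - w) t := by
      simpa using ((hasDerivAt_id t).smul_const (z - w)).const_add w
    exact ((ha.differentiable (by simp)) _).hasFDerivAt.comp_hasDerivAt t h6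
  rw [intervalIntegral.integral_eq_sub_of_hasDerivAt h5]
  · simp
  · exact (hc.clm_apply continuous_const).intervalIntegrable _ _

end Hadamard

/-! ### Forms of type `(0,q)` on a vector space -/

section ConjLinear

variable {E : Type*} [NormedAddCommGroup E] [NormedSpace ℂ E]

lemma curryLeft_mem_antiForms {q : ℕ} {θ : Alt E (q + 1)} (h : θ ∈ antiForms E (q + 1)) (v : E) :
    θ.curryLeft v ∈ antiForms E q := by
  intro w j
  have := h (Matrix.vecCons v w) j.succ
  simp only [ContinuousAlternatingMap.curryLeft_apply_apply]
  rw [← this]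
  congr 1
  exact Fin.cons_update (α := fun _ => E) ..

lemma curryLeft_smul_conj {q : ℕ} {θ : Alt E (q + 1)} (h : θ ∈ antiForms E (q + 1)) (c : ℂ)
    (v : E) : θ.curryLeft (c • v) = starRingEnd ℂ c • θ.curryLeft v := by
  have hI : θ.curryLeft (Complex.I • v) = -(Complex.I • θ.curryLeft v) := by
    ext w
    have := h (Matrix.vecCons v w) 0
    have e : Function.update (Matrix.vecCons v w) 0 (Complex.I • v) =
      Matrix.vecCons (Complex.I • v) w := Fin.update_cons_zero _ _ _
    rw [Matrix.cons_val_zero, e] at this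
    simpa [ContinuousAlternatingMap.curryLeft_apply_apply] using this
  have hc : c • v = c.re • v + c.im • (Complex.I • v) := by
    conv_lhs => rw [← Complex.re_add_im c]
    rw [add_smul, mul_smul, Complex.coe_smul, Complex.coe_smul]
  have hc' : starRingEnd ℂ c = c.re - c.im * Complex.I := by
    apply Complex.ext <;> simp
  rw [hc, map_add, map_smul, map_smul, hI, hc']
  ext w
  simp only [smul_eq_mul, ContinuousAlternatingMap.add_apply, ContinuousAlternatingMap.smul_apply,
    ContinuousAlternatingMap.neg_apply, Complex.real_smul]
  ring

/-- A constant form of type `(0,q+1)` has the primitive `z ↦ θ (z, ...)`, up to the factor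
`q + 1`. -/
lemma dbarVec_curryLeft {q : ℕ} {θ : Alt E (q + 1)} (h : θ ∈ antiForms E (q + 1)) (x : E) :
    dbarVec (fun z => θ.curryLeft z) x = ((q : ℂ) + 1) • θ := by
  have h1 : fderiv ℝ (fun z => θ.curryLeft z) x = θ.curryLeft := θ.curryLeft.fderiv
  have h2 : antiPart θ.curryLeft = θ.curryLeft := by
    ext v : 1
    rw [antiPart_apply, curryLeft_smul_conj h, smul_smul, Complex.conj_I, mul_neg,
      Complex.I_mul_I, neg_neg, one_smul, ← two_smul ℂ (θ.curryLeft v), smul_smul]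
    norm_num
  rw [dbarVec, h1, h2, ContinuousAlternatingMap.alternatizeUncurryFin_curryLeft,
    ← Nat.cast_smul_eq_nsmul ℂ]
  push_cast
  rfl

instance finiteDimensional_alt [FiniteDimensional ℂ E] (q : ℕ) :
    FiniteDimensional ℂ (Alt E q) := by
  have h1 : FiniteDimensional ℝ E := FiniteDimensional.complexToReal E
  let Φ : Alt E q →ₗ[ℝ] MultilinearMap ℝ (fun _ : Fin q => E) ℂ :=
    { toFun η := η.toMultilinearMap
      map_add' _ _ := rfl
      map_smul' _ _ := rfl }
  have hΦ : Function.Injective Φ := fun η η' h => by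
    ext v
    exact congrArg (fun m : MultilinearMap ℝ (fun _ : Fin q => E) ℂ => m v) h
  have h2 : FiniteDimensional ℝ (Alt E q) := FiniteDimensional.of_injective Φ hΦ
  exact Module.Finite.of_restrictScalars_finite ℝ ℂ _

/-- The decomposition of a real linear form in its complex linear and conjugate-linear parts. -/
lemma real_linear_apply (L : E →L[ℝ] ℂ) (c : ℂ) (v : E) :
    L (c • v) = c * ((L v - Complex.I * L (Complex.I • v)) / 2) +
      starRingEnd ℂ c * ((L v + Complex.I * L (Complex.I • v)) / 2) := by
  have hc : c • v = c.re • v + c.im • (Complex.I • v) := by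
    conv_lhs => rw [← Complex.re_add_im c]
    rw [add_smul, mul_smul, Complex.coe_smul, Complex.coe_smul]
  have hc1 : c = c.re + c.im * Complex.I := (Complex.re_add_im c).symm
  have hc' : starRingEnd ℂ c = c.re - c.im * Complex.I := by
    apply Complex.ext <;> simp
  rw [hc, map_add, map_smul, map_smul, hc', Complex.real_smul, Complex.real_smul]
  generalize L v = A
  generalize L (Complex.I • v) = B
  conv_rhs => rw [hc1]
  simp only [Complex.add_re, Complex.ofReal_re, Complex.mul_re, Complex.I_re, mul_zero,
    Complex.ofReal_im, Complex.I_im, mul_one, sub_self, add_zero, Complex.add_im, Complex.mul_im,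
    zero_add]
  linear_combination (c.im * B) * Complex.I_mul_I

end ConjLinear

/-! ### Congruence of forms modulo `ℳ` -/

section Congruence

variable {D : ComplexManifold.{u}} {y : D.carrier}

/-- The form `η` is smooth near `y` and its germ belongs to `ℳ^q`. -/
def InM (y : D.carrier) (I : Set (D.carrier → ℂ)) {q : ℕ} (η : D.carrier → Alt D.E q) : Prop :=
  ∃ h : η ∈ smoothForms D y q, FormGerm.mk ⟨η, h⟩ ∈ relM (y := y) I q

variable {I : Set (D.carrier → ℂ)} {q : ℕ}

lemma InM.congr {η η' : D.carrier → Alt D.E q} (h : InM y I η) (e : η' =ᶠ[𝓝 y] η) :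
    InM y I η' := by
  obtain ⟨h1, h2⟩ := h
  have h3 : η' ∈ smoothForms D y q := by
    filter_upwards [h1, e.eventuallyEq_nhds] with z hz hz' using hz.congr hz'
  exact ⟨h3, by rwa [FormGerm.mk_eq (η := ⟨η', h3⟩) (η' := ⟨η, h1⟩) e]⟩

lemma InM.zero : InM y I (0 : D.carrier → Alt D.E q) :=
  ⟨Submodule.zero_mem _, Submodule.zero_mem _⟩

lemma InM.add {η η' : D.carrier → Alt D.E q} (h : InM y I η) (h' : InM y I η') :
    InM y I (η + η') := by
  obtain ⟨h1, h2⟩ := h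
  obtain ⟨h1', h2'⟩ := h'
  exact ⟨Submodule.add_mem _ h1 h1', Submodule.add_mem _ h2 h2'⟩

lemma InM.sum {κ : Type*} {s : Finset κ} {η : κ → D.carrier → Alt D.E q}
    (h : ∀ k ∈ s, InM y I (η k)) : InM y I (∑ k ∈ s, η k) := by
  classical
  induction s using Finset.induction_on with
  | empty => exact InM.zero
  | insert a s ha ih =>
    rw [Finset.sum_insert ha]
    exact (h a (Finset.mem_insert_self a s)).add
      (ih fun k hk => h k (Finset.mem_insert_of_mem hk))

variable (hI : ∀ f ∈ I, ContMDiffAt 𝓘(ℂ, D.E) 𝓘(ℂ, ℂ) ω f y)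
include hI

lemma InM.smul {η : D.carrier → Alt D.E q} (h : InM y I η) {ρ : D.carrier → ℂ}
    (hρ : ∀ᶠ z in 𝓝 y, SmoothFun D.E ρ z) : InM y I (fun z => ρ z • η z) := by
  obtain ⟨h1, h2⟩ := h
  exact ⟨_, relM_smul hI hρ h2⟩

lemma InM.map_dbar {η : D.carrier → Alt D.E q} (h : InM y I η) : InM y I (dbar D.E η) := by
  obtain ⟨h1, h2⟩ := h
  exact ⟨_, relM_dbar hI q h2⟩

lemma InM.of_ideal {f : D.carrier → ℂ} (hf : ∃ F ∈ I, F =ᶠ[𝓝 y] f) {η : D.carrier → Alt D.E q}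
    (hη : η ∈ smoothForms D y q) : InM y I (fun z => f z • η z) := by
  obtain ⟨F, hF, e⟩ := hf
  have hs := hol_smoothFun (hI F hF)
  refine InM.congr (η := fun z => F z • η z) ⟨smul_mem_smoothForms hs hη, ?_⟩
    (e.mono fun z hz => by simp only [hz])
  exact relI_le_relM _ (mk_mem_relI hF hs ⟨η, hη⟩ _ (Eventually.of_forall fun _ => rfl))

lemma InM.of_conj {f : D.carrier → ℂ} (hf : ∃ F ∈ I, F =ᶠ[𝓝 y] f) {η : D.carrier → Alt D.E q}
    (hη : η ∈ smoothForms D y q) : InM y I (fun z => starRingEnd ℂ (f z) • η z) := by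
  obtain ⟨F, hF, e⟩ := hf
  have hs := hol_smoothFun (hI F hF)
  refine InM.congr (η := fun z => starRingEnd ℂ (F z) • η z)
    ⟨smul_mem_smoothForms (hs.mono fun _ h => smoothFun_conj h) hη, ?_⟩
    (e.mono fun z hz => by simp only [hz])
  exact relConj_le_relM _ (mk_mem_relConj hF hs ⟨η, hη⟩ _ (Eventually.of_forall fun _ => rfl))

end Congruence

/-! ### Pullbacks along maps which are congruent modulo the ideal -/

section Homotopy

variable {D : ComplexManifold.{u}} {y : D.carrier} {I : Set (D.carrier → ℂ)}
  {E' : Type*} [NormedAddCommGroup E'] [NormedSpace ℂ E']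
  {κ : Type*} [Fintype κ] {b : Module.Basis κ ℂ E'} {f g : D.carrier → E'}

lemma smoothFun_vec {a : E' → ℂ} {v : E'} : SmoothFun E' a v ↔ ContDiffAt ℝ ∞ a v := by
  rw [SmoothFun, (chartAt_vec v).2, (chartAt_vec v).1]; rfl

lemma smoothAt_vec {q : ℕ} {η : E' → Alt E' q} {v : E'} :
    SmoothAt E' η v ↔ η v ∈ antiForms E' q ∧ ContDiffAt ℝ ∞ η v := by
  rw [SmoothAt, localRep_vec, (chartAt_vec v).1]; rfl

lemma pullback_mem_vec {q : ℕ} (hf : HolAt D.E E' f y) {η : E' → Alt E' q}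
    (hη : ∀ᶠ v in 𝓝 (f y), SmoothAt E' η v) : pullback D.E E' f η ∈ smoothForms D y q := by
  filter_upwards [hf.eventually, hf.continuousAt.eventually hη] with z hz hz'
  exact SmoothAt.pullback hz hz'

lemma smoothFun_comp_vec {E'' : Type*} [NormedAddCommGroup E''] [NormedSpace ℂ E'']
    {F : D.carrier → E''} (hF : HolAt D.E E'' F y) {a : E'' → ℂ} (ha : ContDiff ℝ ∞ a) :
    ∀ᶠ z in 𝓝 y, SmoothFun D.E (fun z => a (F z)) z := by
  filter_upwards [hF.eventually] with z hz
  exact SmoothFun.comp (f := a) (smoothFun_vec.2 ha.contDiffAt) hz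

omit [Fintype κ] in
lemma contDiff_coord [FiniteDimensional ℂ E'] (k : κ) :
    ContDiff ℝ ∞ (fun v : E' => b.repr v k) := by
  have h : ContDiff ℂ ∞ (fun v : E' => b.repr v k) :=
    (b.coord k).toContinuousLinearMap.contDiff
  exact h.restrict_scalars ℝ

variable (hI : ∀ f ∈ I, ContMDiffAt 𝓘(ℂ, D.E) 𝓘(ℂ, ℂ) ω f y)
  (hf : HolAt D.E E' f y) (hg : HolAt D.E E' g y)
  (hu : ∀ k, ∃ F ∈ I, F =ᶠ[𝓝 y] fun z => b.repr (f z - g z) k)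
include hI hf hg hu

/-- If the coordinates `u k` of `f - g` belong to `I` and `a` is a smooth function, then `a ∘ f - a ∘ g`
is by Hadamard's lemma a combination of the `u k` and their conjugates with smooth
coefficients. -/
lemma InM.sub_smul [FiniteDimensional ℂ E'] {q : ℕ} {a : E' → ℂ} (ha : ContDiff ℝ ∞ a)
    {η : D.carrier → Alt D.E q} (hη : η ∈ smoothForms D y q) :
    InM y I (fun z => (a (f z) - a (g z)) • η z) := by
  obtain ⟨L, hL, hLa⟩ := exists_contDiff_sub_eq ha
  have hfg : HolAt D.E (E' × E') (fun z => (f z, g z)) y := hf.prodMk_space hg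
  have hβ : ∀ (k : κ) (c : ℂ), ∀ᶠ z in 𝓝 y, SmoothFun D.E
      (fun z => (L (f z, g z) (b k) + c * L (f z, g z) (Complex.I • b k)) / 2) z := fun k c =>
    smoothFun_comp_vec hfg (a := fun p => (L p (b k) + c * L p (Complex.I • b k)) / 2)
      (((hL.clm_apply contDiff_const).add
        (contDiff_const.mul (hL.clm_apply contDiff_const))).div_const 2)
  have h1 : ∀ k, InM y I (fun z => b.repr (f z - g z) k •
        (((L (f z, g z) (b k) + -Complex.I * L (f z, g z) (Complex.I • b k)) / 2) • η z)) :=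
    fun k => InM.of_ideal hI (hu k) (smul_mem_smoothForms (hβ k (-Complex.I)) hη)
  have h2 : ∀ k, InM y I (fun z => starRingEnd ℂ (b.repr (f z - g z) k) •
        (((L (f z, g z) (b k) + Complex.I * L (f z, g z) (Complex.I • b k)) / 2) • η z)) :=
    fun k => InM.of_conj hI (hu k) (smul_mem_smoothForms (hβ k Complex.I) hη)
  refine (InM.sum (s := Finset.univ) fun k _ => (h1 k).add (h2 k)).congr
    (Eventually.of_forall fun z => ?_)
  have h3 : a (f z) - a (g z) = ∑ k, L (f z, g z) (b.repr (f z - g z) k • b k) := by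
    rw [hLa, ← map_sum, b.sum_repr]
  simp only [Finset.sum_apply, Pi.add_apply, h3, Finset.sum_smul]
  refine Finset.sum_congr rfl fun k _ => ?_
  rw [real_linear_apply, add_smul, mul_smul, mul_smul]
  congr 3
  ring

/-- Two maps which are congruent modulo `I` have congruent pullbacks of constant forms modulo `ℳ`:
this follows by induction from `θ = ∂̄ K / (q + 1)` with `K z = θ (z, ...)`, whose coefficients are
the conjugates of the coordinates. -/
lemma InM.sub_pullback_const [FiniteDimensional ℂ E'] (q : ℕ) (θ : Alt E' q)
    (hθ : θ ∈ antiForms E' q) :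
    InM y I (pullback D.E E' f (fun _ => θ) - pullback D.E E' g (fun _ => θ)) := by
  induction q with
  | zero =>
    refine InM.zero.congr (Eventually.of_forall fun z => ?_)
    ext v
    exact sub_eq_zero.2 (congrArg θ (Subsingleton.elim _ _))
  | succ q ih =>
    have hK : ∀ v, SmoothAt E' (fun z : E' => θ.curryLeft z) v := fun v =>
      smoothAt_vec.2 ⟨curryLeft_mem_antiForms hθ v, θ.curryLeft.contDiff.contDiffAt⟩
    have hc : ∀ k, ∀ v, SmoothAt E' (fun _ : E' => θ.curryLeft (b k)) v := fun k v =>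
      smoothAt_vec.2 ⟨curryLeft_mem_antiForms hθ _, contDiffAt_const⟩
    have hex : ∀ {F : D.carrier → E'}, HolAt D.E E' F y →
        pullback D.E E' F (fun _ => θ) =ᶠ[𝓝 y] fun z => ((q : ℂ) + 1)⁻¹ •
          dbar D.E (pullback D.E E' F fun z => θ.curryLeft z) z := by
      intro F hF
      filter_upwards [hF.eventually] with z hz
      rw [dbar_pullback hz (Eventually.of_forall hK), dbar_vec]
      have h1 : dbarVec (fun z : E' => θ.curryLeft z) = fun _ => ((q : ℂ) + 1) • θ :=
        funext fun x => dbarVec_curryLeft hθ x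
      have h2 : (q : ℂ) + 1 ≠ 0 := Nat.cast_add_one_ne_zero q
      rw [h1]
      ext v
      simp only [pullback, ContinuousAlternatingMap.compContinuousLinearMap_apply,
        ContinuousAlternatingMap.smul_apply, smul_smul, inv_mul_cancel₀ h2, one_smul]
    have hK' : ∀ {F : D.carrier → E'} (z), pullback D.E E' F (fun z => θ.curryLeft z) z =
        ∑ k, starRingEnd ℂ (b.repr (F z) k) •
          pullback D.E E' F (fun _ => θ.curryLeft (b k)) z := by
      intro F z
      have h1 : θ.curryLeft (F z) =
          ∑ k, starRingEnd ℂ (b.repr (F z) k) • θ.curryLeft (b k) := by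
        conv_lhs => rw [← b.sum_repr (F z), map_sum]
        exact Finset.sum_congr rfl fun k _ => curryLeft_smul_conj hθ _ _
      ext v
      simp only [pullback, h1, ContinuousAlternatingMap.compContinuousLinearMap_apply,
        ContinuousAlternatingMap.smul_apply, ContinuousAlternatingMap.sum_apply]
    have hM : InM y I (pullback D.E E' f (fun z => θ.curryLeft z) -
        pullback D.E E' g fun z => θ.curryLeft z) := by
      have h1 : ∀ k, InM y I _ := fun k =>
        InM.smul hI (ih (θ.curryLeft (b k)) (curryLeft_mem_antiForms hθ _))
          (ρ := fun z => starRingEnd ℂ (b.repr (f z) k))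
          ((smoothFun_comp_vec hf (contDiff_coord (b := b) k)).mono fun _ h => smoothFun_conj h)
      have h2 : ∀ k, InM y I _ := fun k => InM.of_conj hI (hu k)
        (pullback_mem_vec hg (Eventually.of_forall (hc k)))
      refine (InM.sum (s := Finset.univ) fun k _ => (h1 k).add (h2 k)).congr
        (Eventually.of_forall fun z => ?_)
      simp only [Pi.sub_apply, hK', Finset.sum_apply, Pi.add_apply, ← Finset.sum_sub_distrib]
      refine Finset.sum_congr rfl fun k _ => ?_
      simp only [map_sub, Finsupp.coe_sub, Pi.sub_apply]
      module
    have hM' := InM.smul hI (InM.map_dbar hI hM) (ρ := fun _ => ((q : ℂ) + 1)⁻¹)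
      (Eventually.of_forall fun _ => SmoothFun.const _ _)
    refine hM'.congr ?_
    have hs : ∀ {F : D.carrier → E'}, HolAt D.E E' F y → ∀ᶠ z in 𝓝 y,
        SmoothAt D.E (pullback D.E E' F fun z => θ.curryLeft z) z := fun hF =>
      pullback_mem_vec hF (Eventually.of_forall hK)
    filter_upwards [hex hf, hex hg, hs hf, hs hg] with z h1 h2 h3 h4
    have h5 : SmoothAt D.E (-pullback D.E E' g fun z => θ.curryLeft z) z := by
      have := h4.const_smul (-1)
      rwa [neg_one_smul] at this
    have h6 : dbar D.E (-pullback D.E E' g fun z => θ.curryLeft z) z =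
        -dbar D.E (pullback D.E E' g fun z => θ.curryLeft z) z := by
      have := dbar_add h5 h4
      rw [neg_add_cancel] at this
      have h7 := dbar_add (E := D.E) (η := (0 : D.carrier → Alt D.E q)) (η' := 0) (y := z)
        SmoothAt.zero SmoothAt.zero
      rw [add_zero, left_eq_add] at h7
      rw [h7] at this
      exact eq_neg_of_add_eq_zero_left this.symm
    rw [Pi.sub_apply, h1, h2, sub_eq_add_neg (pullback D.E E' f _) _, dbar_add h3 h5, h6,
      ← sub_eq_add_neg, smul_sub]

/-- The case of a form on the whole vector space, which is decomposed in a basis of the space of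
constant forms of type `(0,q)`. -/
lemma InM.sub_pullback_contDiff [FiniteDimensional ℂ E'] {q : ℕ} {η : E' → Alt E' q}
    (hη : ContDiff ℝ ∞ η) (hη' : ∀ v, η v ∈ antiForms E' q) :
    InM y I (pullback D.E E' f η - pullback D.E E' g η) := by
  let B := Module.finBasis ℂ (antiForms E' q)
  have hex : ∀ i, ∃ Φ : Alt E' q →ₗ[ℂ] ℂ, Φ ∘ₗ (antiForms E' q).subtype = B.coord i :=
    fun i => LinearMap.exists_extend _
  choose Φ hΦ using hex
  have hΦ' : ∀ v, η v = ∑ i, Φ i (η v) • (B i : Alt E' q) := fun v => by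
    have h1 := congrArg Subtype.val (B.sum_repr ⟨η v, hη' v⟩)
    have h2 : ∀ i, B.repr ⟨η v, hη' v⟩ i = Φ i (η v) := fun i =>
      (LinearMap.congr_fun (hΦ i) ⟨η v, hη' v⟩).symm
    simp only [h2, Submodule.coe_sum, Submodule.coe_smul] at h1
    exact h1.symm
  have ha : ∀ i, ContDiff ℝ ∞ (fun v => Φ i (η v)) := fun i => by
    have h : ContDiff ℂ ∞ (Φ i) := (Φ i).toContinuousLinearMap.contDiff
    exact (h.restrict_scalars ℝ).comp hη
  have h1 : ∀ i, InM y I _ := fun i =>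
    InM.smul hI (InM.sub_pullback_const hI hf hg hu q (B i) (B i).2)
      (smoothFun_comp_vec hf (ha i))
  have h2 : ∀ i, InM y I _ := fun i => InM.sub_smul hI hf hg hu (ha i)
    (pullback_mem_vec (η := fun _ => (B i : Alt E' q)) hg
      (Eventually.of_forall fun v => smoothAt_vec.2 ⟨(B i).2, contDiffAt_const⟩))
  refine (InM.sum (s := Finset.univ) fun i _ => (h1 i).add (h2 i)).congr
    (Eventually.of_forall fun z => ?_)
  have h3 : ∀ F : D.carrier → E', pullback D.E E' F η z =
      ∑ i, Φ i (η (F z)) • pullback D.E E' F (fun _ => (B i : Alt E' q)) z := fun F => by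
    ext v
    have := congrArg (fun w : Alt E' q => w ((fd D.E E' F z).restrictScalars ℝ ∘ v)) (hΦ' (F z))
    simpa only [pullback, ContinuousAlternatingMap.compContinuousLinearMap_apply,
      ContinuousAlternatingMap.smul_apply, ContinuousAlternatingMap.sum_apply] using this
  simp only [Pi.sub_apply, h3, Finset.sum_apply, Pi.add_apply, ← Finset.sum_sub_distrib]
  refine Finset.sum_congr rfl fun k _ => ?_
  module

/-- Pullbacks of smooth forms along holomorphic maps which agree modulo `I` are congruent
modulo `ℳ`. A cut-off function reduces this to forms on the whole vector space. -/
lemma InM.sub_pullback [FiniteDimensional ℂ E'] (hfg : f y = g y) {q : ℕ} {η : E' → Alt E' q}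
    (hη : ∀ᶠ v in 𝓝 (f y), SmoothAt E' η v) :
    InM y I (pullback D.E E' f η - pullback D.E E' g η) := by
  have hfd : FiniteDimensional ℝ E' := FiniteDimensional.complexToReal E'
  obtain ⟨r, hr, hball⟩ := Metric.eventually_nhds_iff_ball.1 hη
  let χ : ContDiffBump (f y) := ⟨r / 4, r / 2, by positivity, by linarith⟩
  have hχ : ∀ v, SmoothAt E' (fun v => (χ v : ℂ) • η v) v := fun v => by
    by_cases hv : v ∈ Metric.ball (f y) r
    · obtain ⟨h1, h2⟩ := smoothAt_vec.1 (hball v hv)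
      have h3 : ContDiffAt ℝ ∞ (fun v => (χ v : ℂ)) v :=
        Complex.ofRealCLM.contDiff.contDiffAt.comp v χ.contDiffAt
      exact smoothAt_vec.2 ⟨Submodule.smul_mem _ _ h1, h3.smul h2⟩
    · refine SmoothAt.congr (η' := 0) ?_ SmoothAt.zero
      have h1 : ∀ᶠ w in 𝓝 v, r / 2 < dist w (f y) := by
        have h2 : r / 2 < dist v (f y) := by
          rw [Metric.mem_ball, not_lt] at hv; linarith
        exact (continuous_id.dist continuous_const).continuousAt.eventually (lt_mem_nhds h2)
      filter_upwards [h1] with w hw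
      rw [χ.zero_of_le_dist hw.le]
      simp
  have h1 := InM.sub_pullback_contDiff hI hf hg hu (η := fun v => (χ v : ℂ) • η v)
    (contDiff_iff_contDiffAt.2 fun v => (smoothAt_vec.1 (hχ v)).2)
    (fun v => (smoothAt_vec.1 (hχ v)).1)
  have h2 : (fun v => (χ v : ℂ) • η v) =ᶠ[𝓝 (f y)] η := by
    filter_upwards [χ.eventuallyEq_one] with v hv
    rw [hv]; simp
  have h2' : (fun v => (χ v : ℂ) • η v) =ᶠ[𝓝 (g y)] η := by rw [← hfg]; exact h2
  refine h1.congr ?_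
  filter_upwards [hf.continuousAt.eventually h2, hg.continuousAt.eventually h2'] with z h3 h4
  have h3' : (χ (f z) : ℂ) • η (f z) = η (f z) := h3
  have h4' : (χ (g z) : ℂ) • η (g z) = η (g z) := h4
  simp only [Pi.sub_apply, pullback, h3', h4']

end Homotopy

/-! ### Comorphisms of embeddings -/

namespace EmbeddingTriple

variable {X : ComplexRingedSpace.{u}} {T S : EmbeddingTriple X} {x : X.top}

lemma mem_of_mem_preimageOpens {W : Opens T.D.carrier} (hx : x ∈ T.U)
    (h : x ∈ preimageOpens T.isClosedEmbedding.continuous W) : T.k ⟨x, hx⟩ ∈ W := by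
  obtain ⟨y, hy, rfl⟩ := h
  exact hy

lemma germ_comap_res {W W' : Opens T.D.carrier} (h : W' ≤ W) {hx : x ∈ T.U}
    (hx' : T.k ⟨x, hx⟩ ∈ W') (F : Hol T.D W) :
    X.str.germ _ x (mem_preimageOpens T.isClosedEmbedding.continuous ⟨x, hx⟩ hx')
      (T.comap W' (Hol.res h F)) =
    X.str.germ _ x (mem_preimageOpens T.isClosedEmbedding.continuous ⟨x, hx⟩ (h hx'))
      (T.comap W F) := by
  rw [T.comap_res h, TopCat.Presheaf.germ_res_apply]

lemma Pulls.sub {hx : x ∈ T.U} {f g : T.D.carrier → ℂ} {s t : X.str.stalk x}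
    (hf : T.Pulls x hx f s) (hg : T.Pulls x hx g t) :
    T.Pulls x hx (fun z => f z - g z) (s - t) := by
  obtain ⟨W, hW, F, hF, rfl⟩ := hf
  obtain ⟨W', hW', G, hG, rfl⟩ := hg
  refine ⟨W ⊓ W', ⟨hW, hW'⟩, Hol.res inf_le_left F - Hol.res inf_le_right G, fun z => ?_, ?_⟩
  · exact congrArg₂ (· - ·) (hF ⟨z.1, z.2.1⟩) (hG ⟨z.1, z.2.2⟩)
  · rw [map_sub, map_sub, germ_comap_res (hx := hx) inf_le_left ⟨hW, hW'⟩,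
      germ_comap_res (hx := hx) inf_le_right ⟨hW, hW'⟩]

lemma Pulls.mul {hx : x ∈ T.U} {f g : T.D.carrier → ℂ} {s t : X.str.stalk x}
    (hf : T.Pulls x hx f s) (hg : T.Pulls x hx g t) :
    T.Pulls x hx (fun z => f z * g z) (s * t) := by
  obtain ⟨W, hW, F, hF, rfl⟩ := hf
  obtain ⟨W', hW', G, hG, rfl⟩ := hg
  refine ⟨W ⊓ W', ⟨hW, hW'⟩, Hol.res inf_le_left F * Hol.res inf_le_right G, fun z => ?_, ?_⟩
  · exact congrArg₂ (· * ·) (hF ⟨z.1, z.2.1⟩) (hG ⟨z.1, z.2.2⟩)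
  · rw [map_mul, map_mul, germ_comap_res (hx := hx) inf_le_left ⟨hW, hW'⟩,
      germ_comap_res (hx := hx) inf_le_right ⟨hW, hW'⟩]

lemma Pulls.const (hx : x ∈ T.U) (c : ℂ) :
    T.Pulls x hx (fun _ => c) (X.str.germ ⊤ x trivial (X.scalars c)) := by
  refine ⟨⊤, trivial, algebraMap ℂ _ c, fun z => rfl, ?_⟩
  rw [T.comap_const]
  exact TopCat.Presheaf.germ_res_apply X.str _ x _ (X.scalars c)

/-- Functions which do not vanish at the point pull back to units. -/
lemma Pulls.isUnit {hx : x ∈ T.U} {f : T.D.carrier → ℂ} {s : X.str.stalk x}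
    (hf : T.Pulls x hx f s) (h : f (T.k ⟨x, hx⟩) ≠ 0) : IsUnit s := by
  obtain ⟨W, hW, F, hF, rfl⟩ := hf
  have hcont : Continuous F := F.contMDiff.continuous
  let W' : Opens T.D.carrier := ⟨Subtype.val '' (F ⁻¹' {0}ᶜ),
    W.isOpen.isOpenMap_subtype_val _ (isOpen_compl_singleton.preimage hcont)⟩
  have hle : W' ≤ W := by
    rintro _ ⟨z, -, rfl⟩
    exact z.2
  have hW' : T.k ⟨x, hx⟩ ∈ W' := ⟨⟨_, hW⟩, by
    change F ⟨_, hW⟩ ≠ 0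
    rw [hF]; exact h, rfl⟩
  rw [← germ_comap_res hle hW']
  refine IsUnit.map _ (IsUnit.map _ ?_)
  have hne : ∀ z : W', Hol.res hle F z ≠ 0 := by
    rintro ⟨_, z, hz, rfl⟩
    exact hz
  let G : Hol T.D W' := ⟨fun z => (Hol.res hle F z)⁻¹, (Hol.res hle F).contMDiff.inv₀ hne⟩
  refine IsUnit.of_mul_eq_one G ?_
  ext z
  exact mul_inv_cancel₀ (hne z)

/-- The comorphism is a local homomorphism, since it is surjective on the stalks. -/
lemma Pulls.isUnit_iff {hx : x ∈ T.U} {f : T.D.carrier → ℂ} {s : X.str.stalk x}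
    (hf : T.Pulls x hx f s) : IsUnit s ↔ f (T.k ⟨x, hx⟩) ≠ 0 := by
  refine ⟨fun hs h0 => ?_, hf.isUnit⟩
  obtain ⟨v, hv⟩ := hs.exists_right_inv
  obtain ⟨W, hW, G, hG⟩ := T.surjective ⟨x, hx⟩ v
  classical
  have hg : T.Pulls x hx (fun z => if hz : z ∈ W then G ⟨z, hz⟩ else 0) v :=
    ⟨W, hW, G, fun z => by simp, hG⟩
  have h1 := (hf.mul hg).sub (Pulls.const hx 1)
  rw [hv, map_one, map_one, sub_self] at h1
  have h2 : IsUnit (0 : X.str.stalk x) := h1.isUnit (by simp [h0])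
  have := X.toLRS.isLocalRing x
  exact not_isUnit_zero h2

/-- Functions on two embeddings with the same pullback take the same value, which is the only
constant `c` for which the pullback minus `c` is not a unit. -/
lemma Pulls.eq_value {hx : x ∈ T.U} {hx' : x ∈ S.U} {f : T.D.carrier → ℂ} {g : S.D.carrier → ℂ}
    {s : X.str.stalk x} (hf : T.Pulls x hx f s) (hg : S.Pulls x hx' g s) :
    f (T.k ⟨x, hx⟩) = g (S.k ⟨x, hx'⟩) := by
  have h1 := (hf.sub (Pulls.const hx (f (T.k ⟨x, hx⟩)))).isUnit_iff
  have h2 := (hg.sub (Pulls.const hx' (f (T.k ⟨x, hx⟩)))).isUnit_iff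
  rw [h1, sub_self, sub_ne_zero] at h2
  by_contra h
  exact h2.2 (Ne.symm h) rfl

/-- Holomorphic functions on an embedding lift to any other embedding, near the given point. -/
lemma exists_lift (hS : x ∈ S.U) (hT : x ∈ T.U) (W : Opens S.D.carrier)
    (hW : S.k ⟨x, hS⟩ ∈ W) (H : Hol S.D W) (h : S.D.carrier → ℂ) (hH : ∀ z : W, H z = h z) :
    ∃ F : T.D.carrier → ℂ, ∀ᶠ x' in 𝓝 x, ∀ (hT' : x' ∈ T.U) (hS' : x' ∈ S.U),
      ∃ s, S.Pulls x' hS' h s ∧ T.Pulls x' hT' F s := by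
  classical
  obtain ⟨W', hW', G, hG⟩ := T.surjective ⟨x, hT⟩ (X.str.germ _ x
    (mem_preimageOpens S.isClosedEmbedding.continuous ⟨x, hS⟩ hW) (S.comap W H))
  obtain ⟨V, hV, i, j, hij⟩ := TopCat.Presheaf.germ_eq X.str x _ _ _ _ hG
  refine ⟨fun z => if hz : z ∈ W' then G ⟨z, hz⟩ else 0, ?_⟩
  filter_upwards [V.isOpen.mem_nhds hV] with x' hx' hT' hS'
  have h1 := mem_of_mem_preimageOpens hS' (j.le hx')
  have h2 := mem_of_mem_preimageOpens hT' (i.le hx')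
  refine ⟨_, ⟨W, h1, H, hH, rfl⟩, W', h2, G, fun z => by simp, ?_⟩
  have h3 := congrArg (X.str.germ V x' hx') hij
  rwa [TopCat.Presheaf.germ_res_apply, TopCat.Presheaf.germ_res_apply] at h3

end EmbeddingTriple

/-! ### Comparison of two embeddings -/

section LocalLift

variable {X : ComplexRingedSpace.{u}}

lemma ModelStalk.mk_eq_of_inM {m q : ℕ} {T : Fin m → EmbeddingTriple X} {x : X.top}
    (hx : ∀ a, x ∈ (T a).U) {η η' : (famD T).carrier → Alt (famD T).E q}
    (h : η ∈ smoothForms (famD T) (famPt T hx) q) (h' : η' ∈ smoothForms (famD T) (famPt T hx) q)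
    (hM : InM (famPt T hx) (famIdeal T hx) (η - η')) :
    ModelStalk.mk hx q (FormGerm.mk ⟨η, h⟩) = ModelStalk.mk hx q (FormGerm.mk ⟨η', h'⟩) :=
  (Submodule.Quotient.eq _).2 hM.2

/-- A basis of the model space of a product of ambient manifolds. -/
def famBasis {m : ℕ} (T : Fin m → EmbeddingTriple X) :
    Module.Basis (Σ a, Fin (Module.finrank ℂ (T a).D.E)) ℂ (famD T).E :=
  Pi.basis fun a => Module.finBasis ℂ (T a).D.E

lemma famBasis_repr {m : ℕ} (T : Fin m → EmbeddingTriple X) (v : (famD T).E)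
    (k : Σ a, Fin (Module.finrank ℂ (T a).D.E)) :
    (famBasis T).repr v k = (Module.finBasis ℂ (T k.1).D.E).repr (v k.1) k.2 :=
  Pi.basis_repr (fun a => Module.finBasis ℂ (T a).D.E) v k

/-- The continuity of the diagonal embedding, stated without subtypes. -/
lemma continuousAt_famPt {m : ℕ} (T : Fin m → EmbeddingTriple X) {x : X.top}
    (hx : ∀ a, x ∈ (T a).U) {s : Set (famD T).carrier} (hs : s ∈ 𝓝 (famPt T hx)) :
    ∀ᶠ x' in 𝓝 x, ∀ hx' : ∀ a, x' ∈ (T a).U, famPt T hx' ∈ s := by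
  have hc : Continuous (fun y : {y : X.top // ∀ a, y ∈ (T a).U} => famPt T y.2) :=
    continuous_pi fun a => (T a).isClosedEmbedding.continuous.comp
      (Continuous.subtype_mk continuous_subtype_val
        fun y : {y : X.top // ∀ a, y ∈ (T a).U} => y.2 a)
  have h1 : ∀ᶠ y : {y : X.top // ∀ a, y ∈ (T a).U} in 𝓝 ⟨x, hx⟩, famPt T y.2 ∈ s :=
    hc.continuousAt.eventually_mem (x := ⟨x, hx⟩) hs
  rw [nhds_subtype_eq_comap, eventually_comap] at h1
  filter_upwards [h1] with x' h hx' using h ⟨x', hx'⟩ rfl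

/-- Near a point, a smooth form on any embedding has the same class as a smooth form on a given
embedding `T`. The coordinates of the first ambient manifold lift to holomorphic functions on the
second one and so define a holomorphic map `g`, along which the form is pulled back. On the product
of the two ambient manifolds, the coordinates and the components of `g` agree modulo the ideal of
the diagonal embedding. -/
lemma exists_form_single {x : X.top} (S : EmbeddingsAt x) (T : EmbeddingTriple X) (hT : x ∈ T.U)
    {q : ℕ} (η : (famD S.T).carrier → Alt (famD S.T).E q) :
    ∃ η' : (famD fun _ : Fin 1 => T).carrier → Alt (famD fun _ : Fin 1 => T).E q,
      ∀ᶠ x' in 𝓝 x, ∀ (hT' : x' ∈ T.U) (hS' : ∀ a, x' ∈ (S.T a).U)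
        (hη : η ∈ smoothForms (famD S.T) (famPt S.T hS') q),
        ∃ hη' : η' ∈ smoothForms (famD fun _ : Fin 1 => T)
            (famPt (fun _ : Fin 1 => T) fun _ => hT') q,
          SmoothFormStalk.of ⟨S.m, S.T, hS'⟩ q (ModelStalk.mk hS' q (FormGerm.mk ⟨η, hη⟩)) =
          SmoothFormStalk.of ⟨0, fun _ => T, fun _ => hT'⟩ q
            (ModelStalk.mk (T := fun _ : Fin 1 => T) (fun _ => hT') q
              (FormGerm.mk ⟨η', hη'⟩)) := by
  classical
  let E' := (famD S.T).E
  let y₀ : (famD S.T).carrier := famPt S.T S.mem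
  let κ := Σ a, Fin (Module.finrank ℂ (S.T a).D.E)
  -- The coordinate functions near `y₀`.
  let h : ∀ k : κ, (S.T k.1).D.carrier → ℂ := fun k z =>
    (Module.finBasis ℂ (S.T k.1).D.E).repr (chartAt (S.T k.1).D.E (y₀ k.1) z) k.2
  have hlift : ∀ k : κ, ∃ F : T.D.carrier → ℂ, ∀ᶠ x' in 𝓝 x,
      ∀ (hT' : x' ∈ T.U) (hS' : x' ∈ (S.T k.1).U),
        ∃ s, (S.T k.1).Pulls x' hS' (h k) s ∧ T.Pulls x' hT' F s := by
    intro k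
    let W : Opens (S.T k.1).D.carrier :=
      ⟨(chartAt (S.T k.1).D.E (y₀ k.1)).source, (chartAt (S.T k.1).D.E (y₀ k.1)).open_source⟩
    have hh : ∀ z ∈ W, ContMDiffAt 𝓘(ℂ, (S.T k.1).D.E) 𝓘(ℂ, ℂ) ω (h k) z := fun z hz => by
      have h1 : ContMDiff 𝓘(ℂ, (S.T k.1).D.E) 𝓘(ℂ, ℂ) ω
          ((Module.finBasis ℂ (S.T k.1).D.E).coord k.2).toContinuousLinearMap :=
        ContinuousLinearMap.contMDiff _
      exact h1.contMDiffAt.comp z (holAt_chart hz)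
    let H : Hol (S.T k.1).D W := ⟨fun z => h k z.1, fun z =>
      contMDiffAt_subtype_iff.2 (hh z.1 z.2)⟩
    exact EmbeddingTriple.exists_lift (S.mem k.1) hT W (mem_chart_source _ _) H (h k)
      fun z => rfl
  choose F hF using hlift
  let g : (famD fun _ : Fin 1 => T).carrier → E' := fun z => ∑ k, F k (z 0) • famBasis S.T k
  have hgr : ∀ z k, (famBasis S.T).repr (g z) k = F k (z 0) := fun z k =>
    congrFun ((famBasis S.T).repr_sum_self _) k
  refine ⟨pullback (famD fun _ : Fin 1 => T).E E' g (localRep E' y₀ η), ?_⟩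
  have hsrc := continuousAt_famPt S.T S.mem (s := (chartAt E' y₀).source)
    ((chartAt E' y₀).open_source.mem_nhds (mem_chart_source E' y₀))
  filter_upwards [eventually_all.2 hF, hsrc] with x' hx' hsrc' hT' hS' hη
  -- The two classes are compared on the embedding in the product of all the ambient manifolds.
  let R : Fin (S.m + 1 + 1) → EmbeddingTriple X := Fin.cons T S.T
  have hR : ∀ a, x' ∈ (R a).U := Fin.cases hT' hS'
  let y : (famD R).carrier := famPt R hR
  let π : (famD R).carrier → (famD S.T).carrier := famMap Fin.succ R
  let π' : (famD R).carrier → (famD fun _ : Fin 1 => T).carrier := famMap (fun _ : Fin 1 => 0) R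
  let f : (famD R).carrier → E' := chartAt E' y₀ ∘ π
  let g' : (famD R).carrier → E' := g ∘ π'
  have hy : π y ∈ (chartAt E' y₀).source := hsrc' hS'
  have hπ : HolAt (famD R).E E' π y := holAt_famMap Fin.succ R y
  have hπ' : HolAt (famD R).E (famD fun _ : Fin 1 => T).E π' y :=
    holAt_famMap (fun _ : Fin 1 => 0) R y
  have hf : HolAt (famD R).E E' f y := ContMDiffAt.comp y (holAt_chart hy) hπ
  have hFk : ∀ k, ContMDiffAt 𝓘(ℂ, T.D.E) 𝓘(ℂ, ℂ) ω (F k) (T.k ⟨x', hT'⟩) := fun k => by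
    obtain ⟨s, -, hs⟩ := hx' k hT' (hS' k.1)
    exact hs.holAt
  have hg : HolAt (famD fun _ : Fin 1 => T).E E' g (famPt (fun _ : Fin 1 => T) fun _ => hT') := by
    have h1 : ∀ k, ContMDiffAt 𝓘(ℂ, (famD fun _ : Fin 1 => T).E) 𝓘(ℂ, E') ω
        (fun z : (famD fun _ : Fin 1 => T).carrier => F k (z 0) • famBasis S.T k)
        (famPt (fun _ : Fin 1 => T) fun _ => hT') := fun k => by
      have h2 : ContMDiff 𝓘(ℂ, ℂ) 𝓘(ℂ, E') ω
          (ContinuousLinearMap.toSpanSingleton ℂ (famBasis S.T k)) :=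
        ContinuousLinearMap.contMDiff _
      exact h2.contMDiffAt.comp (famPt (fun _ : Fin 1 => T) fun _ => hT')
        (ContMDiffAt.comp (g := F k) (famPt (fun _ : Fin 1 => T) fun _ => hT') (hFk k)
          (ComplexManifold.holAt_eval (fun _ : Fin 1 => T.D) 0 _))
    exact ContMDiffAt.sum fun k _ => h1 k
  have hg' : HolAt (famD R).E E' g' y := ContMDiffAt.comp y hg hπ'
  have hfr : ∀ z k, (famBasis S.T).repr (f z) k = h k (z k.1.succ) := fun z k =>
    famBasis_repr S.T _ k
  have hfg : f y = g' y := by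
    apply (famBasis S.T).repr.injective
    ext k
    rw [hfr]
    refine Eq.trans ?_ (hgr _ k).symm
    obtain ⟨s, hs, hs'⟩ := hx' k hT' (hS' k.1)
    exact hs.eq_value hs'
  have hu : ∀ k, ∃ G ∈ famIdeal R hR,
      G =ᶠ[𝓝 y] fun z => (famBasis S.T).repr (f z - g' z) k := fun k => by
    obtain ⟨s, hs, hs'⟩ := hx' k hT' (hS' k.1)
    refine ⟨fun z => 1 * (h k (z k.1.succ) - F k (z 0)), Submodule.subset_span
      ⟨fun _ => 1, contMDiffAt_const, k.1.succ, 0, s, h k, F k, hs, hs', rfl⟩,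
      Eventually.of_forall fun z => ?_⟩
    have h1 : (famBasis S.T).repr (f z - g' z) k = h k (z k.1.succ) - F k (z 0) := by
      rw [map_sub, Finsupp.sub_apply, hfr]
      exact congrArg (h k (z k.1.succ) - ·) (hgr _ k)
    exact (one_mul _).trans h1.symm
  have hrep : ∀ᶠ v in 𝓝 (f y), SmoothAt E' (localRep E' y₀ η) v := by
    have h1 : f y ∈ (chartAt E' y₀).target := (chartAt E' y₀).map_source hy
    have h2 : HolAt E' E' (chartAt E' y₀).symm (f y) := holAt_chart_symm h1
    have h3 : (chartAt E' y₀).symm (f y) = famPt S.T hS' := (chartAt E' y₀).left_inv hy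
    have h4 : Tendsto (chartAt E' y₀).symm (𝓝 (f y)) (𝓝 (famPt S.T hS')) := by
      have := h2.continuousAt
      rwa [ContinuousAt, h3] at this
    filter_upwards [h2.eventually, h4.eventually hη] with v h5 h6 using SmoothAt.pullback h5 h6
  have hrep' : ∀ᶠ v in 𝓝 (g (famPt (fun _ : Fin 1 => T) fun _ => hT')),
      SmoothAt E' (localRep E' y₀ η) v := by
    have : g (famPt (fun _ : Fin 1 => T) fun _ => hT') = f y := hfg.symm
    rwa [this]
  have hη' := pullback_mem_vec hg hrep'
  refine ⟨hη', ?_⟩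
  have e1 := SmoothFormStalk.of_pull ⟨S.m + 1, R, hR⟩ Fin.succ q
    (ModelStalk.mk hS' q (FormGerm.mk ⟨η, hη⟩))
  have e2 := SmoothFormStalk.of_pull ⟨S.m + 1, R, hR⟩ (fun _ : Fin 1 => 0) q
    (ModelStalk.mk (T := fun _ : Fin 1 => T) (fun _ => hT') q (FormGerm.mk ⟨_, hη'⟩))
  refine e1.symm.trans (Eq.trans ?_ e2)
  refine congrArg (SmoothFormStalk.of ⟨S.m + 1, R, hR⟩ q) ?_
  refine ModelStalk.mk_eq_of_inM hR (pullback_mem (y := y) hπ ⟨η, hη⟩)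
    (pullback_mem (y := y) hπ' ⟨_, hη'⟩) ?_
  refine (InM.sub_pullback (b := famBasis S.T) (famIdeal_hol R hR) hf hg' hu hfg hrep).congr ?_
  have e3 := pullback_chart (y' := y₀) hπ hy η
  have e4 : pullback (famD R).E E' g' (localRep E' y₀ η) =ᶠ[𝓝 y]
      pullback (famD R).E (famD fun _ : Fin 1 => T).E π'
        (pullback (famD fun _ : Fin 1 => T).E E' g (localRep E' y₀ η)) := by
    filter_upwards [hπ'.eventually, hπ'.continuousAt.eventually hg.eventually] with z h1 h2
    exact pullback_comp h2 h1 _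
  filter_upwards [e3, e4] with z h3 h4
  exact congrArg₂ (· - ·) h3 h4.symm

end LocalLift

/-! ### The operation of functions on the sheaf of smooth forms -/

section FunctionModule

variable {X : ComplexRingedSpace.{u}} {x : X.top} {q : ℕ}

/-- Multiplication of classes of forms by a smooth function on the ambient manifold. -/
def ModelStalk.smul {m : ℕ} {T : Fin m → EmbeddingTriple X} (hx : ∀ a, x ∈ (T a).U)
    (ρ : (famD T).carrier → ℂ) (hρ : ∀ᶠ z in 𝓝 (famPt T hx), SmoothFun (famD T).E ρ z) :
    ModelStalk T hx q →ₗ[ℂ] ModelStalk T hx q :=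
  Submodule.mapQ _ _ (smulGerm ρ hρ) (relM_smul (famIdeal_hol T hx) hρ)

lemma smoothFun_eval {m : ℕ} {T : Fin m → EmbeddingTriple X} {z : (famD T).carrier} (a : Fin m)
    {ρ : (T a).D.carrier → ℂ} (hρ : SmoothFun (T a).D.E ρ (z a)) :
    SmoothFun (famD T).E (fun z : (famD T).carrier => ρ (z a)) z :=
  SmoothFun.comp (F := fun z : (famD T).carrier => z a) hρ (ComplexManifold.holAt_eval _ a z)

lemma eventually_smoothFun_eval {m : ℕ} {T : Fin m → EmbeddingTriple X} {z : (famD T).carrier}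
    (a : Fin m) {ρ : (T a).D.carrier → ℂ}
    (hρ : ∀ᶠ w in 𝓝 (z a), SmoothFun (T a).D.E ρ w) :
    ∀ᶠ w in 𝓝 z, SmoothFun (famD T).E (fun z : (famD T).carrier => ρ (z a)) w := by
  have hc : ContinuousAt (fun z : (famD T).carrier => z a) z := (continuous_apply a).continuousAt
  filter_upwards [hc.eventually hρ] with w hw using smoothFun_eval a hw

/-- The class of `ρ(z 0) η`, where `η` is a form on the product of the factors of index `≥ 1`. -/
def consSmul {m : ℕ} (Q : Fin (m + 1 + 1) → EmbeddingTriple X) (hQ : ∀ a, x ∈ (Q a).U)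
    (ρ : (Q 0).D.carrier → ℂ)
    (hρ : ∀ᶠ w in 𝓝 ((Q 0).k ⟨x, hQ 0⟩), SmoothFun (Q 0).D.E ρ w) :
    ModelStalk (Q ∘ Fin.succ) (fun a => hQ a.succ) q →ₗ[ℂ] SmoothFormStalk x q :=
  SmoothFormStalk.of ⟨m + 1, Q, hQ⟩ q ∘ₗ
    ModelStalk.smul hQ (fun z => ρ (z 0)) (eventually_smoothFun_eval (z := famPt Q hQ) 0 hρ) ∘ₗ
    ModelStalk.pull Fin.succ hQ q

lemma mem_cons {m : ℕ} {T : EmbeddingTriple X} {S : Fin m → EmbeddingTriple X} (hT : x ∈ T.U)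
    (hS : ∀ a, x ∈ (S a).U) (a : Fin (m + 1)) :
    x ∈ ((Fin.cons T S : Fin (m + 1) → EmbeddingTriple X) a).U :=
  Fin.cases hT hS a

/-- The class of `ρ(z b) η`, for the pullback `η` of a form `s` from the factors of the indices `i`,
may be computed on the factors of the indices `b` and `i`. The family `Q` of these factors is a
variable, to be substituted by families which are equal to it by extensionality only; therefore the
function and the form on it are compared by heterogeneous equalities. -/
lemma of_smul_pull (R : EmbeddingsAt x) {m : ℕ} (i : Fin (m + 1) → Fin (R.m + 1))
    (b : Fin (R.m + 1)) (ρ : (R.T b).D.carrier → ℂ)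
    (hρ : ∀ᶠ w in 𝓝 ((R.T b).k ⟨x, R.mem b⟩), SmoothFun (R.T b).D.E ρ w)
    (s : ModelStalk (R.T ∘ i) (fun a => R.mem (i a)) q)
    {Q : Fin (m + 1 + 1) → EmbeddingTriple X}
    (e : Q = R.T ∘ (Fin.cons b i : Fin (m + 1 + 1) → Fin (R.m + 1)))
    (hQ : ∀ a, x ∈ (Q a).U) {ρ' : (Q 0).D.carrier → ℂ} (eρ : HEq ρ' ρ)
    (hρ' : ∀ᶠ w in 𝓝 ((Q 0).k ⟨x, hQ 0⟩), SmoothFun (Q 0).D.E ρ' w)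
    {s' : ModelStalk (Q ∘ Fin.succ) (fun a => hQ a.succ) q} (es : HEq s' s) :
    SmoothFormStalk.of R q (ModelStalk.smul R.mem (fun z => ρ (z b))
      (eventually_smoothFun_eval (z := famPt R.T R.mem) b hρ) (ModelStalk.pull i R.mem q s)) =
    consSmul Q hQ ρ' hρ' s' := by
  subst e
  obtain rfl : ρ' = ρ := eq_of_heq eρ
  obtain rfl : s' = s := eq_of_heq es
  let f : Fin (m + 1 + 1) → Fin (R.m + 1) := Fin.cons b i
  refine Eq.trans ?_ (SmoothFormStalk.of_pull R f q _)
  refine congrArg (SmoothFormStalk.of R q) ?_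
  obtain ⟨t, rfl⟩ := ModelStalk.mk_surjective _ q s'
  obtain ⟨η, rfl⟩ := Submodule.mkQ_surjective _ t
  refine congrArg (ModelStalk.mk R.mem q) (FormGerm.mk_eq (Eventually.of_forall fun z => ?_))
  have h1 := pullback_comp (F := famMap f R.T) (G := famMap Fin.succ (R.T ∘ f))
    (holAt_famMap Fin.succ (R.T ∘ f) _) (holAt_famMap f R.T z) η.1
  ext v
  exact congrArg (fun w : Alt (famD R.T).E q => ρ' (z b) * w v) h1

/-- `consSmul` is compatible with the transition maps between families of embedding triples. -/
lemma consSmul_pull {n m : ℕ} (Q : Fin (n + 1 + 1) → EmbeddingTriple X) (hQ : ∀ a, x ∈ (Q a).U)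
    (ρ : (Q 0).D.carrier → ℂ)
    (hρ : ∀ᶠ w in 𝓝 ((Q 0).k ⟨x, hQ 0⟩), SmoothFun (Q 0).D.E ρ w)
    {S : Fin (n + 1) → EmbeddingTriple X} (eS : S = Q ∘ Fin.succ) (hS : ∀ a, x ∈ (S a).U)
    (f : Fin (m + 1) → Fin (n + 1)) (s : ModelStalk (S ∘ f) (fun a => hS (f a)) q)
    {t : ModelStalk (Q ∘ Fin.succ) (fun a => hQ a.succ) q} (et : HEq t (ModelStalk.pull f hS q s))
    {Q' : Fin (m + 1 + 1) → EmbeddingTriple X}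
    (e : Q' = Q ∘ (Fin.cons 0 (Fin.succ ∘ f) : Fin (m + 1 + 1) → Fin (n + 1 + 1)))
    (hQ' : ∀ a, x ∈ (Q' a).U) {ρ' : (Q' 0).D.carrier → ℂ} (eρ : HEq ρ' ρ)
    (hρ' : ∀ᶠ w in 𝓝 ((Q' 0).k ⟨x, hQ' 0⟩), SmoothFun (Q' 0).D.E ρ' w)
    {s' : ModelStalk (Q' ∘ Fin.succ) (fun a => hQ' a.succ) q} (es : HEq s' s) :
    consSmul Q hQ ρ hρ t = consSmul Q' hQ' ρ' hρ' s' := by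
  subst eS
  obtain rfl := eq_of_heq et
  refine Eq.trans ?_ (of_smul_pull ⟨n + 1, Q, hQ⟩ (Fin.succ ∘ f) 0 ρ hρ s e hQ' eρ hρ' es)
  refine congrArg (fun t => SmoothFormStalk.of ⟨n + 1, Q, hQ⟩ q
    (ModelStalk.smul hQ _ (eventually_smoothFun_eval (z := famPt Q hQ) 0 hρ) t)) ?_
  obtain ⟨t, rfl⟩ := ModelStalk.mk_surjective _ q s
  obtain ⟨η, rfl⟩ := Submodule.mkQ_surjective _ t
  refine congrArg (ModelStalk.mk _ q) (FormGerm.mk_eq (Eventually.of_forall fun z => ?_))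
  exact (pullback_comp (F := famMap Fin.succ Q) (G := famMap f (Q ∘ Fin.succ))
    (holAt_famMap f (Q ∘ Fin.succ) _) (holAt_famMap _ _ z) η.1).symm

open Classical in
/-- The operation of a smooth function on an ambient manifold on the sum of the spaces of classes
of forms on all the embeddings. -/
def smulAux (T : EmbeddingTriple X) (hT : x ∈ T.U) (ρ : T.D.carrier → ℂ)
    (hρ : ∀ᶠ w in 𝓝 (T.k ⟨x, hT⟩), SmoothFun T.D.E ρ w) :
    DirectSum (EmbeddingsAt x) (fun S => ModelStalk S.T S.mem q) →ₗ[ℂ] SmoothFormStalk x q :=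
  DirectSum.toModule ℂ (EmbeddingsAt x) _
    fun S => consSmul (Fin.cons T S.T) (mem_cons hT S.mem) ρ hρ

open Classical in
lemma smulAux_lof (T : EmbeddingTriple X) (hT : x ∈ T.U) (ρ : T.D.carrier → ℂ)
    (hρ : ∀ᶠ w in 𝓝 (T.k ⟨x, hT⟩), SmoothFun T.D.E ρ w) (S : EmbeddingsAt x)
    (s : ModelStalk S.T S.mem q) :
    smulAux T hT ρ hρ (DirectSum.lof ℂ (EmbeddingsAt x) (fun S => ModelStalk S.T S.mem q) S s) =
      consSmul (Fin.cons T S.T) (mem_cons hT S.mem) ρ hρ s :=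
  DirectSum.toModule_lof (R := ℂ) (M := fun S : EmbeddingsAt x => ModelStalk S.T S.mem q)
    (φ := fun S => consSmul (Fin.cons T S.T) (mem_cons hT S.mem) ρ hρ) S s

lemma smoothFormRel_le_ker (T : EmbeddingTriple X) (hT : x ∈ T.U) (ρ : T.D.carrier → ℂ)
    (hρ : ∀ᶠ w in 𝓝 (T.k ⟨x, hT⟩), SmoothFun T.D.E ρ w) :
    smoothFormRel x q ≤ LinearMap.ker (smulAux T hT ρ hρ) := by
  refine Submodule.span_le.2 ?_
  rintro _ ⟨S, m, f, s, rfl⟩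
  rw [SetLike.mem_coe, LinearMap.mem_ker, map_sub, sub_eq_zero]
  have h1 := smulAux_lof T hT ρ hρ S (ModelStalk.pull f S.mem q s)
  have h2 := smulAux_lof T hT ρ hρ (S.reindex f) s
  refine h1.trans (Eq.trans ?_ h2.symm)
  refine consSmul_pull (Fin.cons T S.T) (mem_cons hT S.mem) ρ hρ ?_ S.mem f s HEq.rfl ?_ _ HEq.rfl
    hρ HEq.rfl
  · rfl
  · funext a
    exact Fin.cases rfl (fun _ => rfl) a

/-- Multiplication by a smooth function on an ambient manifold, as an operation on the stalk of the
sheaf of smooth forms on `X`. It is defined on all the classes of forms at once, since a class does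
not determine an embedding: a form on the ambient manifold of `S` is multiplied after pullback to the
product with `T.D`. -/
def SmoothFormStalk.smul (T : EmbeddingTriple X) (hT : x ∈ T.U) (ρ : T.D.carrier → ℂ)
    (hρ : ∀ᶠ w in 𝓝 (T.k ⟨x, hT⟩), SmoothFun T.D.E ρ w) :
    SmoothFormStalk x q →ₗ[ℂ] SmoothFormStalk x q :=
  Submodule.liftQ _ (smulAux T hT ρ hρ) (smoothFormRel_le_ker T hT ρ hρ)

lemma SmoothFormStalk.smul_of (S : EmbeddingsAt x) (b : Fin (S.m + 1)) (ρ : (S.T b).D.carrier → ℂ)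
    (hρ : ∀ᶠ w in 𝓝 ((S.T b).k ⟨x, S.mem b⟩), SmoothFun (S.T b).D.E ρ w)
    (s : ModelStalk S.T S.mem q) :
    SmoothFormStalk.smul (S.T b) (S.mem b) ρ hρ (SmoothFormStalk.of S q s) =
      SmoothFormStalk.of S q (ModelStalk.smul S.mem (fun z => ρ (z b))
        (eventually_smoothFun_eval (z := famPt S.T S.mem) b hρ) s) := by
  classical
  refine Eq.trans (smulAux_lof (S.T b) (S.mem b) ρ hρ S s) ?_
  refine Eq.trans (of_smul_pull S id b ρ hρ s ?_ _ HEq.rfl hρ HEq.rfl).symm ?_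
  · funext a
    exact Fin.cases rfl (fun _ => rfl) a
  refine congrArg (fun t => SmoothFormStalk.of S q (ModelStalk.smul _ _ _ t)) ?_
  obtain ⟨t, rfl⟩ := ModelStalk.mk_surjective _ q s
  obtain ⟨η, rfl⟩ := Submodule.mkQ_surjective _ t
  refine congrArg (ModelStalk.mk _ q) (FormGerm.mk_eq (Eventually.of_forall fun z => ?_))
  exact congrFun (pullback_id η.1) z

end FunctionModule

/-! ### Partitions of unity on paracompact complex manifolds -/

section PartitionOfUnity

/-- A point of a locally compact paracompact Hausdorff space has a σ-compact clopen neighbourhood: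
it is the set of the points reached by finite chains of members of a locally finite covering by
relatively compact open sets. -/
lemma exists_isClopen_isSigmaCompact {Y : Type*} [TopologicalSpace Y] [T2Space Y]
    [LocallyCompactSpace Y] [ParacompactSpace Y] (y : Y) :
    ∃ S : Set Y, IsClopen S ∧ IsSigmaCompact S ∧ y ∈ S := by
  choose K hK hyK using fun z : Y => exists_compact_mem_nhds z
  obtain ⟨κ, v, hvo, hvc, hvf, hvK⟩ := ParacompactSpace.locallyFinite_refinement Y
    (fun z => interior (K z)) (fun _ => isOpen_interior)
    (Set.eq_univ_of_forall fun z => Set.mem_iUnion.2 ⟨z, mem_interior_iff_mem_nhds.2 (hyK z)⟩)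
  have hcpt : ∀ i, IsCompact (closure (v i)) := fun i => by
    obtain ⟨z, hz⟩ := hvK i
    exact (hK z).closure_of_subset (hz.trans interior_subset)
  -- The compact set `next C` contains all the members of the covering which meet `C`.
  let next : Set Y → Set Y := fun C => ⋃ i ∈ {i | (v i ∩ C).Nonempty}, closure (v i)
  have hnext : ∀ C, IsCompact C → IsCompact (next C) := fun C hC =>
    (hvf.finite_nonempty_inter_compact hC).isCompact_biUnion fun i _ => hcpt i
  let Q : ℕ → Set Y := fun n => next^[n] {y}
  have hQs : ∀ n, Q (n + 1) = next (Q n) := fun n => Function.iterate_succ_apply' next n {y}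
  have hQ : ∀ n, IsCompact (Q n) := fun n => by
    induction n with
    | zero => exact isCompact_singleton
    | succ n ih => rw [hQs]; exact hnext _ ih
  have hmem : ∀ z, ∃ i, z ∈ v i := fun z =>
    Set.mem_iUnion.1 (hvc.symm ▸ Set.mem_univ z)
  have hsub : ∀ n i, (v i ∩ Q n).Nonempty → v i ⊆ ⋃ n, Q n := fun n i h =>
    (subset_closure.trans (Set.subset_biUnion_of_mem (u := fun i => closure (v i)) h)).trans
      ((hQs n).symm.subset.trans (Set.subset_iUnion Q (n + 1)))
  refine ⟨⋃ n, Q n, ⟨?_, ?_⟩, isSigmaCompact_iUnion_of_isCompact Q hQ,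
    Set.mem_iUnion.2 ⟨0, rfl⟩⟩
  · refine isClosed_of_closure_subset fun z hz => ?_
    obtain ⟨i, hi⟩ := hmem z
    obtain ⟨w, hwi, hw⟩ := mem_closure_iff.1 hz (v i) (hvo i) hi
    obtain ⟨n, hn⟩ := Set.mem_iUnion.1 hw
    exact hsub n i ⟨w, hwi, hn⟩ hi
  · refine isOpen_iff_mem_nhds.2 fun z hz => ?_
    obtain ⟨i, hi⟩ := hmem z
    obtain ⟨n, hn⟩ := Set.mem_iUnion.1 hz
    exact mem_of_superset ((hvo i).mem_nhds hi) (hsub n i ⟨z, hi, hn⟩)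

variable (D : ComplexManifold.{u})

/-- The underlying real manifold. -/
lemma isManifold_real : IsManifold 𝓘(ℝ, D.E) ∞ D.carrier := by
  refine isManifold_of_contDiffOn _ _ _ fun e e' he he' => ?_
  have h := HasGroupoid.compatible (G := contDiffGroupoid ω 𝓘(ℂ, D.E)) he he'
  have h1 : ContDiffOn ℂ ω _ _ := (mem_groupoid_of_pregroupoid.1 h).1
  have h2 := (h1.restrict_scalars ℝ).of_le (m := ∞) (by simp)
  exact h2

variable {D}

/-- Smooth partitions of unity on an open subset of a connected component, extended by zero. -/
lemma exists_partition_component [T2Space D.carrier] [ParacompactSpace D.carrier] {J : Type*}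
    (O : J → Set D.carrier) (hO : ∀ j, IsOpen (O j)) (y₀ : D.carrier) :
    ∃ R : J → D.carrier → ℝ, ∀ y ∈ connectedComponent y₀ ∩ ⋃ j, O j,
      (∀ j, SmoothFun D.E (fun z => (R j z : ℂ)) y) ∧
      ∃ F : Finset J, (∀ j ∈ F, y ∈ O j) ∧
        ∀ᶠ z in 𝓝 y, (∀ j ∉ F, R j z = 0) ∧ ∑ j ∈ F, R j z = 1 := by
  classical
  have : FiniteDimensional ℝ D.E := FiniteDimensional.complexToReal D.E
  have := isManifold_real D
  have : LocallyCompactSpace D.carrier := ChartedSpace.locallyCompactSpace D.E D.carrier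
  have : LocallyConnectedSpace D.carrier := ChartedSpace.locallyConnectedSpace D.E D.carrier
  let C : Opens D.carrier := ⟨connectedComponent y₀, isOpen_connectedComponent⟩
  let W : Opens D.carrier := ⟨connectedComponent y₀ ∩ ⋃ j, O j,
    isOpen_connectedComponent.inter (isOpen_iUnion hO)⟩
  obtain ⟨S, hS, hS', hy₀⟩ := exists_isClopen_isSigmaCompact y₀
  have : SigmaCompactSpace C := isSigmaCompact_iff_sigmaCompactSpace.1
    (hS'.of_isClosed_subset isClosed_connectedComponent (hS.connectedComponent_subset hy₀))
  have : SecondCountableTopology C := ChartedSpace.secondCountable_of_sigmaCompact D.E C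
  have hWC : W ≤ C := Set.inter_subset_left
  have : SecondCountableTopology W :=
    (Topology.IsEmbedding.inclusion hWC).secondCountableTopology
  have : LocallyCompactSpace W := ChartedSpace.locallyCompactSpace D.E W
  obtain ⟨ρ, hρ⟩ := SmoothPartitionOfUnity.exists_isSubordinate 𝓘(ℝ, D.E)
    (isClosed_univ (X := W)) (fun j => Subtype.val ⁻¹' O j)
    (fun j => (hO j).preimage continuous_subtype_val) (fun z _ => by
      obtain ⟨j, hj⟩ := Set.mem_iUnion.1 z.2.2
      exact Set.mem_iUnion.2 ⟨j, hj⟩)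
  -- The extension by zero is not smooth on the boundary of `W`, where nothing is claimed.
  let R : J → D.carrier → ℝ := fun j z => if h : z ∈ W then ρ j ⟨z, h⟩ else 0
  have hR : ∀ j (z : W), R j z = ρ j z := fun j z => dif_pos z.2
  refine ⟨R, fun y hy => ⟨fun j => ?_, ρ.fintsupport ⟨y, hy⟩, fun j hj => ?_, ?_⟩⟩
  · have h1 : ContMDiffAt 𝓘(ℝ, D.E) 𝓘(ℝ, ℝ) ∞ (fun z : W => R j z) ⟨y, hy⟩ := by
      rw [show (fun z : W => R j z) = ρ j from funext (hR j)]
      exact (ρ j).contMDiff _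
    have h2 := (contMDiffAt_iff.1 (contMDiffAt_subtype_iff.1 h1)).2
    rw [modelWithCornersSelf_coe, Set.range_id, contDiffWithinAt_univ] at h2
    exact Complex.ofRealCLM.contDiff.contDiffAt.comp _ h2
  · exact hρ j ((ρ.mem_fintsupport_iff _ j).1 hj)
  · have hm : map Subtype.val (𝓝 (⟨y, hy⟩ : W)) = 𝓝 y :=
      W.isOpen.isOpenEmbedding_subtypeVal.map_nhds_eq ⟨y, hy⟩
    rw [← hm, eventually_map]
    filter_upwards [ρ.eventually_finsupport_subset ⟨y, hy⟩] with z hz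
    simp only [hR]
    refine ⟨fun j hj => ?_, ρ.sum_finsupport' z (Set.mem_univ z) hz⟩
    by_contra h
    exact hj (hz ((ρ.mem_finsupport z).2 h))

/-- A family of open subsets of a paracompact complex manifold has a smooth partition of unity on
its union; outside of the union, the functions are arbitrary. The manifold may have uncountably many connected components, which are treated one by
one. -/
lemma exists_partition [T2Space D.carrier] [ParacompactSpace D.carrier] {J : Type*}
    (O : J → Set D.carrier) (hO : ∀ j, IsOpen (O j)) :
    ∃ R : J → D.carrier → ℝ, ∀ y ∈ ⋃ j, O j,
      (∀ j, SmoothFun D.E (fun z => (R j z : ℂ)) y) ∧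
      ∃ F : Finset J, (∀ j ∈ F, y ∈ O j) ∧
        ∀ᶠ z in 𝓝 y, (∀ j ∉ F, R j z = 0) ∧ ∑ j ∈ F, R j z = 1 := by
  have : LocallyConnectedSpace D.carrier := ChartedSpace.locallyConnectedSpace D.E D.carrier
  choose R hR using fun c : ConnectedComponents D.carrier =>
    exists_partition_component O hO c.out
  refine ⟨fun j z => R (ConnectedComponents.mk z) j z, fun y hy => ?_⟩
  have hc : ∀ᶠ z in 𝓝 y, ConnectedComponents.mk z = ConnectedComponents.mk y := by
    filter_upwards [isOpen_connectedComponent.mem_nhds (mem_connectedComponent (x := y))] with z hz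
    exact ConnectedComponents.coe_eq_coe'.2 hz
  have hy' : y ∈ connectedComponent (Quotient.out (ConnectedComponents.mk y)) :=
    ConnectedComponents.coe_eq_coe'.1 (Quotient.out_eq (ConnectedComponents.mk y)).symm
  obtain ⟨h1, F, hF, h2⟩ := hR (ConnectedComponents.mk y) y ⟨hy', hy⟩
  refine ⟨fun j => (h1 j).congr ?_, F, hF, ?_⟩
  · filter_upwards [hc] with z hz
    rw [hz]
  · filter_upwards [h2, hc] with z hz hcz
    simp only [hcz]
    exact hz

end PartitionOfUnity

/-! ### Lifting of sections -/

section Lift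

variable {X : ComplexRingedSpace.{u}} {x : X.top} {q : ℕ}

/-- `s` is the element of the stalk of `ℰ^{0,q}_X` given by the form `η` on the product of the
ambient manifolds of `S`. -/
def SmoothFormStalk.Rep (S : EmbeddingsAt x) (η : (famD S.T).carrier → Alt (famD S.T).E q)
    (s : SmoothFormStalk x q) : Prop :=
  ∃ h : η ∈ smoothForms (famD S.T) (famPt S.T S.mem) q,
    s = SmoothFormStalk.of S q (ModelStalk.mk S.mem q (FormGerm.mk ⟨η, h⟩))

namespace SmoothFormStalk.Rep

variable {S : EmbeddingsAt x} {η η' : (famD S.T).carrier → Alt (famD S.T).E q}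
  {s s' : SmoothFormStalk x q}

lemma zero : Rep S (0 : (famD S.T).carrier → Alt (famD S.T).E q) 0 :=
  ⟨Submodule.zero_mem _, (map_zero (SmoothFormStalk.of S q ∘ₗ ModelStalk.mk S.mem q ∘ₗ
    FormGerm.mk)).symm⟩

lemma add (h : Rep S η s) (h' : Rep S η' s') : Rep S (η + η') (s + s') := by
  obtain ⟨h, rfl⟩ := h
  obtain ⟨h', rfl⟩ := h'
  exact ⟨Submodule.add_mem _ h h', (map_add (SmoothFormStalk.of S q ∘ₗ ModelStalk.mk S.mem q ∘ₗ
    FormGerm.mk) ⟨η, h⟩ ⟨η', h'⟩).symm⟩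

lemma const_smul (c : ℂ) (h : Rep S η s) : Rep S (c • η) (c • s) := by
  obtain ⟨h, rfl⟩ := h
  exact ⟨Submodule.smul_mem _ c h, ((SmoothFormStalk.of S q ∘ₗ ModelStalk.mk S.mem q ∘ₗ
    FormGerm.mk).map_smul c ⟨η, h⟩).symm⟩

lemma sum {κ : Type*} {η : κ → (famD S.T).carrier → Alt (famD S.T).E q}
    {s : κ → SmoothFormStalk x q} {F : Finset κ} (h : ∀ i ∈ F, Rep S (η i) (s i)) :
    Rep S (∑ i ∈ F, η i) (∑ i ∈ F, s i) := by
  classical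
  induction F using Finset.induction_on with
  | empty => simpa using zero
  | insert i F hi ih =>
    rw [Finset.sum_insert hi, Finset.sum_insert hi]
    exact (h i (Finset.mem_insert_self i F)).add
      (ih fun j hj => h j (Finset.mem_insert_of_mem hj))

lemma congr (h : Rep S η s) (e : η' =ᶠ[𝓝 (famPt S.T S.mem)] η) : Rep S η' s := by
  obtain ⟨h, rfl⟩ := h
  refine ⟨?_, ?_⟩
  · filter_upwards [h, e.eventuallyEq_nhds] with z hz hz' using SmoothAt.congr hz' hz
  · exact congrArg (fun t => SmoothFormStalk.of S q (ModelStalk.mk S.mem q t))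
      (FormGerm.mk_eq e.symm)

lemma unique (h : Rep S η s) (h' : Rep S η s') : s = s' := by
  obtain ⟨h, rfl⟩ := h
  obtain ⟨h', rfl⟩ := h'
  rfl

lemma pull {m : ℕ} {f : Fin (m + 1) → Fin (S.m + 1)}
    {η : (famD (S.T ∘ f)).carrier → Alt (famD (S.T ∘ f)).E q} (h : Rep (S.reindex f) η s) :
    Rep S (pullback (famD S.T).E (famD (S.T ∘ f)).E (famMap f S.T) η) s := by
  obtain ⟨h, rfl⟩ := h
  exact ⟨pullback_mem (y := famPt S.T S.mem) (holAt_famMap f S.T _) ⟨η, h⟩,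
    (SmoothFormStalk.of_pull S f q (ModelStalk.mk _ q (FormGerm.mk ⟨η, h⟩))).symm⟩

lemma smul {b : Fin (S.m + 1)} {ρ : (S.T b).D.carrier → ℂ}
    (hρ : ∀ᶠ w in 𝓝 ((S.T b).k ⟨x, S.mem b⟩), SmoothFun (S.T b).D.E ρ w) (h : Rep S η s) :
    Rep S (fun z => ρ (z b) • η z) (SmoothFormStalk.smul (S.T b) (S.mem b) ρ hρ s) := by
  obtain ⟨h, rfl⟩ := h
  exact ⟨_, SmoothFormStalk.smul_of S b ρ hρ _⟩

end SmoothFormStalk.Rep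

/-- Near a point of the intersection of the open sets of a family of embedding triples, sections of
`ℰ^{0,q}_X` are given by forms on the product of the ambient manifolds of the family. -/
lemma exists_local_rep {m : ℕ} (T : Fin (m + 1) → EmbeddingTriple X) (hx : ∀ a, x ∈ (T a).U)
    {g : ∀ x' : X.top, SmoothFormStalk x' q} (hg : g ∈ smoothFormLoc x q) :
    ∃ η : (famD T).carrier → Alt (famD T).E q, ∀ᶠ x' in 𝓝 x, ∀ hx' : ∀ a, x' ∈ (T a).U,
      SmoothFormStalk.Rep ⟨m, T, hx'⟩ η (g x') := by
  induction hg using Submodule.span_induction with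
  | mem g hg =>
    obtain ⟨S, η, h⟩ := hg
    obtain ⟨η', h'⟩ := exists_form_single S (T 0) (hx 0) η
    refine ⟨pullback (famD T).E (famD (T ∘ fun _ : Fin 1 => 0)).E (famMap (fun _ : Fin 1 => 0) T)
      η', ?_⟩
    filter_upwards [h, h'] with x' hx1 hx2 hx'
    obtain ⟨hS, _, ⟨hη, rfl⟩, e⟩ := hx1
    obtain ⟨hη', e'⟩ := hx2 (hx' 0) hS hη
    exact SmoothFormStalk.Rep.pull (S := ⟨m, T, hx'⟩) (f := fun _ : Fin 1 => 0)
      ⟨hη', e.trans e'⟩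
  | zero => exact ⟨0, Eventually.of_forall fun x' hx' => SmoothFormStalk.Rep.zero⟩
  | add g g' _ _ h h' =>
    obtain ⟨η, h⟩ := h
    obtain ⟨η', h'⟩ := h'
    refine ⟨η + η', ?_⟩
    filter_upwards [h, h'] with x' h1 h2 hx' using (h1 hx').add (h2 hx')
  | smul c g _ h =>
    obtain ⟨η, h⟩ := h
    exact ⟨c • η, h.mono fun x' h1 hx' => (h1 hx').const_smul c⟩

/-- A section of `ℰ^{0,q}_X` over an open subset of the intersection of the open sets of a family
of embedding triples which is locally given by forms on the product of the ambient manifolds is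
given by a single form. The partition of unity used lives on one factor only, so that its members
operate on the stalks of `ℰ^{0,q}_X`. -/
lemma exists_global_rep {m : ℕ} (T : Fin (m + 1) → EmbeddingTriple X) (V : Opens X.top)
    (s : ∀ x : X.top, SmoothFormStalk x q)
    (hs : ∀ x ∈ V, (∀ a, x ∈ (T a).U) → ∃ η : (famD T).carrier → Alt (famD T).E q,
      ∀ᶠ x' in 𝓝 x, ∀ hx' : ∀ a, x' ∈ (T a).U, SmoothFormStalk.Rep ⟨m, T, hx'⟩ η (s x')) :
    ∃ η : (famD T).carrier → Alt (famD T).E q, ∀ x ∈ V, ∀ hx : ∀ a, x ∈ (T a).U,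
      SmoothFormStalk.Rep ⟨m, T, hx⟩ η (s x) := by
  classical
  have := (T 0).t2
  have := (T 0).paracompact
  let J := {x : X.top // x ∈ V ∧ ∀ a, x ∈ (T a).U}
  choose η hη using fun j : J => hs j.1 j.2.1 j.2.2
  have hO : ∀ j : J, ∃ O : Set (T 0).D.carrier, IsOpen O ∧ (T 0).k ⟨j.1, j.2.2 0⟩ ∈ O ∧
      ∀ (x : X.top) (hx : ∀ a, x ∈ (T a).U), (T 0).k ⟨x, hx 0⟩ ∈ O →
        SmoothFormStalk.Rep ⟨m, T, hx⟩ (η j) (s x) := fun j => by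
    have h1 := (continuous_subtype_val.tendsto (⟨j.1, j.2.2 0⟩ : (T 0).U)).eventually (hη j)
    rw [(T 0).isClosedEmbedding.isInducing.nhds_eq_comap, eventually_comap] at h1
    obtain ⟨O, hO, hOo, hj⟩ := eventually_nhds_iff.1 h1
    exact ⟨O, hOo, hj, fun x hx hxO => hO _ hxO ⟨x, hx 0⟩ rfl hx⟩
  choose O hOo hjO hrep using hO
  obtain ⟨R, hR⟩ := exists_partition O hOo
  refine ⟨fun z => ∑ᶠ j, (R j (z 0) : ℂ) • η j z, fun x hxV hx => ?_⟩
  let j₀ : J := ⟨x, hxV, hx⟩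
  have hy : (T 0).k ⟨x, hx 0⟩ ∈ ⋃ j, O j := Set.mem_iUnion.2 ⟨j₀, hjO j₀⟩
  have hsm : ∀ j, ∀ᶠ w in 𝓝 ((T 0).k ⟨x, hx 0⟩), SmoothFun (T 0).D.E (fun z => (R j z : ℂ)) w :=
    fun j => by
      filter_upwards [(isOpen_iUnion hOo).mem_nhds hy] with w hw using (hR w hw).1 j
  obtain ⟨-, F, hF, hF'⟩ := hR _ hy
  have hc : ContinuousAt (fun z : (famD T).carrier => z 0) (famPt T hx) :=
    (continuous_apply 0).continuousAt
  have hev := hc.eventually hF'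
  have hsum : ∀ θ : J → (famD T).carrier → Alt (famD T).E q,
      (∀ j ∈ F, SmoothFormStalk.Rep ⟨m, T, hx⟩ (θ j) (s x)) →
      SmoothFormStalk.Rep ⟨m, T, hx⟩ (∑ j ∈ F, fun z => (R j (z 0) : ℂ) • θ j z)
        (∑ j ∈ F, SmoothFormStalk.smul (T 0) (hx 0) (fun z => (R j z : ℂ)) (hsm j) (s x)) :=
    fun θ hθ => SmoothFormStalk.Rep.sum fun j hj =>
      SmoothFormStalk.Rep.smul (S := ⟨m, T, hx⟩) (b := 0) (hsm j) (hθ j hj)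
  have hx₀ : SmoothFormStalk.Rep ⟨m, T, hx⟩ (η j₀) (s x) := hrep j₀ x hx (hjO j₀)
  -- The operators `R j` of the partition of unity add up to the identity.
  have hone : ∑ j ∈ F, SmoothFormStalk.smul (T 0) (hx 0) (fun z => (R j z : ℂ)) (hsm j) (s x) =
      s x := by
    refine SmoothFormStalk.Rep.unique ((hsum (fun _ => η j₀) fun _ _ => hx₀).congr ?_) hx₀
    filter_upwards [hev] with z hz
    rw [Finset.sum_apply, ← Finset.sum_smul, ← Complex.ofReal_sum, hz.2, Complex.ofReal_one,
      one_smul]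
  rw [← hone]
  refine (hsum η fun j hj => hrep j x hx (hF j hj)).congr ?_
  filter_upwards [hev] with z hz
  rw [Finset.sum_apply]
  refine finsum_eq_sum_of_support_subset _ fun j hj => ?_
  by_contra h
  have h0 : (R j (z 0) : ℂ) = 0 := Complex.ofReal_eq_zero.2 (hz.1 j h)
  exact hj ((congrArg (fun c : ℂ => c • η j z) h0).trans (zero_smul ℂ _))

end Lift

namespace EmbeddingAtlas

variable {X : AnalyticSpace.{u}} {ι : Type u} [LinearOrder ι] (A : EmbeddingAtlas X ι)

/-- The natural quotient morphism is surjective on the sections over every open set. -/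
lemma quotientMap_surjective (p q : ℕ) (V : Opens X.top) :
    Function.Surjective ((A.quotientMap p q).hom.app (op V)) := by
  classical
  intro (s : A.formSystem.sections p q V)
  have key : ∀ α : Fin (p + 1) ↪o ι, ∃ η : (famD (A.fam α)).carrier → Alt (famD (A.fam α)).E q,
      ∀ x : CoeffSystem.Pts A.cov V α,
        SmoothFormStalk.Rep ⟨p, A.fam α, x.1.2⟩ η (s.1 α x) := by
    intro α
    -- The section is extended by zero.
    let s' : ∀ x : X.top, SmoothFormStalk (X := X.toComplexRingedSpace) x q := fun x =>
      if hx : (∀ j, x ∈ A.cov (α j)) ∧ x ∈ V then s.1 α ⟨⟨x, hx.1⟩, hx.2⟩ else 0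
    have hs' : ∀ x : CoeffSystem.Pts A.cov V α, s' x.1.1 = s.1 α x := fun x =>
      dif_pos ⟨x.1.2, x.2⟩
    obtain ⟨η, hη⟩ := exists_global_rep (A.fam α) V s' fun x hxV hx => by
      obtain ⟨g, ⟨g', hg', hgg'⟩, hsg⟩ := s.2 α ⟨⟨x, hx⟩, hxV⟩
      obtain ⟨η, hη⟩ := exists_local_rep (A.fam α) hx hg'
      refine ⟨η, ?_⟩
      have h1 : ∀ᶠ x' : CoeffSystem.Pts A.cov V α in 𝓝 ⟨⟨x, hx⟩, hxV⟩, s.1 α x' = g' x'.1.1 := by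
        filter_upwards [hsg, continuous_subtype_val.continuousAt.eventually hgg'] with x' h h'
        exact h.trans h'
      have ho : IsOpen {x : X.top | (∀ j, x ∈ A.cov (α j)) ∧ x ∈ V} :=
        (A.isOpen_inter α).inter V.isOpen
      have h2 : ∀ᶠ x' in 𝓝 x, ∀ (hx' : ∀ j, x' ∈ A.cov (α j)) (hV : x' ∈ V),
          s.1 α ⟨⟨x', hx'⟩, hV⟩ = g' x' := by
        rw [nhds_subtype_eq_comap, nhds_subtype_eq_comap, comap_comap, eventually_comap] at h1
        exact h1.mono fun x' h hx' hV => h ⟨⟨x', hx'⟩, hV⟩ rfl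
      filter_upwards [hη, h2, V.isOpen.mem_nhds hxV] with x' h h' hV hx'
      have e : s' x' = g' x' := (hs' ⟨⟨x', hx'⟩, hV⟩).trans (h' hx' hV)
      rw [e]
      exact h hx'
    exact ⟨η, fun x => hs' x ▸ hη x.1.1 x.2 x.1.2⟩
  choose η hη using key
  choose hη' e using hη
  let t : ∀ (α : Fin (p + 1) ↪o ι) (x : Inter A.cov α), A.dolbSystem.S α q x := fun α x =>
    if h : η α ∈ smoothForms (famD (A.fam α)) (famPt (A.fam α) x.2) q then
      ULift.up (DolbStalk.mk x.2 q (FormGerm.mk ⟨η α, h⟩)) else 0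
  have ht : ∀ (α : Fin (p + 1) ↪o ι) (x : CoeffSystem.Pts A.cov V α), t α x.1 =
      ULift.up (DolbStalk.mk x.1.2 q (FormGerm.mk ⟨η α, hη' α x⟩)) := fun α x => dif_pos _
  have htV : (fun α (x : CoeffSystem.Pts A.cov V α) => t α x.1) ∈ A.dolbSystem.sections p q V := by
    refine fun α x => ⟨t α, ⟨η α, ?_⟩, Eventually.of_forall fun _ => rfl⟩
    filter_upwards [(V.isOpen.preimage continuous_subtype_val).mem_nhds x.2] with x' hx'
    exact ⟨hη' α ⟨x', hx'⟩, congrArg ULift.down (ht α ⟨x', hx'⟩)⟩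
  refine ⟨⟨_, htV⟩, Subtype.ext (funext fun α => funext fun x => ?_)⟩
  refine Eq.trans (congrArg (A.toForm α q x.1) (ht α x)) (e α x).symm

end EmbeddingAtlas

end DolbeaultForms
end

theorem theorem5p10 (X : DolbeaultForms.AnalyticSpace.{u}) (ι : Type u) [LinearOrder ι]
    (A : DolbeaultForms.EmbeddingAtlas X ι) :
    ∃ φ : A.dolb ⟶ A.cech,
      (∀ n : ℕ, Sheaf.IsLocallySurjective (φ.f n)) ∧
      ∀ (p q n : ℕ) (h : p + q = n),
        A.dolbSystem.inc p q n h ≫ φ.f n = A.quotientMap p q ≫ A.formSystem.inc p q n h := by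
  exact A.exists_total_hom fun p q V => A.quotientMap_surjective p q V
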